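/- **Setting.** Let $0<d<m<\infty$. Let $\mathscr X$ be a set with at least two points and $\rho:\mathscr X\times\mathscr X\to[0,\infty)$ a quasi-distance: $\rho(x,y)=0\iff x=y$, $\rho(y,x)\le\widetilde C_\rho\,\rho(x,y)$ and $\rho(x,y)\le C_\rho\max\{\rho(x,z),\rho(z,y)\}$, with constants $\widetilde C_\rho,C_\rho\in[1,\infty)$. Put $B_\rho(x,r)=\{y:\rho(x,y)<r\}$, and let $\tau_\rho$ be the topology in which a set is open iff with each of its points $x$ it contains some $B_\rho(x,r)$, $r>0$. Assume that $(\mathscr X,\rho)$ is geometrically doubling (for some $N$, every ball of radius $r$ is covered by at most $N$ balls of radius $r/2$), and let $\mu$ be a Borel measure on $(\mathscr X,\tau_\rho)$ for which all $\rho$-balls are measurable and such that $(\mathscr X,\rho,\mu)$ is $m$-dimensional Ahlfors–David regular (ADR): for some $A\in[1,\infty)$, $A^{-1}r^m\le\mu(B_\rho(x,r))\le A r^m$ for all $x\in\mathscr X$ and all finite $r\in(0,\operatorname{diam}_\rho(\mathscr X)]$. Let $E\subseteq\mathscr X$ be closed, with a Borel regular measure $\sigma$ such that $(E,\rho|_E,\sigma)$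 is a $d$-dimensional ADR space (in particular $E$ has at least two points). Let $\rho_\#$ be a regularization of $\rho$, i.e. a symmetric quasi-distance with $L^{-1}\rho\le\rho_\#\le L\rho$ for some $L\in[1,\infty)$, such that $\delta_E(x):=\inf_{y\in E}\rho_\#(x,y)$ is continuous. Let $\mathbb D(E)=\bigcup_{k\ge\kappa_E}\mathbb D_k(E)$, where $2^{-\kappa_E-1}<\operatorname{diam}_\rho(E)\le2^{-\kappa_E}$ ($\kappa_E=-\infty$ if $E$ is unbounded), be a dyadic cube structure of David–Christ type on $E$: for constants $0<a_0\le a_1$, $\eta,c>0$, each $\mathbb D_k(E)$ is a countable family of pairwise disjoint measurable sets covering $\sigma$-almost all of $E$; if $k\le l$, a cube of $\mathbb D_l(E)$ is either contained in or disjoint from any given cube of $\mathbb D_k(E)$; each $Q\in\mathbb D_k(E)$, whose side length is $\ell(Q)=2^{-k}$, contains a point $x_Q$ with $E\cap B_\rho(x_Q,a_0\ell(Q))\subseteq Q\subseteq B_\rho(x_Q,a_1\ell(Q))$, and $\sigma(\{x\in Q:\exists\,y\in E\setminus Q,\ \rho(x,y)<t\,\ell(Q)\})\le c\,t^\eta\sigma(Q)$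 for all $t>0$. (A set that is a cube of several generations counts as several cubes.) Let $\{I_j\}$ be a Whitney covering of $\mathscr X\setminus E$: countably many measurable sets with union $\mathscr X\setminus E$ and overlap bounded by $M$, with sizes $\ell(I_j)>0$ such that, for a constant $W\in[1,\infty)$ and all $x\in I_j$: $\rho(x,y)\le W\ell(I_j)$ for all $y\in I_j$; $\ell(I_j)\le W\rho(x,y)$ for all $y\in E$; and $\rho(x,y)\le W\ell(I_j)$ for some $y\in E$. For a constant $K\ge1$ and $Q\in\mathbb D(E)$, let $\mathcal U_Q$ be the union of all $I_j$ with $K^{-1}\ell(I_j)\le\ell(Q)\le K\ell(I_j)$ and $\operatorname{dist}_\rho(I_j,Q)\le K\ell(Q)$, and let $T_E(Q)=\bigcup_{Q'\in\mathbb D(E),\,Q'\subseteq Q}\mathcal U_{Q'}$ be the dyadic Carleson tent. Let $\theta:(\mathscr X\times\mathscr X)\setminus\{(x,x):x\in\mathscr X\}\to\mathbb R$ be Borel measurable with, for constants $C_\theta,\alpha,\upsilon\in(0,\infty)$ and all $x\ne y$, $$|\theta(x,y)|\le\frac{C_\theta}{\rho(x,y)^{d+\upsilon}},\qquad |\theta(x,y)-\theta(x,\widetilde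 y)|\le C_\theta\frac{\rho(y,\widetilde y)^\alpha}{\rho(x,y)^{d+\upsilon+\alpha}}\ \text{ if }\widetilde y\ne x,\ \rho(y,\widetilde y)\le\tfrac12\rho(x,y),$$ and put $(\Theta_Ef)(x)=\int_E\theta(x,y)f(y)\,d\sigma(y)$ for $x\in\mathscr X\setminus E$. **Theorem.** There is a $K_0\ge1$, depending only on $d,m,\widetilde C_\rho,C_\rho,N$, the ADR constants of $\mathscr X$ and $E$, $L$, the constants $a_0,a_1,\eta,c$ of the dyadic structure and the constants $W,M$ of the Whitney covering, such that the following holds for every $K\ge K_0$. Suppose that there are constants $C_0\in[1,\infty)$, $c_0\in(0,1]$ and $\sigma$-measurable functions $b_Q:E\to\mathbb C$, $Q\in\mathbb D(E)$, such that for each $Q\in\mathbb D(E)$: 1. $\int_E|b_Q|^2\,d\sigma\le C_0\,\sigma(Q)$; 2. there is $\widetilde Q\in\mathbb D(E)$ with $\widetilde Q\subseteq Q$, $\ell(\widetilde Q)\ge c_0\,\ell(Q)$ and $\bigl|\int_{\widetilde Q}b_Q\,d\sigma\bigr|\ge\frac1{C_0}\sigma(\widetilde Q)$; 3. $\int_{T_E(Q)}|(\Theta_Eb_Q)(x)|^2\,\delta_E(x)^{2\upsilon-(m-d)}\,d\mu(x)\le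 C_0\,\sigma(Q)$. Then for all $f\in L^2(E,\sigma)$ the integral defining $(\Theta_Ef)(x)$ converges absolutely for every $x\in\mathscr X\setminus E$, and $$\int_{\mathscr X\setminus E}|(\Theta_Ef)(x)|^2\,\delta_E(x)^{2\upsilon-(m-d)}\,d\mu(x)\le C\int_E|f|^2\,d\sigma,$$ where $C\in(0,\infty)$ depends only on the constants listed above and on $K,\upsilon,\alpha,C_\theta,C_0,c_0$. -/

import Mathlib

open MeasureTheory Set
open scoped ENNReal

namespace LocalTb

noncomputable section

/-- The ball `B_ρ(x, r) = {y : ρ(x, y) < r}`. -/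
def qBall {X : Type*} (ρ : X → X → ℝ) (x : X) (r : ℝ) : Set X := {y | ρ x y < r}

/-- The diameter `sup ρ(x, y)`, with values in `[0, ∞]`. -/
def qDiam {X : Type*} (ρ : X → X → ℝ) : ℝ≥0∞ := ⨆ (x : X) (y : X), ENNReal.ofReal (ρ x y)

/-- The distance `inf {ρ(x, y) : x ∈ A, y ∈ B}` between two sets, with values in `[0, ∞]`. -/
def qDist {X : Type*} (ρ : X → X → ℝ) (A B : Set X) : ℝ≥0∞ :=
  ⨅ (x ∈ A) (y ∈ B), ENNReal.ofReal (ρ x y)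

/-- The topology `τ_ρ`: a set is open iff with each point it contains a ball about it.  It is the
only topology for which the balls about each point can be a fundamental system of
neighbourhoods. -/
@[reducible] def qTopology {X : Type*} (ρ : X → X → ℝ) : TopologicalSpace X where
  IsOpen O := ∀ x ∈ O, ∃ r : ℝ, 0 < r ∧ qBall ρ x r ⊆ O
  isOpen_univ := fun _ _ => ⟨1, one_pos, subset_univ _⟩
  isOpen_inter := by
    rintro s t hs ht x ⟨hxs, hxt⟩
    obtain ⟨r, hr, hrs⟩ := hs x hxs
    obtain ⟨r', hr', hrt⟩ := ht x hxt
    refine ⟨min r r', lt_min hr hr', fun y (hy : ρ x y < min r r') => ⟨hrs ?_, hrt ?_⟩⟩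
    · exact (lt_of_lt_of_le hy (min_le_left _ _) : ρ x y < r)
    · exact (lt_of_lt_of_le hy (min_le_right _ _) : ρ x y < r')
  isOpen_sUnion := by
    rintro S hS x ⟨t, htS, hxt⟩
    obtain ⟨r, hr, hrt⟩ := hS t htS x hxt
    exact ⟨r, hr, hrt.trans (subset_sUnion_of_mem htS)⟩

/-- `ρ` is a quasi-distance with symmetry constant `Cs` and quasi-triangle constant `Cρ`. -/
structure IsQuasiDist {X : Type*} (ρ : X → X → ℝ) (Cs Cρ : ℝ) : Prop where
  nonneg : ∀ x y, 0 ≤ ρ x y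
  eq_zero_iff : ∀ x y, ρ x y = 0 ↔ x = y
  symm_le : ∀ x y, ρ y x ≤ Cs * ρ x y
  le_max : ∀ x y z, ρ x y ≤ Cρ * max (ρ x z) (ρ z y)

/-- `(X, ρ, μ)` is an `n`-dimensional Ahlfors–David regular space with constant `A`, for a
quasi-distance `ρ`.  The `σ`-algebra carrying `μ` contains the Borel sets of `τ_ρ` and the
`ρ`-balls. -/
structure IsADR {X : Type*} [MeasurableSpace X] (ρ : X → X → ℝ) (μ : Measure X)
    (n A : ℝ) : Prop where
  nontrivial : Nontrivial X
  borel_le : @borel X (qTopology ρ) ≤ ‹MeasurableSpace X›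
  measurable_ball : ∀ x r, MeasurableSet (qBall ρ x r)
  le_measure_ball : ∀ (x : X) (r : ℝ), 0 < r → ENNReal.ofReal r ≤ qDiam ρ →
    ENNReal.ofReal (A⁻¹ * r ^ n) ≤ μ (qBall ρ x r)
  measure_ball_le : ∀ (x : X) (r : ℝ), 0 < r → ENNReal.ofReal r ≤ qDiam ρ →
    μ (qBall ρ x r) ≤ ENNReal.ofReal (A * r ^ n)

/-- Geometric doubling: every ball is covered by at most `N` balls of half its radius. -/
def IsGeomDoubling {X : Type*} (ρ : X → X → ℝ) (N : ℕ) : Prop :=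
  ∀ (x : X) (r : ℝ), 0 < r → ∃ F : Finset X, F.card ≤ N ∧
    qBall ρ x r ⊆ ⋃ z ∈ F, qBall ρ z (r / 2)

/-- Borel regularity (with respect to `τ_ρ`): every set has a Borel superset of the same
(outer) measure. -/
def IsBorelRegular {X : Type*} [MeasurableSpace X] (ρ : X → X → ℝ) (μ : Measure X) : Prop :=
  ∀ A : Set X, ∃ B : Set X, A ⊆ B ∧ MeasurableSet[@borel X (qTopology ρ)] B ∧ μ B = μ A

/-- The restriction of `ρ` to `E × E`. -/
abbrev restr {X : Type*} (ρ : X → X → ℝ) (E : Set X) : E → E → ℝ := fun x y => ρ x y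

/-- `δ_E(x) = inf {ρ'(x, y) : y ∈ E}`. -/
def deltaE {X : Type*} (ρ' : X → X → ℝ) (E : Set X) (x : X) : ℝ := ⨅ y : E, ρ' x y

/-- `ρ'` is a regularization of `ρ` relative to `E`: a symmetric function equivalent to `ρ` (hence
again a quasi-distance, inducing the same topology) for which `δ_E` is continuous. -/
structure IsRegularization {X : Type*} (ρ ρ' : X → X → ℝ) (E : Set X) (L : ℝ) : Prop where
  symm : ∀ x y, ρ' x y = ρ' y x
  le_mul : ∀ x y, ρ' x y ≤ L * ρ x y
  mul_le : ∀ x y, ρ x y ≤ L * ρ' x y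
  continuous : @Continuous X ℝ (qTopology ρ) _ (deltaE ρ' E)

/-- The side length `2⁻ᵏ` of the cubes of generation `k`. -/
def side (k : ℤ) : ℝ := (2 : ℝ) ^ (-k)

/-- `k ≥ κ`, where `κ ∈ ℤ ∪ {-∞}` is given by `2^(-κ-1) < diam ≤ 2^(-κ)`: this holds iff
`2^(-k-1) < diam`. -/
def IsGeneration {Y : Type*} (ρ : Y → Y → ℝ) (k : ℤ) : Prop :=
  ENNReal.ofReal (side (k + 1)) < qDiam ρ

/-- `D` is a dyadic cube structure (of David–Christ type) on `(Y, ρ, σ)`; `D k` is the collection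
of the cubes of generation `k`.  As the same set may be a cube of several generations, a cube is
given by a set together with its generation. -/
structure IsDyadic {Y : Type*} [MeasurableSpace Y] (ρ : Y → Y → ℝ) (σ : Measure Y)
    (D : ℤ → Set (Set Y)) (a₀ a₁ η c : ℝ) : Prop where
  gen : ∀ k, ∀ Q ∈ D k, IsGeneration ρ k
  countable : ∀ k, (D k).Countable
  measurable : ∀ k, ∀ Q ∈ D k, MeasurableSet Q
  disjoint : ∀ k, ∀ Q ∈ D k, ∀ Q' ∈ D k, Q ≠ Q' → Disjoint Q Q'
  nested : ∀ k l, k ≤ l → ∀ Q ∈ D k, ∀ Q' ∈ D l, Q' ⊆ Q ∨ Disjoint Q' Q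
  size : ∀ k, ∀ Q ∈ D k, ∃ x ∈ Q, qBall ρ x (a₀ * side k) ⊆ Q ∧ Q ⊆ qBall ρ x (a₁ * side k)
  cover : ∀ k, IsGeneration ρ k → σ (⋃₀ D k)ᶜ = 0
  thin_boundary : ∀ k, ∀ Q ∈ D k, ∀ t : ℝ, 0 < t →
    σ {x | x ∈ Q ∧ ∃ y, y ∉ Q ∧ ρ x y < t * side k} ≤ ENNReal.ofReal (c * t ^ η) * σ Q

/-- `(I j)` is a Whitney covering of `X ∖ E`, with sizes `ℓ(I j) = s j`: the diameter of `I j` is at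
most, and the distance of `I j` from `E` comparable to, its size, and the overlap is bounded.
Members may be empty, so that finite families are included. -/
structure IsWhitney {X : Type*} [MeasurableSpace X] (ρ : X → X → ℝ) (E : Set X)
    (I : ℕ → Set X) (s : ℕ → ℝ) (W : ℝ) (M : ℕ) : Prop where
  measurable : ∀ j, MeasurableSet (I j)
  cover : ⋃ j, I j = Eᶜ
  size_pos : ∀ j, 0 < s j
  diam_le : ∀ j, ∀ x ∈ I j, ∀ y ∈ I j, ρ x y ≤ W * s j
  le_dist : ∀ j, ∀ x ∈ I j, ∀ y ∈ E, s j ≤ W * ρ x y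
  dist_le : ∀ j, ∀ x ∈ I j, ∃ y ∈ E, ρ x y ≤ W * s j
  overlap : ∀ x, {j | x ∈ I j}.encard ≤ M

/-- The region `U_Q` of a cube `Q` of generation `k`: the union of the Whitney sets of size
comparable to `ℓ(Q)` at distance at most `K ℓ(Q)` from `Q`. -/
def whitneyRegion {X : Type*} (ρ : X → X → ℝ) {E : Set X} (I : ℕ → Set X) (s : ℕ → ℝ) (K : ℝ)
    (k : ℤ) (Q : Set E) : Set X :=
  ⋃ j ∈ {j : ℕ | K⁻¹ * s j ≤ side k ∧ side k ≤ K * s j ∧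
    qDist ρ (I j) (Subtype.val '' Q) ≤ ENNReal.ofReal (K * side k)}, I j

/-- The dyadic Carleson tent `T_E(Q) = ⋃ U_{Q'}`, over all cubes `Q' ⊆ Q`. -/
def tent {X : Type*} (ρ : X → X → ℝ) {E : Set X} (D : ℤ → Set (Set E)) (I : ℕ → Set X)
    (s : ℕ → ℝ) (K : ℝ) (Q : Set E) : Set X :=
  ⋃ (k : ℤ) (Q' ∈ {Q' : Set E | Q' ∈ D k ∧ Q' ⊆ Q}), whitneyRegion ρ I s K k Q'

/-- Borel measurability off the diagonal, decay, and Hölder regularity of the kernel `θ` (whose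
values on the diagonal play no role). -/
structure IsKernel {X : Type*} (ρ : X → X → ℝ) (θ : X → X → ℝ) (d υ α Cθ : ℝ) : Prop where
  measurable :
    letI : TopologicalSpace X := qTopology ρ
    @Measurable {p : X × X // p.1 ≠ p.2} ℝ (borel _) (borel ℝ) (fun p => θ p.1.1 p.1.2)
  decay : ∀ x y, x ≠ y → |θ x y| ≤ Cθ / ρ x y ^ (d + υ)
  holder : ∀ x y z, x ≠ y → z ≠ x → ρ y z ≤ ρ x y / 2 →
    |θ x y - θ x z| ≤ Cθ * (ρ y z ^ α / ρ x y ^ (d + υ + α))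

/-- `(Θ_E f)(x) = ∫_E θ(x, y) f(y) dσ(y)`. -/
def Theta {X : Type*} [MeasurableSpace X] (θ : X → X → ℝ) {E : Set X} (σ : Measure E)
    (f : E → ℂ) (x : X) : ℂ :=
  ∫ y : E, (θ x y : ℂ) * f y ∂σ

end

end LocalTb

namespace LocalTb

open scoped NNReal

universe u v

/-! The proof reduces the local theorem to a `T(1)`-type estimate in which the functions `b_Q` serve
only to show that `|Θ1|²` is a Carleson measure.

Each Whitney set of size at most `diam E` is assigned to one nearby cube of comparable side, and the
sets are made disjoint. This gives every cube `Q` a region `V Q` such that, for `x ∈ V Q`, the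
function `ℓ(Q)^υ θ(x, ·)` is a bump of the size and smoothness of the Poisson kernel about `Q`
(`IsAdapted`). Subtracting the multiple of `1_Q` with the same integral gives the kernel `centered`.
It has mean zero, and its pairing with `g` is `ℓ(Q)^υ (Θg(x) - Θ1(x) · mean_Q g)`.

These centered kernels are almost orthogonal. Against a kernel of a finer generation, whose integral
vanishes, the value of the coarser kernel at the finer centre may be subtracted. The difference is
small by Hölder regularity for `θ` and by the thin boundary condition for the jump of `1_Q`, in both
cases after summation over the finer cubes (`IsAdapted.tsum_inner_centered_le`). Schur's test then
yields a Bessel inequality (`IsAdapted.tsum_measure_mul_sq_le`), so that `Θg - Θ1 · mean_Q g` has a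
square function bounded by `‖g‖²` (`IsWhitneyFamily.exists_error_bound`).

What remains is `Θ1 · mean_Q f`, which the Carleson embedding theorem (`DyadicSpace.tsum_mul_sq_le`)
handles once `|Θ1|²` satisfies a Carleson condition. Here the error estimate is used again, with `g
= b_Q`: on cubes where the mean of `b_Q` is not small, `Θ1` is controlled by `Θ b_Q`, hence by the
tent hypothesis, plus the error. A stopping time argument (`DyadicSpace.exists_stopping`) shows that
the remaining cubes below `Q` either have side comparable to that of `Q` or lie below stopping cubes
that omit a fixed fraction of `Q`; an induction over generations absorbs the latter
(`tsum_desc_le_of_stopping`).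

Whitney sets larger than `E` have no cube. There the size of `θ` alone suffices
(`lintegral_far_le`). -/

/-- The Poisson-like kernel `r ^ ε / (r + ρ(z, y)) ^ (d + ε)` at scale `r`. -/
noncomputable def poisson {Y : Type*} (ρ : Y → Y → ℝ) (d ε r : ℝ) (z y : Y) : ℝ :=
  r ^ ε / (r + ρ z y) ^ (d + ε)

/-! ### Poisson kernels: comparison and integrability. -/

section Poisson

variable {Y : Type u} {ρ : Y → Y → ℝ} {d ε r s : ℝ}

theorem poisson_nonneg (h0 : ∀ x y, 0 ≤ ρ x y) (hr : 0 ≤ r) (z y : Y) :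
    0 ≤ poisson ρ d ε r z y := by
  have := h0 z y
  unfold poisson
  positivity

theorem measurable_poisson [MeasurableSpace Y] (hm : ∀ x, Measurable (ρ x)) (z : Y) :
    Measurable (poisson ρ d ε r z) := by
  have := hm z
  unfold poisson
  fun_prop

theorem poisson_le_mul_poisson (h0 : ∀ x y, 0 ≤ ρ x y) (hr : 0 < r) (hε : 0 ≤ d + ε) {c : ℝ}
    (hc : 0 ≤ c) {z y z' y' : Y} (h : r + ρ z' y' ≤ c * (r + ρ z y)) :
    poisson ρ d ε r z y ≤ c ^ (d + ε) * poisson ρ d ε r z' y' := by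
  have h1 := h0 z y
  have h2 := h0 z' y'
  unfold poisson
  rw [← mul_div_assoc, div_le_div_iff₀ (by positivity) (by positivity)]
  have : (r + ρ z' y') ^ (d + ε) ≤ c ^ (d + ε) * (r + ρ z y) ^ (d + ε) := by
    rw [← Real.mul_rpow hc (by positivity)]
    exact Real.rpow_le_rpow (by positivity) h hε
  calc r ^ ε * (r + ρ z' y') ^ (d + ε) ≤ r ^ ε * (c ^ (d + ε) * (r + ρ z y) ^ (d + ε)) := by gcongr
    _ = _ := by ring

/-- Away from `z`, the kernel at scale `r` is much smaller than that at scale `s`. -/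
theorem poisson_le_of_far (h0 : ∀ x y, 0 ≤ ρ x y) (hr : 0 < r) (hs : 0 < s) (hε : 0 ≤ d + ε)
    {c : ℝ} (hc : 0 ≤ c) {z y : Y} (h : s ≤ c * ρ z y) :
    poisson ρ d ε r z y ≤ (c + 1) ^ (d + ε) * (r / s) ^ ε * poisson ρ d ε s z y := by
  have h1 := h0 z y
  unfold poisson
  rw [Real.div_rpow hr.le hs.le]
  have e : (c + 1) ^ (d + ε) * (r ^ ε / s ^ ε) * (s ^ ε / (s + ρ z y) ^ (d + ε)) =
      (c + 1) ^ (d + ε) * r ^ ε / (s + ρ z y) ^ (d + ε) := by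
    have : s ^ ε ≠ 0 := by positivity
    field_simp
  rw [e, div_le_div_iff₀ (by positivity) (by positivity)]
  have : (s + ρ z y) ^ (d + ε) ≤ (c + 1) ^ (d + ε) * (r + ρ z y) ^ (d + ε) := by
    rw [← Real.mul_rpow (by positivity) (by positivity)]
    refine Real.rpow_le_rpow (by positivity) ?_ hε
    nlinarith
  calc r ^ ε * (s + ρ z y) ^ (d + ε)
      ≤ r ^ ε * ((c + 1) ^ (d + ε) * (r + ρ z y) ^ (d + ε)) := by gcongr
    _ = _ := by ring

/-- Part of the decay of the kernel can be traded for smallness. -/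
theorem poisson_mul_rpow_le {υ : ℝ} (h0 : ∀ x y, 0 ≤ ρ x y) (hr : 0 < r) (hs : 0 < s)
    (hε : 0 ≤ ε) (z y : Y) :
    poisson ρ d υ r z y * (ρ z y / s) ^ ε ≤ (r / s) ^ ε * poisson ρ d (υ - ε) r z y := by
  have h1 := h0 z y
  have hp : 0 < r + ρ z y := by positivity
  unfold poisson
  rw [Real.div_rpow hr.le hs.le, Real.div_rpow h1 hs.le]
  have e1 : r ^ (υ - ε) = r ^ υ / r ^ ε := Real.rpow_sub hr _ _
  have e2 : (r + ρ z y) ^ (d + (υ - ε)) = (r + ρ z y) ^ (d + υ) / (r + ρ z y) ^ ε := by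
    rw [← Real.rpow_sub hp]; ring_nf
  rw [e1, e2]
  have h3 : ρ z y ^ ε ≤ (r + ρ z y) ^ ε := Real.rpow_le_rpow h1 (by linarith) hε
  have hse : 0 < s ^ ε := by positivity
  have hre : 0 < r ^ ε := by positivity
  have hpe : 0 < (r + ρ z y) ^ ε := by positivity
  have hpd : 0 < (r + ρ z y) ^ (d + υ) := by positivity
  have : r ^ ε / s ^ ε * (r ^ υ / r ^ ε / ((r + ρ z y) ^ (d + υ) / (r + ρ z y) ^ ε)) =
      r ^ υ / (r + ρ z y) ^ (d + υ) * ((r + ρ z y) ^ ε / s ^ ε) := by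
    field_simp
  rw [this]
  gcongr

theorem poisson_le_rpow_neg (h0 : ∀ x y, 0 ≤ ρ x y) (hr : 0 < r) (hε : 0 ≤ d + ε) (z y : Y) :
    poisson ρ d ε r z y ≤ r ^ (-d) := by
  have h1 := h0 z y
  unfold poisson
  rw [div_le_iff₀ (by positivity)]
  calc r ^ ε = r ^ (-d) * r ^ (d + ε) := by rw [← Real.rpow_add hr]; ring_nf
    _ ≤ _ := by
        gcongr
        linarith

/-- On dyadic shells about `z` the kernel times the measure of the ball is at most a constant times
`2^(-nε)`, so a geometric series bounds the integral. Only upper bounds for balls enter, and the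
constant is uniform in the scale, the centre and the space. -/
theorem lintegral_poisson_le (d ε : ℝ) (Λ : ℝ≥0) (hd : 0 ≤ d) (hε : 0 < ε) :
    ∃ C : ℝ≥0, ∀ {Y : Type u} [MeasurableSpace Y] {ρ : Y → Y → ℝ} {σ : Measure Y},
      (∀ x y, 0 ≤ ρ x y) → (∀ x, Measurable (ρ x)) →
      (∀ x r, 0 < r → σ (qBall ρ x r) ≤ Λ * ENNReal.ofReal (r ^ d)) →
      ∀ (r : ℝ) (z : Y), 0 < r → ∫⁻ y, ENNReal.ofReal (poisson ρ d ε r z y) ∂σ ≤ C := by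
  set q : ℝ≥0 := Real.toNNReal ((2 : ℝ) ^ (-ε)) with hq
  have hq1 : q < 1 := by
    rw [hq, Real.toNNReal_lt_one]
    exact Real.rpow_lt_one_of_one_lt_of_neg (by norm_num) (by linarith)
  refine ⟨Real.toNNReal ((2 : ℝ) ^ (d + ε)) * Λ * (1 - q)⁻¹, ?_⟩
  intro Y _ ρ σ h0 hm hb r z hr
  have key : ∀ y, ENNReal.ofReal (poisson ρ d ε r z y) ≤ ∑' n : ℕ,
      (qBall ρ z (2 ^ n * r)).indicator
        (fun _ => ENNReal.ofReal (2 ^ (d + ε) * r ^ ε / (2 ^ n * r) ^ (d + ε))) y := by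
    intro y
    have h1 := h0 z y
    have hex : ∃ n : ℕ, ρ z y < 2 ^ n * r := by
      obtain ⟨n, hn⟩ := pow_unbounded_of_one_lt (ρ z y / r) (one_lt_two : (1 : ℝ) < 2)
      exact ⟨n, by rwa [div_lt_iff₀ hr] at hn⟩
    classical
    set n := Nat.find hex with hn
    have hn1 : ρ z y < 2 ^ n * r := Nat.find_spec hex
    -- Minimality of `n` bounds the radius by twice the distance; when `n = 0` the summand `r`
    -- provides the bound.
    have hn2 : 2 ^ n * r ≤ 2 * (r + ρ z y) := by
      rcases Nat.eq_zero_or_pos n with h | h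
      · rw [h]; simp; linarith
      · have := Nat.find_min hex (m := n - 1) (by omega)
        rw [not_lt] at this
        have e : (2 : ℝ) ^ n = 2 * 2 ^ (n - 1) := by
          rw [← pow_succ']; congr 1; omega
        rw [e]; linarith
    refine le_trans ?_ (ENNReal.le_tsum n)
    rw [indicator_of_mem (show y ∈ qBall ρ z (2 ^ n * r) from hn1)]
    apply ENNReal.ofReal_le_ofReal
    unfold poisson
    rw [div_le_div_iff₀ (by positivity) (by positivity)]
    have : (2 ^ n * r) ^ (d + ε) ≤ 2 ^ (d + ε) * (r + ρ z y) ^ (d + ε) := by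
      rw [← Real.mul_rpow (by positivity) (by positivity)]
      exact Real.rpow_le_rpow (by positivity) hn2 (by positivity)
    calc r ^ ε * (2 ^ n * r) ^ (d + ε) ≤ r ^ ε * (2 ^ (d + ε) * (r + ρ z y) ^ (d + ε)) := by gcongr
      _ = _ := by ring
  have hball : ∀ n : ℕ, MeasurableSet (qBall ρ z (2 ^ n * r)) := fun n =>
    measurableSet_lt (hm z) measurable_const
  calc ∫⁻ y, ENNReal.ofReal (poisson ρ d ε r z y) ∂σ
      ≤ ∫⁻ y, ∑' n : ℕ, (qBall ρ z (2 ^ n * r)).indicator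
        (fun _ => ENNReal.ofReal (2 ^ (d + ε) * r ^ ε / (2 ^ n * r) ^ (d + ε))) y ∂σ :=
        lintegral_mono key
    _ = ∑' n : ℕ, ENNReal.ofReal (2 ^ (d + ε) * r ^ ε / (2 ^ n * r) ^ (d + ε)) *
          σ (qBall ρ z (2 ^ n * r)) := by
        rw [lintegral_tsum fun n => (measurable_const.indicator (hball n)).aemeasurable]
        exact tsum_congr fun n => lintegral_indicator_const (hball n) _
    _ ≤ ∑' n : ℕ, ENNReal.ofReal (2 ^ (d + ε)) * Λ * (q : ℝ≥0∞) ^ n := by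
        refine ENNReal.tsum_le_tsum fun n => ?_
        refine (mul_le_mul_right (hb z _ (by positivity)) _).trans ?_
        rw [mul_left_comm, ← ENNReal.ofReal_mul (by positivity), mul_right_comm, mul_comm]
        refine mul_le_mul_left (le_of_eq ?_) _
        have : (q : ℝ≥0∞) = ENNReal.ofReal (2 ^ (-ε)) := rfl
        rw [this, ← ENNReal.ofReal_pow (by positivity), ← ENNReal.ofReal_mul (by positivity)]
        congr 1
        rw [Real.mul_rpow (by positivity) hr.le, Real.mul_rpow (by positivity) hr.le,
          Real.rpow_add hr, Real.rpow_add (show (0 : ℝ) < 2 ^ n by positivity), Real.rpow_neg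
          (by norm_num), ← Real.rpow_pow_comm (by norm_num) ε]
        have a1 : ((2 : ℝ) ^ n) ^ d ≠ 0 := by positivity
        have a2 : r ^ d ≠ 0 := by positivity
        have a3 : r ^ ε ≠ 0 := by positivity
        have a4 : (2 : ℝ) ^ ε ≠ 0 := by positivity
        field_simp
        rw [← mul_pow, mul_one_div_cancel a4, one_pow]
    _ = _ := by
        rw [ENNReal.tsum_mul_left, ENNReal.tsum_geometric]
        push_cast
        rw [ENNReal.coe_inv (by simpa [tsub_eq_zero_iff_le] using hq1)]
        rfl

end Poisson

/-! ### Abstract dyadic spaces and kernels adapted to cubes. -/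

theorem side_pos (k : ℤ) : 0 < side k := by unfold side; positivity

theorem side_le_side {k l : ℤ} (h : k ≤ l) : side l ≤ side k :=
  zpow_le_zpow_right₀ (by norm_num) (by omega)

/-- A space of dimension at most `d` with dyadic cubes `D k` and their centres `z k Q`. All
constants are controlled by `Λ`. -/
structure DyadicSpace {Y : Type*} [MeasurableSpace Y] (ρ : Y → Y → ℝ) (σ : Measure Y)
    (D : ℤ → Set (Set Y)) (z : ℤ → Set Y → Y) (d η : ℝ) (Λ : ℝ≥0) : Prop where
  one_le : 1 ≤ Λ
  nonneg : ∀ x y, 0 ≤ ρ x y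
  symm_le : ∀ x y, ρ y x ≤ Λ * ρ x y
  triangle : ∀ x y w, ρ x y ≤ Λ * (ρ x w + ρ w y)
  measurable_dist : ∀ x, Measurable (ρ x)
  measure_ball_le : ∀ x r, 0 < r → σ (qBall ρ x r) ≤ Λ * ENNReal.ofReal (r ^ d)
  countable : ∀ k, (D k).Countable
  measurable : ∀ k, ∀ Q ∈ D k, MeasurableSet Q
  disjoint : ∀ k, ∀ Q ∈ D k, ∀ Q' ∈ D k, Q ≠ Q' → Disjoint Q Q'
  nested : ∀ k l, k ≤ l → ∀ Q ∈ D k, ∀ Q' ∈ D l, Q' ⊆ Q ∨ Disjoint Q' Q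
  ctr_mem : ∀ k, ∀ Q ∈ D k, z k Q ∈ Q
  dist_ctr_le : ∀ k, ∀ Q ∈ D k, ∀ y ∈ Q, ρ (z k Q) y ≤ Λ * side k
  le_measure : ∀ k, ∀ Q ∈ D k, ENNReal.ofReal (side k ^ d) ≤ Λ * σ Q
  thin_boundary : ∀ k, ∀ Q ∈ D k, ∀ t : ℝ, 0 < t →
    σ {x | x ∈ Q ∧ ∃ y, y ∉ Q ∧ ρ x y < t * side k} ≤ Λ * ENNReal.ofReal (t ^ η) * σ Q
  cover : ∀ k l, k ≤ l → (D k).Nonempty → σ (⋃₀ D l)ᶜ = 0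

/-- `κ` has the size and the regularity of the Poisson kernel of scale `r` about `z`. -/
structure IsAdapted {Y : Type*} [MeasurableSpace Y] (ρ : Y → Y → ℝ) (d υ ε : ℝ) (B : ℝ≥0)
    (r : ℝ) (z : Y) (κ : Y → ℝ) : Prop where
  measurable : Measurable κ
  abs_le : ∀ y, |κ y| ≤ B * poisson ρ d υ r z y
  holder : ∀ y y', ρ y y' ≤ r / B →
    |κ y - κ y'| ≤ B * ((ρ y y' / r) ^ ε * poisson ρ d υ r z y)

/-- `κ` minus the multiple of the indicator of `Q` that makes its integral vanish. -/
noncomputable def centered {Y : Type*} [MeasurableSpace Y] (σ : Measure Y) (κ : Y → ℝ)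
    (Q : Set Y) (y : Y) : ℝ :=
  κ y - Q.indicator (fun _ => (∫ w, κ w ∂σ) / (σ Q).toReal) y

namespace DyadicSpace

variable {Y : Type u} [MeasurableSpace Y] {ρ : Y → Y → ℝ} {σ : Measure Y}
  {D : ℤ → Set (Set Y)} {z : ℤ → Set Y → Y} {d η : ℝ} {Λ : ℝ≥0}

theorem measure_le (h : DyadicSpace ρ σ D z d η Λ) {k : ℤ} {Q : Set Y} (hQ : Q ∈ D k) :
    σ Q ≤ (Λ * Real.toNNReal ((2 * Λ) ^ d) : ℝ≥0) * ENNReal.ofReal (side k ^ d) := by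
  have h1 : (1 : ℝ) ≤ Λ := by exact_mod_cast h.one_le
  have hs := side_pos k
  refine (measure_mono fun y hy => ?_).trans
    ((h.measure_ball_le (z k Q) (2 * Λ * side k) (by positivity)).trans (le_of_eq ?_))
  · have := h.dist_ctr_le k Q hQ y hy
    have h2 : 0 < Λ * side k := by positivity
    change ρ (z k Q) y < _
    linarith
  · rw [Real.mul_rpow (by positivity) hs.le, ENNReal.ofReal_mul (by positivity)]
    push_cast
    rw [mul_assoc]
    rfl

theorem measure_ne_top (h : DyadicSpace ρ σ D z d η Λ) {k : ℤ} {Q : Set Y} (hQ : Q ∈ D k) :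
    σ Q ≠ ∞ :=
  ((h.measure_le hQ).trans_lt (ENNReal.mul_lt_top ENNReal.coe_lt_top ENNReal.ofReal_lt_top)).ne

theorem measure_ne_zero (h : DyadicSpace ρ σ D z d η Λ) {k : ℤ} {Q : Set Y} (hQ : Q ∈ D k) :
    σ Q ≠ 0 := by
  intro h0
  have := h.le_measure k Q hQ
  have hs := side_pos k
  rw [h0, mul_zero, nonpos_iff_eq_zero, ENNReal.ofReal_eq_zero] at this
  exact absurd (Real.rpow_pos_of_pos hs d) (not_lt.2 this)

/-- At a scale `r ≥ ℓ(Q)` the points of `Q` cannot be told apart from its centre. Both orders of the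
arguments are needed, as `ρ` is not symmetric; they allow a sum over cubes to be replaced by an
integral. -/
theorem add_dist_le (h : DyadicSpace ρ σ D z d η Λ) {l : ℤ} {Q : Set Y} (hQ : Q ∈ D l) {r : ℝ}
    (hr : side l ≤ r) {w : Y} (hw : w ∈ Q) (y : Y) :
    r + ρ y w ≤ 3 * Λ ^ 3 * (r + ρ (z l Q) y) ∧ r + ρ y w ≤ 3 * Λ ^ 3 * (r + ρ y (z l Q)) := by
  have h1 : (1 : ℝ) ≤ Λ := by exact_mod_cast h.one_le
  have hr0 : 0 < r := (side_pos l).trans_le hr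
  have a1 := h.dist_ctr_le l Q hQ w hw
  have a2 := h.triangle y w (z l Q)
  have a3 := h.symm_le (z l Q) y
  have n1 := h.nonneg (z l Q) y
  have n2 := h.nonneg y (z l Q)
  have b2 : (Λ : ℝ) ≤ Λ ^ 2 := by nlinarith
  have b3 : (Λ : ℝ) ^ 2 ≤ Λ ^ 3 := by nlinarith [sq_nonneg (Λ : ℝ)]
  have a1' : ρ (z l Q) w ≤ Λ * r := a1.trans (by gcongr)
  have c1 : ρ y w ≤ Λ * ρ y (z l Q) + Λ ^ 2 * r := by nlinarith
  have c2 : (Λ : ℝ) * ρ y (z l Q) ≤ Λ ^ 2 * ρ (z l Q) y := by nlinarith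
  have e1 : (Λ : ℝ) ^ 2 * r ≤ Λ ^ 3 * r := by gcongr
  have e2 : (Λ : ℝ) ^ 2 * ρ (z l Q) y ≤ Λ ^ 3 * ρ (z l Q) y := by gcongr
  have e3 : (Λ : ℝ) * ρ y (z l Q) ≤ Λ ^ 3 * ρ y (z l Q) := by gcongr; linarith
  have e4 : r ≤ Λ ^ 3 * r := by nlinarith
  have e5 : 0 ≤ (Λ : ℝ) ^ 3 * ρ (z l Q) y := by positivity
  have e6 : 0 ≤ (Λ : ℝ) ^ 3 * ρ y (z l Q) := by positivity
  constructor <;> nlinarith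

/-- Discrete analogues of the integrability of the Poisson kernel, with the sums over the cubes of
a generation not coarser than the scale of the kernel. -/
theorem tsum_measure_mul_poisson_le (d ε η : ℝ) (Λ : ℝ≥0) (hd : 0 ≤ d) (hε : 0 < ε) :
    ∃ C : ℝ≥0, ∀ {Y : Type u} [MeasurableSpace Y] {ρ : Y → Y → ℝ} {σ : Measure Y}
      {D : ℤ → Set (Set Y)} {z : ℤ → Set Y → Y}, DyadicSpace ρ σ D z d η Λ →
      ∀ (l : ℤ) (r : ℝ) (y : Y), side l ≤ r →
        ∑' Q : D l, σ Q * ENNReal.ofReal (poisson ρ d ε r (z l Q) y) ≤ C ∧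
        ∑' Q : D l, σ Q * ENNReal.ofReal (poisson ρ d ε r y (z l Q)) ≤ C := by
  obtain ⟨C, hC⟩ := lintegral_poisson_le.{u} d ε Λ hd hε
  set c : ℝ := 3 * Λ ^ 3 with hc
  refine ⟨Real.toNNReal (c ^ (d + ε)) * C, ?_⟩
  intro Y _ ρ σ D z h l r y hr
  have hr0 : 0 < r := (side_pos l).trans_le hr
  have hc0 : 0 ≤ c := by positivity
  -- Each term is bounded by an integral over its own cube, and the cubes of one generation are
  -- disjoint, so the sum is at most one integral of a Poisson kernel.
  have main : ∀ F : D l → ℝ, (∀ Q : D l, ∀ w ∈ Q.1,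
      F Q ≤ c ^ (d + ε) * poisson ρ d ε r y w) →
      ∑' Q : D l, σ Q * ENNReal.ofReal (F Q) ≤
        (Real.toNNReal (c ^ (d + ε)) * C : ℝ≥0) := by
    intro F hF
    have := (h.countable l).to_subtype
    calc ∑' Q : D l, σ Q * ENNReal.ofReal (F Q)
        ≤ ∑' Q : D l, ∫⁻ w in Q.1, ENNReal.ofReal (c ^ (d + ε)) *
            ENNReal.ofReal (poisson ρ d ε r y w) ∂σ := by
          refine ENNReal.tsum_le_tsum fun Q => ?_
          rw [mul_comm, ← setLIntegral_const]
          refine setLIntegral_mono' (h.measurable l Q Q.2) fun w hw => ?_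
          rw [← ENNReal.ofReal_mul (by positivity)]
          exact ENNReal.ofReal_le_ofReal (hF Q w hw)
      _ = ∫⁻ w in ⋃ Q : D l, Q.1, ENNReal.ofReal (c ^ (d + ε)) *
            ENNReal.ofReal (poisson ρ d ε r y w) ∂σ := by
          rw [lintegral_iUnion (fun Q : D l => h.measurable l Q Q.2)]
          intro Q Q' hQ
          exact h.disjoint l Q Q.2 Q' Q'.2 (fun e => hQ (Subtype.ext e))
      _ ≤ ∫⁻ w, ENNReal.ofReal (c ^ (d + ε)) *
            ENNReal.ofReal (poisson ρ d ε r y w) ∂σ := setLIntegral_le_lintegral _ _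
      _ ≤ _ := by
          rw [lintegral_const_mul _ (measurable_poisson h.measurable_dist y).ennreal_ofReal]
          push_cast
          exact mul_le_mul_right (hC h.nonneg h.measurable_dist h.measure_ball_le r y hr0) _
  exact ⟨main _ fun Q w hw => poisson_le_mul_poisson h.nonneg hr0 (by positivity) hc0
      (h.add_dist_le Q.2 hr hw y).1,
    main _ fun Q w hw => poisson_le_mul_poisson h.nonneg hr0 (by positivity) hc0
      (h.add_dist_le Q.2 hr hw y).2⟩

end DyadicSpace

/-! ### Mean-zero corrections of adapted kernels. -/

section Centered

variable {Y : Type u} [MeasurableSpace Y] {ρ : Y → Y → ℝ} {σ : Measure Y}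
  {D : ℤ → Set (Set Y)} {z : ℤ → Set Y → Y} {d η : ℝ} {Λ : ℝ≥0}

theorem measurable_centered {κ : Y → ℝ} (hκ : Measurable κ) {Q : Set Y} (hQ : MeasurableSet Q) :
    Measurable (centered σ κ Q) :=
  hκ.sub (measurable_const.indicator hQ)

theorem integral_centered {κ : Y → ℝ} (hκ : Integrable κ σ) {Q : Set Y} (hQ : MeasurableSet Q)
    (h0 : σ Q ≠ 0) (ht : σ Q ≠ ∞) : ∫ y, centered σ κ Q y ∂σ = 0 := by
  unfold centered
  rw [integral_sub hκ ((integrable_indicator_iff hQ).2 (integrableOn_const ht (by simp))),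
    integral_indicator hQ, setIntegral_const]
  have : (σ Q).toReal ≠ 0 := ENNReal.toReal_ne_zero.2 ⟨h0, ht⟩
  simp only [Measure.real, smul_eq_mul]
  field_simp
  ring

/-- An adapted kernel and its centering are dominated by the Poisson kernel. -/
theorem IsAdapted.abs_centered_le (d υ ε η : ℝ) (Λ B : ℝ≥0) (hd : 0 ≤ d) (hυ : 0 < υ) :
    ∃ C : ℝ≥0, ∀ {Y : Type u} [MeasurableSpace Y] {ρ : Y → Y → ℝ} {σ : Measure Y}
      {D : ℤ → Set (Set Y)} {z : ℤ → Set Y → Y}, DyadicSpace ρ σ D z d η Λ →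
      ∀ (k : ℤ) (Q : Set Y) (κ : Y → ℝ), Q ∈ D k → IsAdapted ρ d υ ε B (side k) (z k Q) κ →
      Integrable κ σ ∧ |∫ w, κ w ∂σ| ≤ C ∧
      ∀ y, |centered σ κ Q y| ≤ C * poisson ρ d υ (side k) (z k Q) y := by
  obtain ⟨C, hC⟩ := lintegral_poisson_le.{u} d υ Λ hd hυ
  refine ⟨B * C + (B + B * C * Λ * Real.toNNReal ((1 + Λ) ^ (d + υ))), ?_⟩
  intro Y _ ρ σ D z h k Q κ hQ hκ
  have hs := side_pos k
  have hI : ∫⁻ y, ‖κ y‖ₑ ∂σ ≤ (B * C : ℝ≥0) := by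
    calc ∫⁻ y, ‖κ y‖ₑ ∂σ ≤ ∫⁻ y, B * ENNReal.ofReal (poisson ρ d υ (side k) (z k Q) y) ∂σ := by
          refine lintegral_mono fun y => ?_
          rw [Real.enorm_eq_ofReal_abs, ← ENNReal.ofReal_coe_nnreal,
            ← ENNReal.ofReal_mul (by positivity)]
          exact ENNReal.ofReal_le_ofReal (hκ.abs_le y)
      _ ≤ _ := by
          rw [lintegral_const_mul _ (measurable_poisson h.measurable_dist _).ennreal_ofReal]
          push_cast
          exact mul_le_mul_right (hC h.nonneg h.measurable_dist h.measure_ball_le _ _ hs) _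
  have hint : Integrable κ σ := ⟨hκ.measurable.aestronglyMeasurable, hI.trans_lt ENNReal.coe_lt_top⟩
  have hint' : |∫ w, κ w ∂σ| ≤ B * C := by
    have : ‖∫ w, κ w ∂σ‖ₑ ≤ (B * C : ℝ≥0) := (enorm_integral_le_lintegral_enorm _).trans hI
    rw [enorm_le_coe] at this
    exact_mod_cast this
  refine ⟨hint, hint'.trans ?_, fun y => ?_⟩
  · push_cast
    have : (0 : ℝ) ≤ B + B * C * Λ * Real.toNNReal ((1 + Λ) ^ (d + υ)) := by positivity
    linarith
  have hp := poisson_nonneg (d := d) (ε := υ) h.nonneg hs.le (z k Q) y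
  have hind : |Q.indicator (fun _ => (∫ w, κ w ∂σ) / (σ Q).toReal) y| ≤
      B * C * Λ * (1 + Λ) ^ (d + υ) * poisson ρ d υ (side k) (z k Q) y := by
    by_cases hy : y ∈ Q
    · rw [indicator_of_mem hy, abs_div, abs_of_nonneg ENNReal.toReal_nonneg]
      have hpos : 0 < (σ Q).toReal :=
        ENNReal.toReal_pos (h.measure_ne_zero hQ) (h.measure_ne_top hQ)
      have hlow : side k ^ d ≤ Λ * (σ Q).toReal := by
        have := h.le_measure k Q hQ
        rw [ENNReal.ofReal_le_iff_le_toReal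
          (ENNReal.mul_ne_top ENNReal.coe_ne_top (h.measure_ne_top hQ)), ENNReal.toReal_mul] at this
        simpa using this
      -- On `Q` itself the Poisson kernel of scale `ℓ(Q)` is at least a multiple of `ℓ(Q)^(-d)`, so
      -- it dominates the normalised indicator of `Q`.
      have hpl : 1 ≤ (1 + Λ : ℝ) ^ (d + υ) * poisson ρ d υ (side k) (z k Q) y * side k ^ d := by
        unfold poisson
        have n1 := h.nonneg (z k Q) y
        have a1 := h.dist_ctr_le k Q hQ y hy
        have : (side k + ρ (z k Q) y) ^ (d + υ) ≤ (1 + Λ) ^ (d + υ) * side k ^ (d + υ) := by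
          rw [← Real.mul_rpow (by positivity) hs.le]
          exact Real.rpow_le_rpow (by positivity) (by linarith) (by positivity)
        rw [mul_div_assoc', div_mul_eq_mul_div, le_div_iff₀ (by positivity), one_mul]
        refine this.trans (le_of_eq ?_)
        rw [Real.rpow_add hs]
        ring
      rw [div_le_iff₀ hpos]
      calc |∫ w, κ w ∂σ| ≤ B * C * 1 := by simpa using hint'
        _ ≤ B * C * ((1 + Λ : ℝ) ^ (d + υ) * poisson ρ d υ (side k) (z k Q) y * side k ^ d) := by
            gcongr
        _ ≤ B * C * ((1 + Λ : ℝ) ^ (d + υ) * poisson ρ d υ (side k) (z k Q) y *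
              (Λ * (σ Q).toReal)) := by gcongr
        _ = _ := by ring
    · rw [indicator_of_notMem hy, abs_zero]
      positivity
  have e : (Real.toNNReal ((1 + Λ : ℝ) ^ (d + υ)) : ℝ) = (1 + Λ : ℝ) ^ (d + υ) :=
    Real.coe_toNNReal _ (by positivity)
  push_cast
  rw [e]
  unfold centered
  calc |κ y - Q.indicator (fun _ => (∫ w, κ w ∂σ) / (σ Q).toReal) y|
      ≤ |κ y| + |Q.indicator (fun _ => (∫ w, κ w ∂σ) / (σ Q).toReal) y| := abs_sub _ _
    _ ≤ B * poisson ρ d υ (side k) (z k Q) y +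
        B * C * Λ * (1 + Λ) ^ (d + υ) * poisson ρ d υ (side k) (z k Q) y :=
        add_le_add (hκ.abs_le y) hind
    _ ≤ _ := by
        have : 0 ≤ (B * C : ℝ) * poisson ρ d υ (side k) (z k Q) y := by positivity
        linarith

end Centered

/-! ### Oscillation of adapted kernels and of indicators, averaged over finer cubes. -/

theorem enorm_le_mul_ofReal {a p : ℝ} {C : ℝ≥0} (h : |a| ≤ C * p) :
    ‖a‖ₑ ≤ C * ENNReal.ofReal p := by
  rw [Real.enorm_eq_ofReal_abs, ← ENNReal.ofReal_coe_nnreal, ← ENNReal.ofReal_mul (by positivity)]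
  exact ENNReal.ofReal_le_ofReal h

/-- The terms of a kernel regularity estimate, before integration. -/
theorem IsAdapted.poisson_mul_abs_sub_le {Y : Type u} [MeasurableSpace Y] {ρ : Y → Y → ℝ}
    {d υ ε r s : ℝ} {B : ℝ≥0} {x : Y} {κ : Y → ℝ} (hκ : IsAdapted ρ d υ ε B s x κ)
    (h0 : ∀ x y, 0 ≤ ρ x y) (hd : 0 ≤ d) (hε : 0 < ε) (hευ : ε ≤ υ) (hr : 0 < r) (hrs : r ≤ s)
    (hB : 1 ≤ B) (w y : Y) :
    poisson ρ d υ r w y * |κ w - κ y| ≤ B * (B + 1) ^ (d + υ) * ((r / s) ^ ε *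
      (poisson ρ d υ s x w * poisson ρ d (υ - ε) r w y +
        poisson ρ d υ s w y * (poisson ρ d υ s x w + poisson ρ d υ s x y))) := by
  have hs : 0 < s := hr.trans_le hrs
  have hB' : (1 : ℝ) ≤ B := by exact_mod_cast hB
  have p1 := poisson_nonneg (d := d) (ε := υ) h0 hr.le w y
  have p2 := poisson_nonneg (d := d) (ε := υ) h0 hs.le x w
  have p3 := poisson_nonneg (d := d) (ε := υ) h0 hs.le x y
  have p4 := poisson_nonneg (d := d) (ε := υ) h0 hs.le w y
  have p5 := poisson_nonneg (d := d) (ε := υ - ε) h0 hr.le w y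
  have hq : 0 ≤ (r / s) ^ ε := by positivity
  have hc1 : 1 ≤ ((B : ℝ) + 1) ^ (d + υ) :=
    Real.one_le_rpow (by linarith) (by linarith)
  -- Near `w`, Hölder regularity applies, and `ε` of the decay of the fine kernel is traded for the
  -- gain `(r / s)^ε`. Far from `w` no regularity is available, but the fine kernel is itself
  -- smaller by `(r / s)^υ` than the one at scale `s`.
  rcases le_or_gt (ρ w y) (s / B) with hn | hf
  · calc poisson ρ d υ r w y * |κ w - κ y|
        ≤ poisson ρ d υ r w y * (B * ((ρ w y / s) ^ ε * poisson ρ d υ s x w)) := by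
          gcongr; exact hκ.holder w y hn
      _ = B * (poisson ρ d υ r w y * (ρ w y / s) ^ ε) * poisson ρ d υ s x w := by ring
      _ ≤ B * ((r / s) ^ ε * poisson ρ d (υ - ε) r w y) * poisson ρ d υ s x w := by
          exact mul_le_mul_of_nonneg_right (mul_le_mul_of_nonneg_left
            (poisson_mul_rpow_le h0 hr hs hε.le w y) B.2) p2
      _ = B * 1 * ((r / s) ^ ε * (poisson ρ d υ s x w * poisson ρ d (υ - ε) r w y + 0)) := by ring
      _ ≤ _ := by gcongr; positivity
  · have h1 : poisson ρ d υ r w y ≤ (B + 1) ^ (d + υ) * (r / s) ^ ε * poisson ρ d υ s w y := by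
      refine (poisson_le_of_far h0 hr hs (by linarith) B.2 (c := B) ?_).trans ?_
      · rw [div_lt_iff₀ (by positivity)] at hf
        linarith
      · have : (r / s) ^ υ ≤ (r / s) ^ ε :=
          Real.rpow_le_rpow_of_exponent_ge (by positivity) ((div_le_one hs).2 hrs) hευ
        gcongr
    have h2 : |κ w - κ y| ≤ B * (poisson ρ d υ s x w + poisson ρ d υ s x y) := by
      have := abs_sub (κ w) (κ y)
      linarith [hκ.abs_le w, hκ.abs_le y]
    calc poisson ρ d υ r w y * |κ w - κ y| ≤ ((B + 1) ^ (d + υ) * (r / s) ^ ε *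
          poisson ρ d υ s w y) * (B * (poisson ρ d υ s x w + poisson ρ d υ s x y)) := by gcongr
      _ = B * (B + 1) ^ (d + υ) * ((r / s) ^ ε * (0 + poisson ρ d υ s w y *
            (poisson ρ d υ s x w + poisson ρ d υ s x y))) := by ring
      _ ≤ _ := by gcongr; positivity

/-- Summing over all the cubes of the finer generation at once replaces pointwise off-diagonal
estimates: after the pointwise bound, only the total masses of Poisson kernels, continuous and
discrete, are needed. The inequality `ε < υ` is strict so that the kernel with the reduced decay `υ
- ε` remains integrable. -/
theorem IsAdapted.tsum_lintegral_sub_le (d υ ε η : ℝ) (Λ B : ℝ≥0) (hd : 0 ≤ d) (hε : 0 < ε)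
    (hευ : ε < υ) (hB : 1 ≤ B) :
    ∃ C : ℝ≥0, ∀ {Y : Type u} [MeasurableSpace Y] {ρ : Y → Y → ℝ} {σ : Measure Y}
      {D : ℤ → Set (Set Y)} {z : ℤ → Set Y → Y}, DyadicSpace ρ σ D z d η Λ →
      ∀ (k l : ℤ) (x : Y) (κ : Y → ℝ), k ≤ l → IsAdapted ρ d υ ε B (side k) x κ →
      ∑' Q : D l, σ Q * ∫⁻ y, ENNReal.ofReal (poisson ρ d υ (side l) (z l Q) y) *
        ‖κ (z l Q) - κ y‖ₑ ∂σ ≤ C * ENNReal.ofReal ((side l / side k) ^ ε) := by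
  obtain ⟨C, hC⟩ := lintegral_poisson_le.{u} d υ Λ hd (hε.trans hευ)
  obtain ⟨C', hC'⟩ := lintegral_poisson_le.{u} d (υ - ε) Λ hd (sub_pos.2 hευ)
  obtain ⟨S, hS⟩ := DyadicSpace.tsum_measure_mul_poisson_le.{u} d υ η Λ hd (hε.trans hευ)
  set A : ℝ≥0 := B * (B + 1) ^ (d + υ) with hA
  refine ⟨A * (S * C' + S * C + S * C), ?_⟩
  intro Y _ ρ σ D z h k l x κ hkl hκ
  have hr := side_pos l
  have hs := side_pos k
  have hrs := side_le_side hkl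
  have hc := (h.countable l).to_subtype
  set q := ENNReal.ofReal ((side l / side k) ^ ε) with hq
  have m1 : ∀ (υ s : ℝ) (w : Y), Measurable fun y => ENNReal.ofReal (poisson ρ d υ s w y) :=
    fun υ s w => (measurable_poisson h.measurable_dist w).ennreal_ofReal
  set P := fun w y => ENNReal.ofReal (poisson ρ d υ (side k) w y) with hP
  set P' := fun w y => ENNReal.ofReal (poisson ρ d (υ - ε) (side l) w y) with hP'
  have hpt : ∀ w y, ENNReal.ofReal (poisson ρ d υ (side l) w y) * ‖κ w - κ y‖ₑ ≤
      A * q * (P x w * P' w y + P w y * P x w + P w y * P x y) := by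
    intro w y
    have p1 := poisson_nonneg (d := d) (ε := υ) h.nonneg hr.le w y
    have p2 := poisson_nonneg (d := d) (ε := υ) h.nonneg hs.le x w
    have p3 := poisson_nonneg (d := d) (ε := υ) h.nonneg hs.le x y
    have p4 := poisson_nonneg (d := d) (ε := υ) h.nonneg hs.le w y
    have p5 := poisson_nonneg (d := d) (ε := υ - ε) h.nonneg hr.le w y
    have := ENNReal.ofReal_le_ofReal
      (hκ.poisson_mul_abs_sub_le h.nonneg hd hε hευ.le hr hrs hB w y)
    have hAe : (B : ℝ) * (B + 1) ^ (d + υ) = A := by rw [hA]; push_cast; rfl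
    rw [ENNReal.ofReal_mul p1, ← Real.enorm_eq_ofReal_abs, hAe] at this
    refine this.trans (le_of_eq ?_)
    rw [ENNReal.ofReal_mul A.coe_nonneg, ENNReal.ofReal_mul (by positivity),
      ENNReal.ofReal_add (by positivity) (by positivity), ENNReal.ofReal_mul p2,
      ENNReal.ofReal_mul p4, ENNReal.ofReal_add p2 p3, ENNReal.ofReal_coe_nnreal]
    ring
  have bound : ∀ w, ∫⁻ y, ENNReal.ofReal (poisson ρ d υ (side l) w y) * ‖κ w - κ y‖ₑ ∂σ ≤
      A * q * (P x w * C' + P x w * C + ∫⁻ y, P w y * P x y ∂σ) := by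
    intro w
    refine (lintegral_mono (hpt w)).trans ?_
    rw [lintegral_const_mul _ (by fun_prop), lintegral_add_left (by fun_prop),
      lintegral_add_left (by fun_prop), lintegral_const_mul _ (m1 _ _ _),
      lintegral_mul_const _ (m1 _ _ _), mul_comm (∫⁻ y, P w y ∂σ)]
    gcongr
    · exact hC' h.nonneg h.measurable_dist h.measure_ball_le _ _ hr
    · exact hC h.nonneg h.measurable_dist h.measure_ball_le _ _ hs
  calc ∑' Q : D l, σ Q * ∫⁻ y, ENNReal.ofReal (poisson ρ d υ (side l) (z l Q) y) *
        ‖κ (z l Q) - κ y‖ₑ ∂σ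
      ≤ ∑' Q : D l, σ Q * (A * q * (P x (z l Q) * C' + P x (z l Q) * C +
          ∫⁻ y, P (z l Q) y * P x y ∂σ)) := by
        gcongr with Q
        exact bound _
    _ = A * q * ((∑' Q : D l, σ Q * P x (z l Q)) * C' + (∑' Q : D l, σ Q * P x (z l Q)) * C +
          ∫⁻ y, (∑' Q : D l, σ Q * P (z l Q) y) * P x y ∂σ) := by
        have e : ∫⁻ y, (∑' Q : D l, σ Q * P (z l Q) y) * P x y ∂σ =
            ∑' Q : D l, σ Q * ∫⁻ y, P (z l Q) y * P x y ∂σ := by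
          rw [← lintegral_congr fun y => ENNReal.tsum_mul_right, lintegral_tsum (fun Q => by
            refine Measurable.aemeasurable ?_; fun_prop)]
          refine tsum_congr fun Q => ?_
          rw [← lintegral_const_mul _ (by fun_prop)]
          exact lintegral_congr fun y => mul_assoc _ _ _
        rw [e, ← ENNReal.tsum_mul_right, ← ENNReal.tsum_mul_right, ← ENNReal.tsum_add,
          ← ENNReal.tsum_add, ← ENNReal.tsum_mul_left]
        exact tsum_congr fun Q => by ring
    _ ≤ A * q * (S * C' + S * C + ∫⁻ y, S * P x y ∂σ) := by
        gcongr with y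
        · exact (hS h l (side k) x hrs).2
        · exact (hS h l (side k) x hrs).2
        · exact (hS h l (side k) y hrs).1
    _ ≤ A * q * (S * C' + S * C + S * C) := by
        rw [lintegral_const_mul _ (m1 _ _ _)]
        gcongr
        exact hC h.nonneg h.measurable_dist h.measure_ball_le _ _ hs
    _ = _ := by push_cast; ring

/-- The thin boundary condition makes the indicators of cubes regular on average. -/
theorem DyadicSpace.tsum_lintegral_indicator_sub_le (d υ ε η : ℝ) (Λ : ℝ≥0) (hd : 0 ≤ d)
    (hε : 0 < ε) (hευ : 2 * ε ≤ υ) (hεη : 2 * ε ≤ η) :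
    ∃ C : ℝ≥0, ∀ {Y : Type u} [MeasurableSpace Y] {ρ : Y → Y → ℝ} {σ : Measure Y}
      {D : ℤ → Set (Set Y)} {z : ℤ → Set Y → Y}, DyadicSpace ρ σ D z d η Λ →
      ∀ (k l : ℤ) (R : Set Y), k ≤ l → R ∈ D k →
      ∑' Q : D l, σ Q * ∫⁻ y, ENNReal.ofReal (poisson ρ d υ (side l) (z l Q) y) *
        ‖R.indicator (1 : Y → ℝ) (z l Q) - R.indicator 1 y‖ₑ ∂σ ≤
          C * ENNReal.ofReal ((side l / side k) ^ ε) * σ R := by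
  have hυ : 0 < υ := by linarith
  obtain ⟨C, hC⟩ := lintegral_poisson_le.{u} d υ Λ hd hυ
  obtain ⟨S, hS⟩ := DyadicSpace.tsum_measure_mul_poisson_le.{u} d υ η Λ hd hυ
  set A : ℝ≥0 := Real.toNNReal ((Λ + 1) ^ (d + υ)) with hA
  set T₀ : ℝ≥0 := Λ * Real.toNNReal ((3 * Λ ^ 3) ^ η) with hT₀
  refine ⟨C * (T₀ + A) + S * (T₀ + A), ?_⟩
  intro Y _ ρ σ D z h k l R hkl hR
  have hΛ : (1 : ℝ) ≤ Λ := by exact_mod_cast h.one_le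
  have hr := side_pos l
  have hs := side_pos k
  have hrs := side_le_side hkl
  have hc := (h.countable l).to_subtype
  -- The scale `v * side k` is the geometric mean of `side l` and `side k`. A boundary layer of this
  -- width has relative measure about `v^η`, and across such a gap the kernel of scale `side l`
  -- loses a factor `v^υ`. Both are at most `(side l / side k)^ε` because `2 * ε` is at most `η` and
  -- `υ`.
  set v : ℝ := √(side l / side k) with hv
  have hv0 : 0 < v := Real.sqrt_pos.2 (by positivity)
  have hv2 : v ^ 2 = side l / side k := Real.sq_sqrt (by positivity)
  have hv1 : v ≤ 1 := Real.sqrt_le_one.2 ((div_le_one hs).2 hrs)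
  have hrv : side l = v ^ 2 * side k := by rw [hv2]; field_simp
  set q := ENNReal.ofReal ((side l / side k) ^ ε) with hq
  have hpow : ∀ τ, 2 * ε ≤ τ → v ^ τ ≤ (side l / side k) ^ ε := by
    intro τ hτ
    rw [← hv2, ← Real.rpow_natCast, ← Real.rpow_mul hv0.le]
    exact Real.rpow_le_rpow_of_exponent_ge hv0 hv1 (by simpa using hτ)
  have hvs : 0 < v * side k := by positivity
  have hls : side l ≤ v * side k := by rw [hrv]; nlinarith
  have hlv : side l / (v * side k) = v := by rw [hrv]; field_simp
  have hfar : ∀ w y, v * side k ≤ Λ * ρ w y → ENNReal.ofReal (poisson ρ d υ (side l) w y) ≤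
      A * q * ENNReal.ofReal (poisson ρ d υ (v * side k) w y) := by
    intro w y hwy
    have := poisson_le_of_far (d := d) (ε := υ) h.nonneg hr hvs (by linarith) Λ.2 hwy
    rw [hlv] at this
    rw [hA, hq, ← ENNReal.ofReal, ← ENNReal.ofReal_mul (by positivity),
      ← ENNReal.ofReal_mul (by positivity)]
    refine ENNReal.ofReal_le_ofReal (this.trans ?_)
    have p := poisson_nonneg (d := d) (ε := υ) h.nonneg hvs.le w y
    gcongr
    · exact le_rfl
    · exact hpow υ hευ
  set t : ℝ := 3 * Λ ^ 3 * v with ht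
  have ht0 : 0 < t := by positivity
  set U := {x | x ∈ R ∧ ∃ y, y ∉ R ∧ ρ x y < t * side k} with hU
  -- The boundary layer is not known to be measurable, so it is replaced by a measurable hull of the
  -- same measure.
  set T := toMeasurable σ U with hT
  have hTm : MeasurableSet T := measurableSet_toMeasurable _ _
  have hUT : U ⊆ T := subset_toMeasurable _ _
  have hσT : σ T ≤ T₀ * q * σ R := by
    rw [hT, measure_toMeasurable]
    refine (h.thin_boundary k R hR t ht0).trans ?_
    refine mul_le_mul_left ?_ _
    rw [hT₀]
    push_cast
    rw [mul_assoc]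
    refine mul_le_mul_right ?_ _
    rw [← ENNReal.ofReal, hq, ← ENNReal.ofReal_mul (by positivity), ht,
      Real.mul_rpow (by positivity) hv0.le]
    exact ENNReal.ofReal_le_ofReal (by gcongr; exact hpow η hεη)
  have hvt : v * side k ≤ t * side k := by
    have : (1 : ℝ) ≤ Λ ^ 3 := one_le_pow₀ hΛ
    rw [ht]; gcongr; nlinarith
  have m1 : ∀ w, Measurable fun y => ENNReal.ofReal (poisson ρ d υ (side l) w y) :=
    fun w => (measurable_poisson h.measurable_dist w).ennreal_ofReal
  have m2 : ∀ w, Measurable fun y => ENNReal.ofReal (poisson ρ d υ (v * side k) w y) :=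
    fun w => (measurable_poisson h.measurable_dist w).ennreal_ofReal
  have hRm := h.measurable k R hR
  have hQm : ∀ Q : D l, MeasurableSet Q.1 := fun Q => h.measurable l Q Q.2
  have hQd : Pairwise (Function.onFun Disjoint fun Q : D l => Q.1) := fun Q Q' hQ =>
    h.disjoint l Q Q.2 Q' Q'.2 fun e => hQ (Subtype.ext e)
  -- the contribution of a single cube
  have each : ∀ Q : D l, σ Q * ∫⁻ y, ENNReal.ofReal (poisson ρ d υ (side l) (z l Q) y) *
        ‖R.indicator (1 : Y → ℝ) (z l Q) - R.indicator 1 y‖ₑ ∂σ ≤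
      C * (σ (Q.1 ∩ T) + A * q * σ (Q.1 ∩ R)) +
      ∫⁻ y in R, σ Q * {w | w ∉ R}.indicator
        (fun w => ENNReal.ofReal (poisson ρ d υ (side l) w y)) (z l Q) ∂σ := by
    intro Q
    have hzQ := h.ctr_mem l Q Q.2
    -- A cube inside `R` with centre close to the complement lies entirely in the layer `T` and is
    -- estimated crudely; if its centre is not close, the kernel sees the complement only across the
    -- gap. For a cube outside `R`, the mass falling into `R` is kept as an integral, to be summed
    -- over the cubes first.
    rcases h.nested k l hkl R hR Q Q.2 with hsub | hdis
    · have hzR : z l Q ∈ R := hsub hzQ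
      refine le_trans ?_ (le_add_right le_rfl)
      by_cases hnear : ∃ y, y ∉ R ∧ ρ (z l Q) y < v * side k
      · obtain ⟨y, hyR, hy⟩ := hnear
        have hQT : Q.1 ⊆ T := by
          refine fun w hw => hUT ⟨hsub hw, y, hyR, ?_⟩
          have a1 := h.triangle w y (z l Q)
          have a2 := h.symm_le (z l Q) w
          have a3 := h.dist_ctr_le l Q Q.2 w hw
          have a4 : ρ w (z l Q) ≤ Λ ^ 2 * (v * side k) := by
            calc ρ w (z l Q) ≤ Λ * (Λ * side l) := a2.trans (by gcongr)
              _ ≤ Λ * (Λ * (v * side k)) := by gcongr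
              _ = _ := by ring
          have b2 : (1 : ℝ) ≤ Λ ^ 2 := one_le_pow₀ hΛ
          have b3 : (0 : ℝ) < Λ ^ 3 := by positivity
          calc ρ w y ≤ Λ * (Λ ^ 2 * (v * side k) + v * side k) :=
                a1.trans (mul_le_mul_of_nonneg_left (add_le_add a4 hy.le) Λ.coe_nonneg)
            _ ≤ Λ * (Λ ^ 2 * (v * side k) + Λ ^ 2 * (v * side k)) := by
                have : v * side k ≤ Λ ^ 2 * (v * side k) := le_mul_of_one_le_left hvs.le b2
                gcongr
            _ = 2 * (Λ ^ 3 * (v * side k)) := by ring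
            _ < t * side k := by rw [ht]; nlinarith [mul_pos b3 hvs]
        rw [inter_eq_self_of_subset_left hQT]
        calc σ Q * ∫⁻ y, ENNReal.ofReal (poisson ρ d υ (side l) (z l Q) y) *
              ‖R.indicator (1 : Y → ℝ) (z l Q) - R.indicator 1 y‖ₑ ∂σ
            ≤ σ Q * ∫⁻ y, ENNReal.ofReal (poisson ρ d υ (side l) (z l Q) y) ∂σ := by
              gcongr with y
              refine mul_le_of_le_one_right' ?_
              by_cases hy : y ∈ R <;> simp [hzR, hy]
          _ ≤ σ Q * C := by gcongr; exact hC h.nonneg h.measurable_dist h.measure_ball_le _ _ hr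
          _ = C * σ Q := mul_comm _ _
          _ ≤ _ := by gcongr; exact le_add_right le_rfl
      · push Not at hnear
        rw [inter_eq_self_of_subset_left hsub]
        calc σ Q * ∫⁻ y, ENNReal.ofReal (poisson ρ d υ (side l) (z l Q) y) *
              ‖R.indicator (1 : Y → ℝ) (z l Q) - R.indicator 1 y‖ₑ ∂σ
            ≤ σ Q * ∫⁻ y, A * q * ENNReal.ofReal (poisson ρ d υ (v * side k) (z l Q) y) ∂σ := by
              refine mul_le_mul_right (lintegral_mono fun y => ?_) _
              by_cases hy : y ∈ R
              · simp [hzR, hy]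
              · refine (mul_le_of_le_one_right' (by simp [hzR, hy])).trans (hfar _ _ ?_)
                have := hnear y hy
                have := h.nonneg (z l Q) y
                nlinarith
          _ ≤ σ Q * (A * q * C) := by
              rw [lintegral_const_mul _ (m2 _)]
              gcongr; exact hC h.nonneg h.measurable_dist h.measure_ball_le _ _ hvs
          _ = C * (A * q * σ Q) := by ring
          _ ≤ _ := by gcongr; exact le_add_left le_rfl
    · have hzR : z l Q ∉ R := fun hz => disjoint_left.1 hdis hzQ hz
      refine le_trans ?_ (le_add_left le_rfl)
      simp_rw [indicator_of_mem (show z l Q ∈ {w | w ∉ R} from hzR)]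
      rw [lintegral_const_mul _ (m1 _), ← lintegral_indicator hRm]
      refine mul_le_mul_right (lintegral_mono fun y => ?_) _
      by_cases hy : y ∈ R <;> simp [hzR, hy]
  -- The cubes outside `R`, summed with `y ∈ R` fixed: if `y` is in the layer, the total mass is
  -- bounded by a constant; otherwise every outside centre lies across the gap.
  have inner : ∀ y ∈ R, ∑' Q : D l, σ Q * {w | w ∉ R}.indicator
        (fun w => ENNReal.ofReal (poisson ρ d υ (side l) w y)) (z l Q) ≤
      S * (T.indicator 1 y + A * q) := by
    intro y hy
    by_cases hyU : y ∈ U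
    · rw [indicator_of_mem (hUT hyU)]
      calc ∑' Q : D l, σ Q * {w | w ∉ R}.indicator
            (fun w => ENNReal.ofReal (poisson ρ d υ (side l) w y)) (z l Q)
          ≤ ∑' Q : D l, σ Q * ENNReal.ofReal (poisson ρ d υ (side l) (z l Q) y) := by
            gcongr with Q
            exact indicator_le_self _ (fun w => ENNReal.ofReal (poisson ρ d υ (side l) w y)) _
        _ ≤ S := (hS h l (side l) y le_rfl).1
        _ ≤ S * (1 + A * q) := le_mul_of_one_le_right' (le_add_right le_rfl)
    · calc ∑' Q : D l, σ Q * {w | w ∉ R}.indicator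
            (fun w => ENNReal.ofReal (poisson ρ d υ (side l) w y)) (z l Q)
          ≤ ∑' Q : D l, A * q * (σ Q *
              ENNReal.ofReal (poisson ρ d υ (v * side k) (z l Q) y)) := by
            refine ENNReal.tsum_le_tsum fun Q => ?_
            rw [mul_left_comm]
            refine mul_le_mul_right ?_ _
            by_cases hz : z l Q ∈ R
            · simp [hz]
            · rw [indicator_of_mem (show z l Q ∈ {w | w ∉ R} from hz)]
              refine hfar _ _ ?_
              have a1 := h.symm_le (z l Q) y
              have a2 : t * side k ≤ ρ y (z l Q) := by
                by_contra hlt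
                exact hyU ⟨hy, z l Q, hz, not_le.1 hlt⟩
              linarith
        _ ≤ A * q * S := by
            rw [ENNReal.tsum_mul_left]
            gcongr
            exact (hS h l (v * side k) y hls).1
        _ = S * (A * q) := mul_comm _ _
        _ ≤ _ := by gcongr; exact le_add_left le_rfl
  have sumle : ∀ V : Set Y, MeasurableSet V → ∑' Q : D l, σ (Q.1 ∩ V) ≤ σ V := by
    intro V hV
    rw [← measure_iUnion (fun Q Q' hQ => (hQd hQ).mono inter_subset_left inter_subset_left)
      (fun Q => (hQm Q).inter hV)]
    exact measure_mono (iUnion_subset fun Q => inter_subset_right)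
  calc ∑' Q : D l, σ Q * ∫⁻ y, ENNReal.ofReal (poisson ρ d υ (side l) (z l Q) y) *
        ‖R.indicator (1 : Y → ℝ) (z l Q) - R.indicator 1 y‖ₑ ∂σ
      ≤ ∑' Q : D l, (C * (σ (Q.1 ∩ T) + A * q * σ (Q.1 ∩ R)) +
        ∫⁻ y in R, σ Q * {w | w ∉ R}.indicator
          (fun w => ENNReal.ofReal (poisson ρ d υ (side l) w y)) (z l Q) ∂σ) :=
        ENNReal.tsum_le_tsum each
    _ = C * (∑' Q : D l, σ (Q.1 ∩ T) + A * q * ∑' Q : D l, σ (Q.1 ∩ R)) +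
        ∫⁻ y in R, ∑' Q : D l, σ Q * {w | w ∉ R}.indicator
          (fun w => ENNReal.ofReal (poisson ρ d υ (side l) w y)) (z l Q) ∂σ := by
        rw [ENNReal.tsum_add, ENNReal.tsum_mul_left, ENNReal.tsum_add, ENNReal.tsum_mul_left,
          lintegral_tsum]
        intro Q
        refine (Measurable.const_mul ?_ _).aemeasurable
        by_cases hz : z l Q ∈ R
        · simp [hz]
        · simpa [hz] using m1 (z l Q)
    _ ≤ C * (T₀ * q * σ R + A * q * σ R) + ∫⁻ y in R, S * (T.indicator 1 y + A * q) ∂σ := by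
        gcongr _ * (?_ + _ * ?_) + ?_
        · exact (sumle T hTm).trans hσT
        · exact sumle R hRm
        · exact setLIntegral_mono' hRm inner
    _ ≤ C * (T₀ * q * σ R + A * q * σ R) + S * (T₀ * q * σ R + A * q * σ R) := by
        gcongr
        rw [lintegral_const_mul _ ((measurable_one.indicator hTm).add_const _),
          lintegral_add_right _ measurable_const, setLIntegral_const]
        gcongr
        refine (setLIntegral_le_lintegral _ _).trans ?_
        rw [lintegral_indicator_one hTm]
        exact hσT
    _ = _ := by push_cast; ring

/-! ### Almost orthogonality and the Bessel inequality. -/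

/-- The cubes of a dyadic structure, as pairs of a generation and a set. -/
def cubes {Y : Type*} (D : ℤ → Set (Set Y)) : Set (ℤ × Set Y) := {p | p.2 ∈ D p.1}

theorem tsum_cubes {Y : Type*} (D : ℤ → Set (Set Y)) (F : ℤ → Set Y → ℝ≥0∞) :
    ∑' p : cubes D, F p.1.1 p.1.2 = ∑' k, ∑' Q : D k, F k Q := by
  let e : (Σ k, D k) ≃ cubes D :=
    { toFun := fun p => ⟨(p.1, p.2.1), p.2.2⟩
      invFun := fun p => ⟨p.1.1, p.1.2, p.2⟩
      left_inv := fun _ => rfl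
      right_inv := fun _ => rfl }
  rw [← ENNReal.tsum_sigma (fun k (Q : D k) => F k Q), ← e.tsum_eq]
  rfl

theorem countable_cubes {Y : Type*} {D : ℤ → Set (Set Y)} (h : ∀ k, (D k).Countable) :
    (cubes D).Countable := by
  have : cubes D = ⋃ k : ℤ, (fun Q => (k, Q)) '' D k := by
    ext ⟨k, Q⟩
    simp [cubes]
  rw [this]
  exact countable_iUnion fun k => (h k).image _

section Bessel

open scoped InnerProductSpace ComplexConjugate

/-- A Bessel inequality for almost orthogonal vectors, by Schur's test. -/
theorem sum_mul_sq_norm_inner_le {H ι : Type*} [NormedAddCommGroup H] [InnerProductSpace ℂ H]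
    (S : Finset ι) (v : ι → H) (s : ι → ℝ) (w : ι → ι → ℝ) (C : ℝ) (hC0 : 0 ≤ C) (hs : ∀ i, 0 ≤ s i)
    (hw : ∀ i j, 0 < w i j) (hww : ∀ i j, w i j * w j i = 1)
    (hC : ∀ i ∈ S, ∑ j ∈ S, w i j * s j * ‖⟪v i, v j⟫_ℂ‖ ≤ C) (g : H) :
    ∑ i ∈ S, s i * ‖⟪v i, g⟫_ℂ‖ ^ 2 ≤ C * ‖g‖ ^ 2 := by
  set t : ι → ℂ := fun i => ⟪v i, g⟫_ℂ with ht
  set A := ∑ i ∈ S, s i * ‖t i‖ ^ 2 with hA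
  -- Duality: `A` is the inner product of `x` with `g`, so it suffices to bound `‖x‖ ^ 2` by `C *
  -- A`.
  set x : H := ∑ i ∈ S, ((s i : ℂ) * t i) • v i with hx
  have hA0 : 0 ≤ A := Finset.sum_nonneg fun i _ => mul_nonneg (hs i) (by positivity)
  have hxg : ⟪x, g⟫_ℂ = (A : ℂ) := by
    rw [hx, sum_inner, hA]
    push_cast
    refine Finset.sum_congr rfl fun i _ => ?_
    rw [inner_smul_left, map_mul, Complex.conj_ofReal, mul_assoc, ← Complex.conj_mul']
  have h1 : A ≤ ‖x‖ * ‖g‖ := by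
    have := norm_inner_le_norm (𝕜 := ℂ) x g
    rwa [hxg, Complex.norm_real, Real.norm_of_nonneg hA0] at this
  have h2 : ‖x‖ ^ 2 ≤ C * A := by
    have e : (‖x‖ : ℂ) ^ 2 = ∑ i ∈ S, ∑ j ∈ S,
        conj ((s i : ℂ) * t i) * (((s j : ℂ) * t j) * ⟪v i, v j⟫_ℂ) := by
      rw [← Complex.coe_algebraMap, ← inner_self_eq_norm_sq_to_K (𝕜 := ℂ) x]
      conv_lhs => rw [hx]
      rw [sum_inner]
      refine Finset.sum_congr rfl fun i _ => ?_
      rw [inner_sum]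
      refine Finset.sum_congr rfl fun j _ => ?_
      rw [inner_smul_left, inner_smul_right]
      rfl
    have e2 : ‖x‖ ^ 2 ≤ ∑ i ∈ S, ∑ j ∈ S,
        s i * ‖t i‖ * (s j * ‖t j‖) * ‖⟪v i, v j⟫_ℂ‖ := by
      calc ‖x‖ ^ 2 = ‖((‖x‖ : ℂ)) ^ 2‖ := by simp
        _ ≤ _ := by
            rw [e]
            refine (norm_sum_le _ _).trans (Finset.sum_le_sum fun i _ =>
              (norm_sum_le _ _).trans (Finset.sum_le_sum fun j _ => le_of_eq ?_))
            rw [norm_mul, norm_mul, RCLike.norm_conj, norm_mul, norm_mul, Complex.norm_real,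
              Complex.norm_real, Real.norm_of_nonneg (hs i), Real.norm_of_nonneg (hs j)]
            ring
    have e3 : ∀ i j, s i * ‖t i‖ * (s j * ‖t j‖) * ‖⟪v i, v j⟫_ℂ‖ ≤
        1 / 2 * (s i * ‖t i‖ ^ 2 * (w i j * s j * ‖⟪v i, v j⟫_ℂ‖)) +
        1 / 2 * (s j * ‖t j‖ ^ 2 * (w j i * s i * ‖⟪v j, v i⟫_ℂ‖)) := by
      intro i j
      rw [norm_inner_symm (v j) (v i)]
      -- The weights are inserted as `√(w i j) * √(w j i) = 1` before the arithmetic-geometric mean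
      -- inequality.
      have a1 : ‖t i‖ * ‖t j‖ ≤ 1 / 2 * (‖t i‖ ^ 2 * w i j) + 1 / 2 * (‖t j‖ ^ 2 * w j i) := by
        have b1 : √(w i j) * √(w j i) = 1 := by
          rw [← Real.sqrt_mul (hw i j).le, hww, Real.sqrt_one]
        have b2 := Real.sq_sqrt (hw i j).le
        have b3 := Real.sq_sqrt (hw j i).le
        have b4 := two_mul_le_add_sq (‖t i‖ * √(w i j)) (‖t j‖ * √(w j i))
        rw [mul_pow, mul_pow, b2, b3, mul_assoc 2, mul_mul_mul_comm, b1] at b4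
        linarith
      have a2 : 0 ≤ s i * s j * ‖⟪v i, v j⟫_ℂ‖ :=
        mul_nonneg (mul_nonneg (hs i) (hs j)) (norm_nonneg _)
      nlinarith [mul_le_mul_of_nonneg_left a1 a2]
    have e4 : ∑ i ∈ S, ∑ j ∈ S, s i * ‖t i‖ ^ 2 * (w i j * s j * ‖⟪v i, v j⟫_ℂ‖) ≤ C * A := by
      rw [hA, Finset.mul_sum]
      refine Finset.sum_le_sum fun i hi => ?_
      rw [← Finset.mul_sum, mul_comm C]
      exact mul_le_mul_of_nonneg_left (hC i hi) (mul_nonneg (hs i) (by positivity))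
    have e5 : ∑ i ∈ S, ∑ j ∈ S, s j * ‖t j‖ ^ 2 * (w j i * s i * ‖⟪v j, v i⟫_ℂ‖) ≤ C * A := by
      rw [Finset.sum_comm]
      exact e4
    refine e2.trans ((Finset.sum_le_sum fun i _ => Finset.sum_le_sum fun j _ => e3 i j).trans ?_)
    calc _ = 1 / 2 * ∑ i ∈ S, ∑ j ∈ S, s i * ‖t i‖ ^ 2 * (w i j * s j * ‖⟪v i, v j⟫_ℂ‖) +
          1 / 2 * ∑ i ∈ S, ∑ j ∈ S, s j * ‖t j‖ ^ 2 * (w j i * s i * ‖⟪v j, v i⟫_ℂ‖) := by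
          simp only [Finset.sum_add_distrib, Finset.mul_sum]
      _ ≤ C * A := by linarith
  rcases hA0.eq_or_lt with h0 | h0
  · change A ≤ _
    rw [← h0]
    positivity
  · change A ≤ _
    have h3 : A ^ 2 ≤ ‖x‖ ^ 2 * ‖g‖ ^ 2 := by
      rw [← mul_pow]; exact pow_le_pow_left₀ hA0 h1 2
    have h4 : A * A ≤ A * (C * ‖g‖ ^ 2) := by nlinarith [sq_nonneg ‖g‖]
    exact le_of_mul_le_mul_left h4 h0

end Bessel

/-- Orthogonality between levels without gain. -/
theorem IsAdapted.tsum_lintegral_centered_mul_le (d υ ε η : ℝ) (Λ B : ℝ≥0) (hd : 0 ≤ d)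
    (hυ : 0 < υ) :
    ∃ C : ℝ≥0, ∀ {Y : Type u} [MeasurableSpace Y] {ρ : Y → Y → ℝ} {σ : Measure Y}
      {D : ℤ → Set (Set Y)} {z : ℤ → Set Y → Y} {κ : ℤ → Set Y → Y → ℝ},
      DyadicSpace ρ σ D z d η Λ →
      (∀ k, ∀ Q ∈ D k, IsAdapted ρ d υ ε B (side k) (z k Q) (κ k Q)) →
      ∀ (j k : ℤ) (Q : Set Y), Q ∈ D j → ∑' R : D k, σ R *
        ‖∫ y, centered σ (κ j Q) Q y * centered σ (κ k R) R y ∂σ‖ₑ ≤ C := by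
  obtain ⟨C, hC⟩ := lintegral_poisson_le.{u} d υ Λ hd hυ
  obtain ⟨S, hS⟩ := DyadicSpace.tsum_measure_mul_poisson_le.{u} d υ η Λ hd hυ
  obtain ⟨A, hA⟩ := IsAdapted.abs_centered_le.{u} d υ ε η Λ B hd hυ
  refine ⟨A * A * S * C, ?_⟩
  intro Y _ ρ σ D z κ h hκ j k Q hQ
  have hc := (h.countable k).to_subtype
  have m1 : ∀ (s : ℝ) (w : Y), Measurable fun y => ENNReal.ofReal (poisson ρ d υ s w y) :=
    fun s w => (measurable_poisson h.measurable_dist w).ennreal_ofReal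
  have hle : ∀ k, ∀ Q ∈ D k, ∀ y, ‖centered σ (κ k Q) Q y‖ₑ ≤
      A * ENNReal.ofReal (poisson ρ d υ (side k) (z k Q) y) := fun k Q hQ y =>
    enorm_le_mul_ofReal ((hA h k Q _ hQ (hκ k Q hQ)).2.2 y)
  calc ∑' R : D k, σ R * ‖∫ y, centered σ (κ j Q) Q y * centered σ (κ k R) R y ∂σ‖ₑ
      ≤ ∑' R : D k, σ R * ∫⁻ y, A * A * (ENNReal.ofReal (poisson ρ d υ (side j) (z j Q) y) *
          ENNReal.ofReal (poisson ρ d υ (side k) (z k R) y)) ∂σ := by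
        refine ENNReal.tsum_le_tsum fun R => mul_le_mul_right ?_ _
        refine (enorm_integral_le_lintegral_enorm _).trans (lintegral_mono fun y => ?_)
        rw [enorm_mul, mul_mul_mul_comm]
        exact mul_le_mul' (hle j Q hQ y) (hle k R R.2 y)
    _ = A * A * ∫⁻ y, (∑' R : D k, σ R * ENNReal.ofReal (poisson ρ d υ (side k) (z k R) y)) *
          ENNReal.ofReal (poisson ρ d υ (side j) (z j Q) y) ∂σ := by
        rw [← lintegral_congr fun y => ENNReal.tsum_mul_right, lintegral_tsum (fun R => by
          refine Measurable.aemeasurable ?_; fun_prop), ← ENNReal.tsum_mul_left]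
        refine tsum_congr fun R => ?_
        rw [← lintegral_const_mul _ (by fun_prop), ← lintegral_const_mul _ (by fun_prop)]
        exact lintegral_congr fun y => by ring
    _ ≤ A * A * ∫⁻ y, S * ENNReal.ofReal (poisson ρ d υ (side j) (z j Q) y) ∂σ := by
        gcongr with y
        exact (hS h k (side k) y le_rfl).1
    _ ≤ A * A * (S * C) := by
        rw [lintegral_const_mul _ (m1 _ _)]
        gcongr
        exact hC h.nonneg h.measurable_dist h.measure_ball_le _ _ (side_pos j)
    _ = _ := by push_cast; ring

section

variable {Y : Type u} [MeasurableSpace Y] {ρ : Y → Y → ℝ} {σ : Measure Y}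
  {D : ℤ → Set (Set Y)} {z : ℤ → Set Y → Y} {d υ ε η : ℝ} {Λ B : ℝ≥0}

theorem integrable_centered {κ : Y → ℝ} (hκ : Integrable κ σ) {Q : Set Y} (hQ : MeasurableSet Q)
    (ht : σ Q ≠ ∞) : Integrable (centered σ κ Q) σ :=
  hκ.sub ((integrable_indicator_iff hQ).2 (integrableOn_const ht (by simp)))

theorem IsAdapted.exists_abs_centered_le (h : DyadicSpace ρ σ D z d η Λ) (hd : 0 ≤ d) (hυ : 0 < υ)
    {k : ℤ} {Q : Set Y} {κ : Y → ℝ} (hQ : Q ∈ D k)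
    (hκ : IsAdapted ρ d υ ε B (side k) (z k Q) κ) :
    ∃ c : ℝ, ∀ y, ‖centered σ κ Q y‖ ≤ c := by
  obtain ⟨A, hA⟩ := IsAdapted.abs_centered_le.{u} d υ ε η Λ B hd hυ
  refine ⟨A * side k ^ (-d), fun y => ((hA h k Q κ hQ hκ).2.2 y).trans ?_⟩
  gcongr
  exact poisson_le_rpow_neg h.nonneg (side_pos k) (by linarith) _ _

theorem IsAdapted.integrable (h : DyadicSpace ρ σ D z d η Λ) (hd : 0 ≤ d) (hυ : 0 < υ)
    {k : ℤ} {Q : Set Y} {κ : Y → ℝ} (hQ : Q ∈ D k)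
    (hκ : IsAdapted ρ d υ ε B (side k) (z k Q) κ) : Integrable κ σ := by
  obtain ⟨A, hA⟩ := IsAdapted.abs_centered_le.{u} d υ ε η Λ B hd hυ
  exact (hA h k Q κ hQ hκ).1

theorem IsAdapted.memLp_centered (h : DyadicSpace ρ σ D z d η Λ) (hd : 0 ≤ d) (hυ : 0 < υ)
    {k : ℤ} {Q : Set Y} {κ : Y → ℝ} (hQ : Q ∈ D k)
    (hκ : IsAdapted ρ d υ ε B (side k) (z k Q) κ) : MemLp (centered σ κ Q) 2 σ := by
  have hm := (measurable_centered (σ := σ) hκ.measurable (h.measurable k Q hQ)).aestronglyMeasurable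
    (μ := σ)
  obtain ⟨c, hc⟩ := hκ.exists_abs_centered_le h hd hυ hQ
  rw [memLp_two_iff_integrable_sq hm]
  have := (integrable_centered (hκ.integrable h hd hυ hQ) (h.measurable k Q hQ)
    (h.measure_ne_top hQ)).bdd_mul hm (Filter.Eventually.of_forall hc)
  simpa [sq] using this

end

/-- Orthogonality between levels, with a gain. -/
theorem IsAdapted.tsum_inner_centered_le (d υ ε η : ℝ) (Λ B : ℝ≥0) (hd : 0 ≤ d)
    (hε : 0 < ε) (hευ : 2 * ε ≤ υ) (hεη : 2 * ε ≤ η) (hB : 1 ≤ B) :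
    ∃ C : ℝ≥0, ∀ {Y : Type u} [MeasurableSpace Y] {ρ : Y → Y → ℝ} {σ : Measure Y}
      {D : ℤ → Set (Set Y)} {z : ℤ → Set Y → Y} {κ : ℤ → Set Y → Y → ℝ},
      DyadicSpace ρ σ D z d η Λ →
      (∀ k, ∀ Q ∈ D k, IsAdapted ρ d υ ε B (side k) (z k Q) (κ k Q)) →
      ∀ (k l : ℤ) (R : Set Y), k ≤ l → R ∈ D k → ∑' Q : D l, σ Q *
        ‖∫ y, centered σ (κ k R) R y * centered σ (κ l Q) Q y ∂σ‖ₑ ≤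
          C * ENNReal.ofReal ((side l / side k) ^ ε) := by
  have hυ : 0 < υ := by linarith
  obtain ⟨A, hA⟩ := IsAdapted.abs_centered_le.{u} d υ ε η Λ B hd hυ
  obtain ⟨C₁, hC₁⟩ := IsAdapted.tsum_lintegral_sub_le.{u} d υ ε η Λ B hd hε (by linarith) hB
  obtain ⟨C₂, hC₂⟩ := DyadicSpace.tsum_lintegral_indicator_sub_le.{u} d υ ε η Λ hd hε hευ hεη
  refine ⟨A * (C₁ + A * C₂), ?_⟩
  intro Y _ ρ σ D z κ h hκ k l R hkl hR
  have hc := (h.countable l).to_subtype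
  have m1 : ∀ (s : ℝ) (w : Y), Measurable fun y => ENNReal.ofReal (poisson ρ d υ s w y) :=
    fun s w => (measurable_poisson h.measurable_dist w).ennreal_ofReal
  obtain ⟨hint, hI, -⟩ := hA h k R _ hR (hκ k R hR)
  set m : ℝ := (∫ w, κ k R w ∂σ) / (σ R).toReal with hm
  -- The coefficient `m` is of order `1 / σ R`, which is compensated by the factor `σ R` in the
  -- averaged estimate for the indicator of `R`.
  have hmR : ‖m‖ₑ * σ R ≤ A := by
    have hpos : 0 < (σ R).toReal := ENNReal.toReal_pos (h.measure_ne_zero hR) (h.measure_ne_top hR)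
    rw [← ENNReal.ofReal_toReal (h.measure_ne_top hR), Real.enorm_eq_ofReal_abs,
      ← ENNReal.ofReal_mul (abs_nonneg _), hm, abs_div, abs_of_pos hpos,
      div_mul_cancel₀ _ hpos.ne', ← ENNReal.ofReal_coe_nnreal]
    exact ENNReal.ofReal_le_ofReal hI
  have hκm := (hκ k R hR).measurable
  have hRm := h.measurable k R hR
  have step : ∀ Q : D l, ‖∫ y, centered σ (κ k R) R y * centered σ (κ l Q) Q y ∂σ‖ₑ ≤
      A * (∫⁻ y, ENNReal.ofReal (poisson ρ d υ (side l) (z l Q) y) *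
          ‖κ k R (z l Q) - κ k R y‖ₑ ∂σ +
        ‖m‖ₑ * ∫⁻ y, ENNReal.ofReal (poisson ρ d υ (side l) (z l Q) y) *
          ‖R.indicator (1 : Y → ℝ) (z l Q) - R.indicator 1 y‖ₑ ∂σ) := by
    intro Q
    have hQm := h.measurable l Q Q.2
    have hQt := h.measure_ne_top Q.2
    have hκQ := hκ l Q Q.2
    have hiQ := hκQ.integrable h hd hυ Q.2
    have hiφ := integrable_centered hiQ hQm hQt
    obtain ⟨c, hc⟩ := (hκ k R hR).exists_abs_centered_le h hd hυ hR
    have i1 : Integrable (fun y => centered σ (κ k R) R y * centered σ (κ l Q) Q y) σ :=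
      hiφ.bdd_mul (measurable_centered hκm hRm).aestronglyMeasurable
        (Filter.Eventually.of_forall hc)
    -- The finer kernel has integral zero, so the value of the coarser one at the finer centre may
    -- be subtracted.
    have e : ∫ y, centered σ (κ k R) R y * centered σ (κ l Q) Q y ∂σ =
        ∫ y, (centered σ (κ k R) R y - centered σ (κ k R) R (z l Q)) *
          centered σ (κ l Q) Q y ∂σ := by
      simp_rw [sub_mul]
      rw [integral_sub i1 (hiφ.const_mul _), integral_const_mul,
        integral_centered hiQ hQm (h.measure_ne_zero Q.2) hQt, mul_zero, sub_zero]
    rw [e]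
    refine (enorm_integral_le_lintegral_enorm _).trans ?_
    have mκ : Measurable fun y => ‖κ k R (z l Q) - κ k R y‖ₑ := by fun_prop
    have mi : Measurable fun y => ‖R.indicator (1 : Y → ℝ) (z l Q) - R.indicator 1 y‖ₑ :=
      ((measurable_one.indicator hRm).const_sub _).enorm
    rw [← lintegral_const_mul _ (by fun_prop), ← lintegral_add_left (by fun_prop),
      ← lintegral_const_mul _ (by fun_prop)]
    refine lintegral_mono fun y => ?_
    have b1 : ‖centered σ (κ k R) R y - centered σ (κ k R) R (z l Q)‖ₑ ≤
        ‖κ k R (z l Q) - κ k R y‖ₑ +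
          ‖m‖ₑ * ‖R.indicator (1 : Y → ℝ) (z l Q) - R.indicator 1 y‖ₑ := by
      have ind : ∀ w, R.indicator (fun _ => m) w = m * R.indicator (1 : Y → ℝ) w := by
        intro w; by_cases hw : w ∈ R <;> simp [hw]
      have : centered σ (κ k R) R y - centered σ (κ k R) R (z l Q) =
          -(κ k R (z l Q) - κ k R y) +
            m * (R.indicator (1 : Y → ℝ) (z l Q) - R.indicator 1 y) := by
        unfold centered
        rw [← hm, ind, ind]
        ring
      rw [this]
      refine (enorm_add_le _ _).trans ?_
      rw [enorm_neg, enorm_mul]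
    rw [enorm_mul]
    calc _ ≤ (‖κ k R (z l Q) - κ k R y‖ₑ +
          ‖m‖ₑ * ‖R.indicator (1 : Y → ℝ) (z l Q) - R.indicator 1 y‖ₑ) *
          (A * ENNReal.ofReal (poisson ρ d υ (side l) (z l Q) y)) :=
          mul_le_mul' b1 (enorm_le_mul_ofReal ((hA h l Q _ Q.2 hκQ).2.2 y))
      _ = _ := by ring
  calc ∑' Q : D l, σ Q * ‖∫ y, centered σ (κ k R) R y * centered σ (κ l Q) Q y ∂σ‖ₑ
      ≤ ∑' Q : D l, σ Q * (A * (∫⁻ y, ENNReal.ofReal (poisson ρ d υ (side l) (z l Q) y) *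
          ‖κ k R (z l Q) - κ k R y‖ₑ ∂σ +
        ‖m‖ₑ * ∫⁻ y, ENNReal.ofReal (poisson ρ d υ (side l) (z l Q) y) *
          ‖R.indicator (1 : Y → ℝ) (z l Q) - R.indicator 1 y‖ₑ ∂σ)) :=
        ENNReal.tsum_le_tsum fun Q => mul_le_mul_right (step Q) _
    _ = A * (∑' Q : D l, σ Q * ∫⁻ y, ENNReal.ofReal (poisson ρ d υ (side l) (z l Q) y) *
          ‖κ k R (z l Q) - κ k R y‖ₑ ∂σ +
        ‖m‖ₑ * ∑' Q : D l, σ Q * ∫⁻ y, ENNReal.ofReal (poisson ρ d υ (side l) (z l Q) y) *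
          ‖R.indicator (1 : Y → ℝ) (z l Q) - R.indicator 1 y‖ₑ ∂σ) := by
        rw [← ENNReal.tsum_mul_left, ← ENNReal.tsum_add, ← ENNReal.tsum_mul_left]
        exact tsum_congr fun Q => by ring
    _ ≤ A * (C₁ * ENNReal.ofReal ((side l / side k) ^ ε) +
          ‖m‖ₑ * (C₂ * ENNReal.ofReal ((side l / side k) ^ ε) * σ R)) := by
        gcongr
        · exact hC₁ h k l (z k R) _ hkl (hκ k R hR)
        · exact hC₂ h k l R hkl hR
    _ = A * ENNReal.ofReal ((side l / side k) ^ ε) * (C₁ + (‖m‖ₑ * σ R) * C₂) := by ring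
    _ ≤ A * ENNReal.ofReal ((side l / side k) ^ ε) * (C₁ + A * C₂) := by gcongr
    _ = _ := by push_cast; ring

open scoped InnerProductSpace


theorem sq_lintegral_mul_le {α : Type*} [MeasurableSpace α] (μ : Measure α) {f g : α → ℝ≥0∞}
    (hf : AEMeasurable f μ) (hg : AEMeasurable g μ) :
    (∫⁻ a, f a * g a ∂μ) ^ 2 ≤ (∫⁻ a, f a ^ 2 ∂μ) * ∫⁻ a, g a ^ 2 ∂μ := by
  have h := ENNReal.lintegral_mul_le_Lp_mul_Lq μ Real.HolderConjugate.two_two hf hg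
  simp only [Pi.mul_apply, ENNReal.rpow_ofNat] at h
  have e : ∀ x : ℝ≥0∞, (x ^ (1 / 2 : ℝ)) ^ 2 = x := fun x => by
    rw [← ENNReal.rpow_natCast, ← ENNReal.rpow_mul]; norm_num
  calc (∫⁻ a, f a * g a ∂μ) ^ 2
      ≤ ((∫⁻ a, f a ^ 2 ∂μ) ^ (1 / 2 : ℝ) * (∫⁻ a, g a ^ 2 ∂μ) ^ (1 / 2 : ℝ)) ^ 2 :=
        pow_le_pow_left' h 2
    _ = _ := by rw [mul_pow, e, e]

theorem sq_eLpNorm_two {α F : Type*} [MeasurableSpace α] [NormedAddCommGroup F] (μ : Measure α)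
    (f : α → F) : eLpNorm f 2 μ ^ 2 = ∫⁻ a, ‖f a‖ₑ ^ 2 ∂μ := by
  rw [eLpNorm_eq_lintegral_rpow_enorm_toReal (by norm_num) (by norm_num)]
  rw [← ENNReal.rpow_natCast, ← ENNReal.rpow_mul]
  norm_num

theorem rpow_side_div_side {k l : ℤ} (h : k ≤ l) (τ : ℝ) :
    (side l / side k) ^ τ = ((2 : ℝ) ^ (-τ)) ^ (k - l).natAbs := by
  have e : side l / side k = ((2 : ℝ)⁻¹) ^ (k - l).natAbs := by
    unfold side
    rw [← zpow_sub₀ (by norm_num), inv_pow, ← zpow_natCast, ← zpow_neg]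
    congr 1
    omega
  rw [e, ← Real.rpow_pow_comm (by norm_num), Real.inv_rpow (by norm_num), Real.rpow_neg
    (by norm_num)]

theorem exists_tsum_natAbs_le {t : ℝ} (h0 : 0 ≤ t) (h1 : t < 1) :
    ∃ G : ℝ≥0, ∀ j : ℤ, ∑' k : ℤ, ENNReal.ofReal (t ^ (j - k).natAbs) ≤ G := by
  have hs : Summable fun i : ℤ => t ^ i.natAbs := by
    apply Summable.of_nat_of_neg <;> simpa using summable_geometric_of_lt_one h0 h1
  refine ⟨Real.toNNReal (∑' i : ℤ, t ^ i.natAbs), fun j => ?_⟩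
  have e := (Equiv.subLeft j).tsum_eq (fun i => ENNReal.ofReal (t ^ i.natAbs))
  simp only [Equiv.subLeft_apply] at e
  rw [e, ← ENNReal.ofReal, ENNReal.ofReal_tsum_of_nonneg (fun i => by positivity) hs]

/-- Centered adapted kernels satisfy a Bessel inequality. -/
theorem IsAdapted.tsum_measure_mul_sq_le (d υ ε η : ℝ) (Λ B : ℝ≥0) (hd : 0 ≤ d)
    (hε : 0 < ε) (hευ : 2 * ε ≤ υ) (hεη : 2 * ε ≤ η) (hB : 1 ≤ B) :
    ∃ C : ℝ≥0, ∀ {Y : Type u} [MeasurableSpace Y] {ρ : Y → Y → ℝ} {σ : Measure Y}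
      {D : ℤ → Set (Set Y)} {z : ℤ → Set Y → Y} {κ : ℤ → Set Y → Y → ℝ},
      DyadicSpace ρ σ D z d η Λ →
      (∀ k, ∀ Q ∈ D k, IsAdapted ρ d υ ε B (side k) (z k Q) (κ k Q)) →
      ∀ g : Y → ℂ, MemLp g 2 σ → ∑' p : cubes D, σ p.1.2 *
        ‖∫ y, (centered σ (κ p.1.1 p.1.2) p.1.2 y : ℂ) * g y ∂σ‖ₑ ^ 2 ≤
          C * ∫⁻ y, ‖g y‖ₑ ^ 2 ∂σ := by
  have hυ : 0 < υ := by linarith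
  obtain ⟨C₁, hC₁⟩ := IsAdapted.tsum_lintegral_centered_mul_le.{u} d υ ε η Λ B hd hυ
  obtain ⟨C₂, hC₂⟩ := IsAdapted.tsum_inner_centered_le.{u} d υ ε η Λ B hd hε hευ hεη hB
  -- Half the gain pays for the Schur weight `(side p / side q)^τ`. Towards finer cubes the weight
  -- grows, and the gain `ε` leaves decay of order `τ`; towards coarser cubes there is no gain, and
  -- the weight itself decays.
  set τ : ℝ := ε / 2 with hτ
  set t : ℝ := (2 : ℝ) ^ (-τ) with ht
  have ht0 : 0 < t := by positivity
  have ht1 : t < 1 := Real.rpow_lt_one_of_one_lt_of_neg (by norm_num) (by linarith)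
  obtain ⟨G, hG⟩ := exists_tsum_natAbs_le ht0.le ht1
  refine ⟨(C₁ + C₂) * G, ?_⟩
  intro Y _ ρ σ D z κ h hκ g hg
  have hmem : ∀ p : cubes D, MemLp (centered σ (κ p.1.1 p.1.2) p.1.2) 2 σ := fun p =>
    (hκ _ _ p.2).memLp_centered h hd hυ p.2
  set w : cubes D → cubes D → ℝ := fun p q => (side p.1.1 / side q.1.1) ^ τ with hw
  have hw0 : ∀ p q, 0 < w p q := fun p q => by
    have := side_pos p.1.1
    have := side_pos q.1.1
    positivity
  have schur : ∀ p : cubes D, ∑' q : cubes D, ENNReal.ofReal (w p q) * (σ q.1.2 *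
      ‖∫ y, centered σ (κ p.1.1 p.1.2) p.1.2 y * centered σ (κ q.1.1 q.1.2) q.1.2 y ∂σ‖ₑ) ≤
      ((C₁ + C₂) * G : ℝ≥0) := by
    intro p
    rw [tsum_cubes D fun k R => ENNReal.ofReal ((side p.1.1 / side k) ^ τ) * (σ R *
      ‖∫ y, centered σ (κ p.1.1 p.1.2) p.1.2 y * centered σ (κ k R) R y ∂σ‖ₑ)]
    calc _ ≤ ∑' k : ℤ, (C₁ + C₂) * ENNReal.ofReal (t ^ (p.1.1 - k).natAbs) := by
          refine ENNReal.tsum_le_tsum fun k => ?_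
          rw [ENNReal.tsum_mul_left]
          have hpos := side_pos p.1.1
          have hkpos := side_pos k
          rcases le_total k p.1.1 with hk | hk
          · rw [rpow_side_div_side hk, ← ht, mul_comm, ← Int.natAbs_neg, neg_sub]
            gcongr
            exact (hC₁ h hκ p.1.1 k p.1.2 p.2).trans (by exact_mod_cast le_add_right le_rfl)
          · calc _ ≤ ENNReal.ofReal ((side p.1.1 / side k) ^ τ) *
                  (C₂ * ENNReal.ofReal ((side k / side p.1.1) ^ ε)) := by
                  gcongr
                  exact hC₂ h hκ p.1.1 k p.1.2 hk p.2
              _ = C₂ * ENNReal.ofReal (t ^ (p.1.1 - k).natAbs) := by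
                  rw [ht, ← rpow_side_div_side hk, mul_left_comm,
                    ← ENNReal.ofReal_mul (by positivity)]
                  congr 2
                  rw [show ε = τ + τ by rw [hτ]; ring, Real.rpow_add (by positivity), ← mul_assoc,
                    ← Real.mul_rpow (by positivity) (by positivity)]
                  rw [div_mul_div_cancel₀ hkpos.ne', div_self hpos.ne', Real.one_rpow, one_mul]
              _ ≤ _ := by
                  gcongr
                  exact le_add_left le_rfl
      _ ≤ (C₁ + C₂) * G := by
          rw [ENNReal.tsum_mul_left]
          gcongr
          exact hG _
      _ = _ := by push_cast; ring
  let v : cubes D → Lp ℂ 2 σ := fun p => (hmem p).ofReal.toLp _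
  have hv : ∀ p, v p =ᵐ[σ] fun y => (centered σ (κ p.1.1 p.1.2) p.1.2 y : ℂ) := fun p =>
    MemLp.coeFn_toLp _
  have hinner : ∀ p q, ⟪v p, v q⟫_ℂ = ((∫ y, centered σ (κ p.1.1 p.1.2) p.1.2 y *
      centered σ (κ q.1.1 q.1.2) q.1.2 y ∂σ : ℝ) : ℂ) := by
    intro p q
    rw [L2.inner_def, ← integral_complex_ofReal]
    refine integral_congr_ae ?_
    filter_upwards [hv p, hv q] with y h1 h2
    rw [h1, h2, RCLike.inner_apply', Complex.conj_ofReal]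
    push_cast
    rfl
  have hinner' : ∀ p, ⟪v p, hg.toLp g⟫_ℂ =
      ∫ y, (centered σ (κ p.1.1 p.1.2) p.1.2 y : ℂ) * g y ∂σ := by
    intro p
    rw [L2.inner_def]
    refine integral_congr_ae ?_
    filter_upwards [hv p, hg.coeFn_toLp] with y h1 h2
    rw [h1, h2, RCLike.inner_apply', Complex.conj_ofReal]
  rw [ENNReal.tsum_eq_iSup_sum]
  refine iSup_le fun S => ?_
  have key := sum_mul_sq_norm_inner_le S v (fun p => (σ p.1.2).toReal) w ((C₁ + C₂) * G : ℝ≥0)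
    (NNReal.coe_nonneg _) (fun p => ENNReal.toReal_nonneg) hw0 (fun p q => by
      have h1 := side_pos p.1.1
      have h2 := side_pos q.1.1
      change (side p.1.1 / side q.1.1) ^ τ * (side q.1.1 / side p.1.1) ^ τ = 1
      rw [← Real.mul_rpow (by positivity) (by positivity), div_mul_div_cancel₀ h2.ne',
        div_self h1.ne', Real.one_rpow]) (fun p _ => by
      rw [← ENNReal.ofReal_le_coe, ENNReal.ofReal_sum_of_nonneg (fun q _ => mul_nonneg
        (mul_nonneg (hw0 p q).le ENNReal.toReal_nonneg) (norm_nonneg _))]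
      refine (le_of_eq ?_).trans ((ENNReal.sum_le_tsum S).trans (schur p))
      refine Finset.sum_congr rfl fun q _ => ?_
      rw [ENNReal.ofReal_mul (mul_nonneg (hw0 p q).le ENNReal.toReal_nonneg),
        ENNReal.ofReal_mul (hw0 p q).le, ENNReal.ofReal_toReal (h.measure_ne_top q.2), mul_assoc,
        hinner, Complex.norm_real, ofReal_norm]) (hg.toLp g)
  have key2 := ENNReal.ofReal_le_ofReal key
  rw [ENNReal.ofReal_mul (NNReal.coe_nonneg _), ENNReal.ofReal_coe_nnreal,
    ENNReal.ofReal_pow (norm_nonneg _), ofReal_norm, Lp.enorm_toLp, sq_eLpNorm_two,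
    ENNReal.ofReal_sum_of_nonneg (fun q _ => mul_nonneg ENNReal.toReal_nonneg (by positivity))]
    at key2
  refine (le_of_eq (Finset.sum_congr rfl fun p _ => ?_)).trans key2
  rw [ENNReal.ofReal_mul ENNReal.toReal_nonneg, ENNReal.ofReal_toReal (h.measure_ne_top p.2),
    ENNReal.ofReal_pow (norm_nonneg _), ofReal_norm, hinner']

/-! ### Replacing a function by its averages, with a square integrable error. -/

/-- The operator with kernel `θ`. -/
noncomputable def kernelOp {X Y : Type*} [MeasurableSpace Y] (θ : X → Y → ℝ) (σ : Measure Y)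
    (f : Y → ℂ) (x : X) : ℂ := ∫ y, (θ x y : ℂ) * f y ∂σ

/-- The average of `f` over `Q`. -/
noncomputable def mean {Y : Type*} [MeasurableSpace Y] (σ : Measure Y) (Q : Set Y) (f : Y → ℂ) :
    ℂ := (∫ y in Q, f y ∂σ) / ((σ Q).toReal : ℂ)

/-- Disjoint regions `V k Q` associated with the cubes of a dyadic structure, of weight controlled
by that of the cubes, and such that the functions `θ x`, for `x` in the region of a cube, are
adapted to this cube. -/
structure IsWhitneyFamily {X Y : Type*} [MeasurableSpace X] [MeasurableSpace Y]
    (ρ : Y → Y → ℝ) (σ : Measure Y) (D : ℤ → Set (Set Y)) (z : ℤ → Set Y → Y) (μ : Measure X)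
    (ω : X → ℝ≥0∞) (θ : X → Y → ℝ) (V : ℤ → Set Y → Set X) (d υ ε : ℝ) (B : ℝ≥0) : Prop where
  one_le : 1 ≤ B
  measurable_weight : Measurable ω
  measurable : ∀ k, ∀ Q ∈ D k, MeasurableSet (V k Q)
  disjoint : ∀ p ∈ cubes D, ∀ q ∈ cubes D, p ≠ q → Disjoint (V p.1 p.2) (V q.1 q.2)
  adapted : ∀ k, ∀ Q ∈ D k, ∀ x ∈ V k Q,
    IsAdapted ρ d υ ε B (side k) (z k Q) (fun y => side k ^ υ * θ x y)
  weight_le : ∀ k, ∀ Q ∈ D k,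
    ∫⁻ x in V k Q, ω x ∂μ ≤ B * ENNReal.ofReal (side k ^ (2 * υ)) * σ Q

theorem isAdapted_zero {Y : Type*} [MeasurableSpace Y] {ρ : Y → Y → ℝ} {d υ ε : ℝ} {B : ℝ≥0}
    {r : ℝ} {z : Y} (h0 : ∀ x y, 0 ≤ ρ x y) (hr : 0 ≤ r) :
    IsAdapted ρ d υ ε B r z fun _ => 0 := by
  refine ⟨measurable_const, fun y => ?_, fun y y' _ => ?_⟩
  · have := poisson_nonneg (d := d) (ε := υ) h0 hr z y
    simp only [abs_zero]
    positivity
  · have := poisson_nonneg (d := d) (ε := υ) h0 hr z y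
    have := h0 y y'
    simp only [sub_zero, abs_zero]
    positivity

section

variable {Y : Type u} [MeasurableSpace Y] {ρ : Y → Y → ℝ} {σ : Measure Y}
  {D : ℤ → Set (Set Y)} {z : ℤ → Set Y → Y} {d υ ε η : ℝ} {Λ B : ℝ≥0}

theorem IsAdapted.memLp (h : DyadicSpace ρ σ D z d η Λ) (hd : 0 ≤ d) (hυ : 0 < υ)
    {k : ℤ} {Q : Set Y} {κ : Y → ℝ} (hQ : Q ∈ D k)
    (hκ : IsAdapted ρ d υ ε B (side k) (z k Q) κ) : MemLp κ 2 σ := by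
  have h1 := hκ.memLp_centered h hd hυ hQ
  have h2 : MemLp (Q.indicator fun _ => (∫ w, κ w ∂σ) / (σ Q).toReal) 2 σ :=
    memLp_indicator_const 2 (h.measurable k Q hQ) _ (Or.inr (h.measure_ne_top hQ))
  convert h1.add h2 using 1
  ext y
  simp [centered]

theorem MemLp.integrable_ofReal_mul {κ : Y → ℝ} {g : Y → ℂ} (hκ : MemLp κ 2 σ) (hg : MemLp g 2 σ) :
    Integrable (fun y => (κ y : ℂ) * g y) σ :=
  MemLp.integrable_mul (hκ.ofReal (K := ℂ)) hg

/-- The correction term in the centered kernel pairs with `g` to give the integral of `κ` times the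
mean of `g`. For `κ = ℓ(Q)^υ θ(x, ·)` this is, up to scaling, `Θ1(x) · mean_Q g`. -/
theorem IsAdapted.integral_centered_mul (h : DyadicSpace ρ σ D z d η Λ) (hd : 0 ≤ d) (hυ : 0 < υ)
    {k : ℤ} {Q : Set Y} {κ : Y → ℝ} (hQ : Q ∈ D k)
    (hκ : IsAdapted ρ d υ ε B (side k) (z k Q) κ) {g : Y → ℂ} (hg : MemLp g 2 σ) :
    ∫ y, (centered σ κ Q y : ℂ) * g y ∂σ =
      ∫ y, (κ y : ℂ) * g y ∂σ - (∫ y, (κ y : ℂ) ∂σ) * mean σ Q g := by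
  have h2 : MemLp (Q.indicator fun _ => (∫ w, κ w ∂σ) / (σ Q).toReal) 2 σ :=
    memLp_indicator_const 2 (h.measurable k Q hQ) _ (Or.inr (h.measure_ne_top hQ))
  have e : ∀ y, (centered σ κ Q y : ℂ) * g y = (κ y : ℂ) * g y -
      ((Q.indicator (fun _ => (∫ w, κ w ∂σ) / (σ Q).toReal) y : ℝ) : ℂ) * g y := by
    intro y
    unfold centered
    push_cast
    ring
  simp_rw [e]
  rw [integral_sub (MemLp.integrable_ofReal_mul (hκ.memLp h hd hυ hQ) hg)
    (MemLp.integrable_ofReal_mul h2 hg)]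
  congr 1
  have e2 : ∀ y, ((Q.indicator (fun _ => (∫ w, κ w ∂σ) / (σ Q).toReal) y : ℝ) : ℂ) * g y =
      Q.indicator (fun y => (((∫ w, κ w ∂σ) / (σ Q).toReal : ℝ) : ℂ) * g y) y := by
    intro y
    by_cases hy : y ∈ Q <;> simp [hy]
  simp_rw [e2]
  rw [integral_indicator (h.measurable k Q hQ), integral_const_mul, mean, integral_complex_ofReal]
  push_cast
  ring

end

/-- The operator acts like multiplication by its value at `1` on averages, up to an error that is
square integrable. -/
theorem IsWhitneyFamily.exists_error_bound (d υ ε η : ℝ) (Λ B : ℝ≥0) (hd : 0 ≤ d)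
    (hε : 0 < ε) (hευ : 2 * ε ≤ υ) (hεη : 2 * ε ≤ η) :
    ∃ C : ℝ≥0, ∀ {X : Type v} {Y : Type u} [MeasurableSpace X] [MeasurableSpace Y] [Nonempty X]
      {ρ : Y → Y → ℝ} {σ : Measure Y} {D : ℤ → Set (Set Y)} {z : ℤ → Set Y → Y} {μ : Measure X}
      {ω : X → ℝ≥0∞} {θ : X → Y → ℝ} {V : ℤ → Set Y → Set X},
      DyadicSpace ρ σ D z d η Λ → IsWhitneyFamily ρ σ D z μ ω θ V d υ ε B →
      ∀ g : Y → ℂ, MemLp g 2 σ → ∃ e : ℤ → Set Y → ℝ≥0∞,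
        (∀ k, ∀ Q ∈ D k, ∀ x ∈ V k Q,
          ‖kernelOp θ σ g x - kernelOp θ σ 1 x * mean σ Q g‖ₑ ^ 2 ≤ e k Q) ∧
        ∑' p : cubes D, e p.1.1 p.1.2 * ∫⁻ x in V p.1.1 p.1.2, ω x ∂μ ≤
          C * ∫⁻ y, ‖g y‖ₑ ^ 2 ∂σ := by
  have hυ : 0 < υ := by linarith
  by_cases hB : 1 ≤ B
  swap
  · exact ⟨0, fun _ h => absurd h.one_le hB⟩
  obtain ⟨C, hC⟩ := IsAdapted.tsum_measure_mul_sq_le.{u} d υ ε η Λ B hd hε hευ hεη hB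
  refine ⟨2 * B * C, ?_⟩
  intro X Y _ _ _ ρ σ D z μ ω θ V h hV g hg
  set τ : Set Y → X → ℝ≥0∞ := fun Q x =>
    ‖kernelOp θ σ g x - kernelOp θ σ 1 x * mean σ Q g‖ₑ ^ 2 with hτ
  classical
  -- The Bessel inequality admits one kernel per cube, hence one point per region. Its bound does
  -- not depend on the choice of the points, so no measurability of the operator in `x` is involved.
  have choice : ∀ χ : ℤ → Set Y → X, ∑' p : cubes D,
      (if χ p.1.1 p.1.2 ∈ V p.1.1 p.1.2 then
        σ p.1.2 * (ENNReal.ofReal (side p.1.1 ^ (2 * υ)) * τ p.1.2 (χ p.1.1 p.1.2)) else 0) ≤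
        C * ∫⁻ y, ‖g y‖ₑ ^ 2 ∂σ := by
    intro χ
    -- Cubes whose chosen point is not in their region receive the zero kernel, so that the whole
    -- family is adapted.
    set κ : ℤ → Set Y → Y → ℝ := fun k Q =>
      if χ k Q ∈ V k Q then fun y => side k ^ υ * θ (χ k Q) y else fun _ => 0 with hκ
    have hκa : ∀ k, ∀ Q ∈ D k, IsAdapted ρ d υ ε B (side k) (z k Q) (κ k Q) := by
      intro k Q hQ
      by_cases hx : χ k Q ∈ V k Q
      · simp only [hκ, hx, if_true]
        exact hV.adapted k Q hQ _ hx
      · simp only [hκ, hx, if_false]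
        exact isAdapted_zero h.nonneg (side_pos k).le
    refine le_trans (ENNReal.tsum_le_tsum fun p => ?_) (hC h hκa g hg)
    split_ifs with hx
    · refine mul_le_mul_right (le_of_eq ?_) _
      rw [(hκa _ _ p.2).integral_centered_mul h hd hυ p.2 hg]
      simp only [hκ, hx, if_true, hτ, kernelOp, Pi.one_apply, mul_one]
      have hs := side_pos p.1.1
      push_cast
      simp_rw [mul_assoc]
      rw [integral_const_mul, integral_const_mul, mul_assoc, ← mul_sub, enorm_mul, mul_pow]
      congr 1
      rw [← ofReal_norm, Complex.norm_real,
        Real.norm_of_nonneg (by positivity), ← ENNReal.ofReal_pow (by positivity),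
        mul_comm 2 υ, Real.rpow_mul hs.le]
      simp
    · exact zero_le
  have hfin : ∫⁻ y, ‖g y‖ₑ ^ 2 ∂σ < ∞ := by
    rw [← sq_eLpNorm_two]
    exact ENNReal.pow_lt_top hg.2
  -- The supremum over a region need not be attained, but a point within a factor `2` of it exists
  -- once it is finite. Finiteness follows from the estimate for a constant choice of points.
  set e : ℤ → Set Y → ℝ≥0∞ := fun k Q => ⨆ x ∈ V k Q, τ Q x with he
  have hne : ∀ k, ∀ Q ∈ D k, e k Q ≠ ∞ := by
    intro k Q hQ
    have hc0 : σ Q * ENNReal.ofReal (side k ^ (2 * υ)) ≠ 0 := by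
      have := side_pos k
      refine mul_ne_zero (h.measure_ne_zero hQ) ?_
      rw [Ne, ENNReal.ofReal_eq_zero, not_le]
      positivity
    have hct : σ Q * ENNReal.ofReal (side k ^ (2 * υ)) ≠ ∞ :=
      ENNReal.mul_ne_top (h.measure_ne_top hQ) ENNReal.ofReal_ne_top
    have : e k Q ≤ (C * ∫⁻ y, ‖g y‖ₑ ^ 2 ∂σ) / (σ Q * ENNReal.ofReal (side k ^ (2 * υ))) := by
      refine iSup₂_le fun x hx => ?_
      rw [ENNReal.le_div_iff_mul_le (Or.inl hc0) (Or.inl hct)]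
      have h1 := (ENNReal.le_tsum (⟨(k, Q), hQ⟩ : cubes D)).trans (choice fun _ _ => x)
      simp only [hx, if_true] at h1
      refine le_trans (le_of_eq ?_) h1
      ring
    exact (this.trans_lt (ENNReal.div_lt_top
      (ENNReal.mul_ne_top ENNReal.coe_ne_top hfin.ne) hc0)).ne
  have hex : ∀ k Q, ∃ x, Q ∈ D k → (V k Q).Nonempty → x ∈ V k Q ∧ e k Q ≤ 2 * τ Q x := by
    intro k Q
    by_cases hQ : Q ∈ D k ∧ (V k Q).Nonempty
    · obtain ⟨hQ, x₀, hx₀⟩ := hQ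
      by_cases h0 : e k Q = 0
      · exact ⟨x₀, fun _ _ => ⟨hx₀, by rw [h0]; exact zero_le⟩⟩
      · have : e k Q / 2 < e k Q := ENNReal.half_lt_self h0 (hne k Q hQ)
        rw [he] at this
        obtain ⟨x, hx⟩ := lt_iSup_iff.1 this
        obtain ⟨hxV, hx⟩ := lt_iSup_iff.1 hx
        refine ⟨x, fun _ _ => ⟨hxV, ?_⟩⟩
        have := (ENNReal.div_le_iff (by norm_num) (by norm_num)).1 hx.le
        rwa [mul_comm] at this
    · exact ⟨Classical.arbitrary X, fun h1 h2 => absurd ⟨h1, h2⟩ hQ⟩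
  choose χ hχ using hex
  refine ⟨e, fun k Q hQ x hx => le_iSup₂ (f := fun x (_ : x ∈ V k Q) => τ Q x) x hx, ?_⟩
  calc ∑' p : cubes D, e p.1.1 p.1.2 * ∫⁻ x in V p.1.1 p.1.2, ω x ∂μ
      ≤ ∑' p : cubes D, 2 * B * (if χ p.1.1 p.1.2 ∈ V p.1.1 p.1.2 then
        σ p.1.2 * (ENNReal.ofReal (side p.1.1 ^ (2 * υ)) * τ p.1.2 (χ p.1.1 p.1.2)) else 0) := by
        refine ENNReal.tsum_le_tsum fun p => ?_
        by_cases hVp : (V p.1.1 p.1.2).Nonempty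
        · obtain ⟨h1, h2⟩ := hχ p.1.1 p.1.2 p.2 hVp
          rw [if_pos h1]
          calc _ ≤ 2 * τ p.1.2 (χ p.1.1 p.1.2) *
                (B * ENNReal.ofReal (side p.1.1 ^ (2 * υ)) * σ p.1.2) :=
                mul_le_mul' h2 (hV.weight_le _ _ p.2)
            _ = _ := by ring
        · rw [not_nonempty_iff_eq_empty] at hVp
          simp [hVp]
    _ ≤ 2 * B * (C * ∫⁻ y, ‖g y‖ₑ ^ 2 ∂σ) := by
        rw [ENNReal.tsum_mul_left]
        gcongr
        exact choice χ
    _ = _ := by push_cast; ring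

/-! ### Descendants of a cube. -/

/-- The cubes contained in the cube `Q` of generation `k`, of generation at least `k`. -/
def desc {Y : Type*} (D : ℤ → Set (Set Y)) (k : ℤ) (Q : Set Y) : Set (ℤ × Set Y) :=
  {p | p ∈ cubes D ∧ k ≤ p.1 ∧ p.2 ⊆ Q}

/-- The cubes of generation `l` contained in `Q`. -/
def subcubes {Y : Type*} (D : ℤ → Set (Set Y)) (l : ℤ) (Q : Set Y) : Set (Set Y) :=
  {R | R ∈ D l ∧ R ⊆ Q}

namespace DyadicSpace

variable {Y : Type u} [MeasurableSpace Y] {ρ : Y → Y → ℝ} {σ : Measure Y}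
  {D : ℤ → Set (Set Y)} {z : ℤ → Set Y → Y} {d η : ℝ} {Λ : ℝ≥0}

theorem subset_of_mem_of_mem (h : DyadicSpace ρ σ D z d η Λ) {k l : ℤ} (hkl : k ≤ l) {Q R : Set Y}
    (hQ : Q ∈ D k) (hR : R ∈ D l) {x : Y} (hxQ : x ∈ Q) (hxR : x ∈ R) : R ⊆ Q :=
  (h.nested k l hkl Q hQ R hR).resolve_right fun hd => disjoint_left.1 hd hxR hxQ

theorem eq_of_mem_of_mem (h : DyadicSpace ρ σ D z d η Λ) {k : ℤ} {Q R : Set Y}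
    (hQ : Q ∈ D k) (hR : R ∈ D k) {x : Y} (hxQ : x ∈ Q) (hxR : x ∈ R) : Q = R := by
  by_contra hne
  exact disjoint_left.1 (h.disjoint k Q hQ R hR hne) hxQ hxR

/-- Generations cover only almost everywhere, so the ancestor is found through a point of `R` off a
null set, which exists as `R` has positive measure. The nonempty generation `j` is needed because
covering is known only from an inhabited generation on. -/
theorem exists_ancestor (h : DyadicSpace ρ σ D z d η Λ) {k j l : ℤ} (hj : (D j).Nonempty)
    (hjk : j ≤ k) (hkl : k ≤ l) {R : Set Y} (hR : R ∈ D l) : ∃ Q ∈ D k, R ⊆ Q := by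
  have h0 := h.cover j k hjk hj
  have : ¬ R ⊆ (⋃₀ D k)ᶜ := fun hs => h.measure_ne_zero hR (measure_mono_null hs h0)
  obtain ⟨x, hxR, hx⟩ := not_subset.1 this
  rw [notMem_compl_iff] at hx
  obtain ⟨Q, hQ, hxQ⟩ := hx
  exact ⟨Q, hQ, h.subset_of_mem_of_mem hkl hQ hR hxQ hxR⟩

theorem countable_subcubes (h : DyadicSpace ρ σ D z d η Λ) (l : ℤ) (Q : Set Y) :
    Countable (subcubes D l Q) :=
  ((h.countable l).mono fun _ hR => hR.1).to_subtype

theorem disjoint_subcubes (h : DyadicSpace ρ σ D z d η Λ) (l : ℤ) (Q : Set Y) :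
    Pairwise (Function.onFun Disjoint fun R : subcubes D l Q => R.1) := fun R R' hne =>
  h.disjoint l R R.2.1 R' R'.2.1 fun e => hne (Subtype.ext e)

theorem ae_eq_iUnion_subcubes (h : DyadicSpace ρ σ D z d η Λ) {k l : ℤ} (hkl : k ≤ l) {Q : Set Y}
    (hQ : Q ∈ D k) : Q =ᵐ[σ] ⋃ R : subcubes D l Q, R.1 := by
  have hsub : (⋃ R : subcubes D l Q, R.1) ⊆ Q := iUnion_subset fun R => R.2.2
  refine (ae_eq_of_subset_of_measure_ge hsub ?_ ?_ (h.measure_ne_top hQ)).symm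
  · refine (measure_mono fun x hx => ?_).trans
      ((measure_union_le (⋃ R : subcubes D l Q, R.1) (⋃₀ D l)ᶜ).trans
        (by rw [h.cover k l hkl ⟨Q, hQ⟩, add_zero]))
    by_cases hx' : x ∈ ⋃₀ D l
    · obtain ⟨R, hR, hxR⟩ := hx'
      exact Or.inl (mem_iUnion.2 ⟨⟨R, hR, h.subset_of_mem_of_mem hkl hQ hR hx hxR⟩, hxR⟩)
    · exact Or.inr hx'
  · have := h.countable_subcubes l Q
    exact (MeasurableSet.iUnion fun R : subcubes D l Q =>
      h.measurable l R R.2.1).nullMeasurableSet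

theorem setLIntegral_eq_tsum_subcubes (h : DyadicSpace ρ σ D z d η Λ) {k l : ℤ} (hkl : k ≤ l)
    {Q : Set Y} (hQ : Q ∈ D k) (f : Y → ℝ≥0∞) :
    ∫⁻ y in Q, f y ∂σ = ∑' R : subcubes D l Q, ∫⁻ y in R.1, f y ∂σ := by
  have := h.countable_subcubes l Q
  rw [setLIntegral_congr (h.ae_eq_iUnion_subcubes hkl hQ),
    lintegral_iUnion (fun R : subcubes D l Q => h.measurable l R R.2.1) (h.disjoint_subcubes l Q)]

theorem measure_eq_tsum_subcubes (h : DyadicSpace ρ σ D z d η Λ) {k l : ℤ} (hkl : k ≤ l)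
    {Q : Set Y} (hQ : Q ∈ D k) : σ Q = ∑' R : subcubes D l Q, σ R.1 := by
  simpa using h.setLIntegral_eq_tsum_subcubes hkl hQ 1

/-- A descendant is either `(k, Q)` itself or lies below exactly one cube of the next generation.
Even when that cube is again the set `Q`, it is a different pair. This recursion drives the
induction for the embedding theorem. -/
theorem tsum_desc (h : DyadicSpace ρ σ D z d η Λ) {k : ℤ} {Q : Set Y} (hQ : Q ∈ D k)
    (F : ℤ × Set Y → ℝ≥0∞) :
    ∑' p : desc D k Q, F p = F (k, Q) +
      ∑' R : subcubes D (k + 1) Q, ∑' p : desc D (k + 1) R.1, F p := by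
  have e : ∀ p, (desc D k Q).indicator F p = ({(k, Q)} : Set (ℤ × Set Y)).indicator F p +
      ∑' R : subcubes D (k + 1) Q, (desc D (k + 1) R.1).indicator F p := by
    intro p
    have hz : ∀ p ∈ cubes D, z p.1 p.2 ∈ p.2 := fun p hp => h.ctr_mem _ _ hp
    by_cases hp : p ∈ desc D k Q
    · rw [indicator_of_mem hp]
      obtain ⟨hpc, hkp, hpQ⟩ := hp
      rcases hkp.eq_or_lt with hk | hk
      · have hpe : p = (k, Q) := by
          refine Prod.ext hk.symm ?_
          have : p.2 ∈ D k := hk ▸ hpc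
          exact h.eq_of_mem_of_mem this hQ (hz p hpc) (hpQ (hz p hpc))
        rw [indicator_of_mem (show p ∈ ({(k, Q)} : Set (ℤ × Set Y)) from hpe)]
        rw [ENNReal.tsum_eq_zero.2, add_zero]
        intro R
        refine indicator_of_notMem (fun hp' => ?_) _
        have := hp'.2.1
        omega
      · rw [indicator_of_notMem (show p ∉ ({(k, Q)} : Set (ℤ × Set Y)) from ?_), zero_add]
        · obtain ⟨R, hR, hpR⟩ := h.exists_ancestor (j := k) (k := k + 1) ⟨Q, hQ⟩ (by omega)
            (by omega) hpc
          have hRQ : R ⊆ Q := h.subset_of_mem_of_mem (by omega) hQ hR (hpQ (hz p hpc))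
            (hpR (hz p hpc))
          rw [tsum_eq_single (⟨R, hR, hRQ⟩ : subcubes D (k + 1) Q)]
          · rw [indicator_of_mem]
            exact ⟨hpc, by omega, hpR⟩
          · intro R' hne
            refine indicator_of_notMem (fun hp' => hne (Subtype.ext ?_)) _
            exact h.eq_of_mem_of_mem R'.2.1 hR (hp'.2.2 (hz p hpc)) (hpR (hz p hpc))
        · rintro rfl
          exact lt_irrefl _ hk
    · rw [indicator_of_notMem hp, indicator_of_notMem, ENNReal.tsum_eq_zero.2, add_zero]
      · intro R
        refine indicator_of_notMem (fun hp' => hp ⟨hp'.1, ?_, hp'.2.2.trans R.2.2⟩) _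
        have := hp'.2.1
        omega
      · rintro rfl
        exact hp ⟨hQ, le_rfl, subset_rfl⟩
  rw [tsum_subtype, tsum_congr e, ENNReal.tsum_add, ENNReal.tsum_comm, ← tsum_subtype,
    tsum_singleton]
  congr 1
  exact tsum_congr fun R => (tsum_subtype _ _).symm

end DyadicSpace

/-! ### The Carleson embedding theorem, by a Bellman function. -/

section Embedding

theorem ENNReal_two_mul_le {t b : ℝ≥0∞} (ht : t ≠ ∞) (hb : b ≠ ∞) :
    2 * t * b ≤ b ^ 2 + t ^ 2 := by
  lift t to ℝ≥0 using ht
  lift b to ℝ≥0 using hb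
  norm_cast
  rw [← NNReal.coe_le_coe]
  push_cast
  linarith [two_mul_le_add_sq (t : ℝ) b]

/-- Cauchy-Schwarz in the form of the joint convexity of `a ^ 2 / w`: the tangent inequalities `2ta
≤ a ^ 2 / w + t ^ 2 w` are summed with the optimal slope `t = A / W`. -/
theorem sq_tsum_div_tsum_le {ι : Type*} (a w : ι → ℝ≥0∞) (hw0 : ∑' i, w i ≠ 0)
    (hwt : ∑' i, w i ≠ ∞) (hi : ∀ i, w i ≠ 0) (ha : ∑' i, a i ≠ ∞) :
    (∑' i, a i) ^ 2 / ∑' i, w i ≤ ∑' i, a i ^ 2 / w i := by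
  set A := ∑' i, a i
  set W := ∑' i, w i
  have hait : ∀ i, a i ≠ ∞ := fun i => ne_top_of_le_ne_top ha (ENNReal.le_tsum i)
  have hwit : ∀ i, w i ≠ ∞ := fun i => ne_top_of_le_ne_top hwt (ENNReal.le_tsum i)
  set t := A / W with ht
  have htt : t ≠ ∞ := ENNReal.div_ne_top ha hw0
  have hpt : ∀ i, 2 * t * a i ≤ a i ^ 2 / w i + t ^ 2 * w i := by
    intro i
    set b := a i / w i with hb
    have hbt : b ≠ ∞ := ENNReal.div_ne_top (hait i) (hi i)
    have e : a i = b * w i := (ENNReal.div_mul_cancel (hi i) (hwit i)).symm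
    have e2 : a i ^ 2 / w i = b ^ 2 * w i := by
      rw [e, mul_pow, sq (w i), ← mul_assoc, mul_div_assoc, ENNReal.div_self (hi i) (hwit i),
        mul_one]
    rw [e2, e, ← add_mul, ← mul_assoc]
    gcongr
    exact ENNReal_two_mul_le htt hbt
  have hsum : 2 * t * A ≤ ∑' i, a i ^ 2 / w i + t ^ 2 * W := by
    rw [← ENNReal.tsum_mul_left, ← ENNReal.tsum_mul_left, ← ENNReal.tsum_add]
    exact ENNReal.tsum_le_tsum hpt
  have e1 : t * A = A ^ 2 / W := by rw [ht, ← ENNReal.mul_div_right_comm, sq]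
  have e2 : t ^ 2 * W = A ^ 2 / W := by
    rw [sq, mul_assoc, ht, ENNReal.div_mul_cancel hw0 hwt, ← ht, e1]
  rw [mul_assoc, e1, e2, two_mul] at hsum
  exact (ENNReal.add_le_add_iff_right (ENNReal.div_ne_top (ENNReal.pow_ne_top ha) hw0)).1 hsum

/-- The Bellman increment. As a function of the Carleson mass `N ≤ m`, the quantity `4 * S ^ 2 / (m
+ N)` has slope at most `-(S / m) ^ 2`; lowering the mass by `β` therefore pays for the term of the
top cube. -/
theorem mul_sq_div_add_le {S m β N' : ℝ≥0∞} (hS : S ≠ ∞) (hm0 : m ≠ 0) (hm : m ≠ ∞)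
    (h : β + N' ≤ m) :
    β * (S / m) ^ 2 + 4 * (S ^ 2 / (m + (β + N'))) ≤ 4 * (S ^ 2 / (m + N')) := by
  have hβ : β ≠ ∞ := ne_top_of_le_ne_top hm (le_self_add.trans h)
  have hN : N' ≠ ∞ := ne_top_of_le_ne_top hm (le_add_self.trans h)
  lift S to ℝ≥0 using hS
  lift m to ℝ≥0 using hm
  lift β to ℝ≥0 using hβ
  lift N' to ℝ≥0 using hN
  have hm' : m ≠ 0 := by exact_mod_cast hm0
  have h' : β + N' ≤ m := by exact_mod_cast h
  have n1 : m + (β + N') ≠ 0 := by positivity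
  have n2 : m + N' ≠ 0 := by positivity
  rw [← ENNReal.coe_div hm', ← ENNReal.coe_add, ← ENNReal.coe_add, ← ENNReal.coe_add,
    ← ENNReal.coe_pow, ← ENNReal.coe_pow, ← ENNReal.coe_div n1, ← ENNReal.coe_div n2]
  norm_cast
  rw [← NNReal.coe_le_coe]
  rw [← NNReal.coe_le_coe] at h'
  push_cast at h' ⊢
  have p1 : (0 : ℝ) < m := by positivity
  have b0 : (0 : ℝ) ≤ β := β.2
  have c0 : (0 : ℝ) ≤ N' := N'.2
  have p2 : (0 : ℝ) < m + N' := by positivity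
  have p3 : (0 : ℝ) < m + (β + N') := by positivity
  have key : (β : ℝ) / m ^ 2 ≤ 4 * (1 / (m + N') - 1 / (m + (β + N'))) := by
    rw [div_sub_div _ _ p2.ne' p3.ne', ← mul_div_assoc, div_le_div_iff₀ (by positivity)
      (by positivity)]
    have : ((m : ℝ) + N') * (m + (β + N')) ≤ 4 * m ^ 2 := by nlinarith
    nlinarith [mul_le_mul_of_nonneg_left this b0]
  have := mul_le_mul_of_nonneg_left key (sq_nonneg (S : ℝ))
  have e1 : (β : ℝ) * (S / m) ^ 2 = S ^ 2 * (β / m ^ 2) := by field_simp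
  have e2 : 4 * ((S : ℝ) ^ 2 / (m + N')) = S ^ 2 * (4 * (1 / (m + N'))) := by ring
  have e3 : 4 * ((S : ℝ) ^ 2 / (m + (β + N'))) = S ^ 2 * (4 * (1 / (m + (β + N')))) := by ring
  rw [e1, e2, e3]
  linarith

variable {Y : Type u} [MeasurableSpace Y] {ρ : Y → Y → ℝ} {σ : Measure Y}
  {D : ℤ → Set (Set Y)} {z : ℤ → Set Y → Y} {d η : ℝ} {Λ : ℝ≥0}

theorem sq_setLIntegral_le {f : Y → ℝ≥0∞} (hf : AEMeasurable f σ) (Q : Set Y) :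
    (∫⁻ y in Q, f y ∂σ) ^ 2 ≤ σ Q * ∫⁻ y in Q, f y ^ 2 ∂σ := by
  have := sq_lintegral_mul_le (σ.restrict Q) (f := fun _ => 1) (g := f) aemeasurable_const
    hf.restrict
  simpa using this

/-- The Carleson embedding theorem below one cube, for finitely many generations. -/
theorem DyadicSpace.tsum_desc_mul_sq_le (h : DyadicSpace ρ σ D z d η Λ) (β : ℤ × Set Y → ℝ≥0∞)
    (hβ : ∀ k, ∀ Q ∈ D k, ∑' p : desc D k Q, β p ≤ σ Q) {f : Y → ℝ≥0∞}
    (hf : AEMeasurable f σ) (hf2 : ∫⁻ y, f y ^ 2 ∂σ ≠ ∞) (n : ℕ) :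
    ∀ k l : ℤ, l - k = n → (∀ p : ℤ × Set Y, l ≤ p.1 → β p = 0) → ∀ Q ∈ D k,
      ∑' p : desc D k Q, β p * ((∫⁻ y in p.1.2, f y ∂σ) / σ p.1.2) ^ 2 +
        4 * ((∫⁻ y in Q, f y ∂σ) ^ 2 / (σ Q + ∑' p : desc D k Q, β p)) ≤
          4 * ∫⁻ y in Q, f y ^ 2 ∂σ := by
  -- The second summand on the left is what the induction carries. It absorbs the term of `Q` by
  -- `mul_sq_div_add_le` and is then distributed over the children by convexity. With no generations
  -- left, it is bounded by Cauchy-Schwarz.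
  induction n with
  | zero =>
    intro k l hkl hl Q hQ
    have hz : ∀ p : desc D k Q, β p = 0 := fun p => hl p (by have := p.2.2.1; omega)
    simp only [hz, zero_mul, tsum_zero, zero_add, add_zero]
    gcongr
    refine ENNReal.div_le_of_le_mul ?_
    rw [mul_comm]
    exact sq_setLIntegral_le hf Q
  | succ n ih =>
    intro k l hkl hl Q hQ
    have hS : ∫⁻ y in Q, f y ∂σ ≠ ∞ := by
      intro htop
      have h1 := sq_setLIntegral_le hf Q
      rw [htop] at h1
      have h2 : σ Q * ∫⁻ y in Q, f y ^ 2 ∂σ ≠ ∞ := ENNReal.mul_ne_top (h.measure_ne_top hQ)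
        (ne_top_of_le_ne_top hf2 (setLIntegral_le_lintegral _ _))
      exact h2 (top_le_iff.1 (by simpa using h1))
    have hm0 := h.measure_ne_zero hQ
    have hm := h.measure_ne_top hQ
    have ih' : ∀ R : subcubes D (k + 1) Q, _ := fun R =>
      ih (k + 1) l (by push_cast at hkl; omega) hl R.1 R.2.1
    have hN := hβ k Q hQ
    rw [h.tsum_desc hQ] at hN
    rw [h.tsum_desc hQ fun p => β p * ((∫⁻ y in p.2, f y ∂σ) / σ p.2) ^ 2, h.tsum_desc hQ β]
    have hsplit := h.setLIntegral_eq_tsum_subcubes (show k ≤ k + 1 by omega) hQ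
    have hmsplit := h.measure_eq_tsum_subcubes (show k ≤ k + 1 by omega) hQ
    set N' := ∑' R : subcubes D (k + 1) Q, ∑' p : desc D (k + 1) R.1, β p with hN'
    have hN't : N' ≠ ∞ := ne_top_of_le_ne_top hm (le_add_self.trans hN)
    have step := mul_sq_div_add_le hS hm0 hm hN
    have cs : (∫⁻ y in Q, f y ∂σ) ^ 2 / (σ Q + N') ≤ ∑' R : subcubes D (k + 1) Q,
        (∫⁻ y in R.1, f y ∂σ) ^ 2 / (σ R.1 + ∑' p : desc D (k + 1) R.1, β p) := by
      have hw : σ Q + N' = ∑' R : subcubes D (k + 1) Q,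
          (σ R.1 + ∑' p : desc D (k + 1) R.1, β p) := by
        rw [ENNReal.tsum_add, ← hmsplit]
      rw [hw, hsplit f]
      refine sq_tsum_div_tsum_le _ _ ?_ ?_ ?_ ?_
      · rw [← hw]; simp [hm0]
      · rw [← hw]; exact ENNReal.add_ne_top.2 ⟨hm, hN't⟩
      · intro R; simp [h.measure_ne_zero R.2.1]
      · rwa [← hsplit f]
    calc _ = ∑' R : subcubes D (k + 1) Q, ∑' p : desc D (k + 1) R.1,
            β p * ((∫⁻ y in p.1.2, f y ∂σ) / σ p.1.2) ^ 2 +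
          (β (k, Q) * ((∫⁻ y in Q, f y ∂σ) / σ Q) ^ 2 +
            4 * ((∫⁻ y in Q, f y ∂σ) ^ 2 / (σ Q + (β (k, Q) + N')))) := by ring
      _ ≤ ∑' R : subcubes D (k + 1) Q, ∑' p : desc D (k + 1) R.1,
            β p * ((∫⁻ y in p.1.2, f y ∂σ) / σ p.1.2) ^ 2 +
          4 * ∑' R : subcubes D (k + 1) Q,
            (∫⁻ y in R.1, f y ∂σ) ^ 2 / (σ R.1 + ∑' p : desc D (k + 1) R.1, β p) := by
          gcongr _ + ?_
          exact step.trans (by gcongr)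
      _ ≤ ∑' R : subcubes D (k + 1) Q, 4 * ∫⁻ y in R.1, f y ^ 2 ∂σ := by
          rw [← ENNReal.tsum_mul_left, ← ENNReal.tsum_add]
          exact ENNReal.tsum_le_tsum ih'
      _ = _ := by rw [ENNReal.tsum_mul_left, ← hsplit]

/-- The Carleson embedding theorem. -/
theorem DyadicSpace.tsum_mul_sq_le (h : DyadicSpace ρ σ D z d η Λ) (β : ℤ × Set Y → ℝ≥0∞)
    (hβ : ∀ k, ∀ Q ∈ D k, ∑' p : desc D k Q, β p ≤ σ Q) {f : Y → ℝ≥0∞}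
    (hf : AEMeasurable f σ) (hf2 : ∫⁻ y, f y ^ 2 ∂σ ≠ ∞) :
    ∑' p : cubes D, β p * ((∫⁻ y in p.1.2, f y ∂σ) / σ p.1.2) ^ 2 ≤ 4 * ∫⁻ y, f y ^ 2 ∂σ := by
  rw [ENNReal.tsum_eq_iSup_sum]
  refine iSup_le fun S => ?_
  rcases S.eq_empty_or_nonempty with rfl | hS
  · simp
  obtain ⟨p₀, hp₀, hmin⟩ := S.exists_min_image (fun p => p.1.1) hS
  obtain ⟨p₁, hp₁, hmax⟩ := S.exists_max_image (fun p => p.1.1) hS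
  set k := p₀.1.1 with hk
  set l := p₁.1.1 + 1 with hl
  have hkl : k ≤ p₁.1.1 := hmin p₁ hp₁
  -- A finite partial sum involves only generations from `k` to `l - 1`, so `β` may be cut off at
  -- `l`, and all its cubes lie below cubes of generation `k`. Thus no largest cube is needed.
  set β' : ℤ × Set Y → ℝ≥0∞ := {p | p.1 < l}.indicator β with hβ'
  have hβle : ∀ p, β' p ≤ β p := fun p => indicator_le_self _ _ _
  set G : ℤ × Set Y → ℝ≥0∞ := fun p => β' p * ((∫⁻ y in p.2, f y ∂σ) / σ p.2) ^ 2 with hG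
  have hc := (h.countable k).to_subtype
  have key : ∀ Q : D k, ∑' p : desc D k Q, G p ≤ 4 * ∫⁻ y in Q.1, f y ^ 2 ∂σ := fun Q =>
    le_self_add.trans (h.tsum_desc_mul_sq_le β' (fun k Q hQ =>
      (ENNReal.tsum_le_tsum fun p : desc D k Q => hβle p).trans (hβ k Q hQ)) hf hf2
      (l - k).toNat k l (by omega)
      (fun p hp => indicator_of_notMem (s := {p : ℤ × Set Y | p.1 < l}) (not_lt.2 hp) β) Q.1 Q.2)
  have anc : ∀ p : cubes D, k ≤ p.1.1 → ∃ Q : D k, p.1 ∈ desc D k Q.1 := by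
    intro p hp
    obtain ⟨Q, hQ, hpQ⟩ := h.exists_ancestor (j := k) ⟨p₀.1.2, p₀.2⟩ le_rfl hp p.2
    exact ⟨⟨Q, hQ⟩, p.2, hp, hpQ⟩
  calc ∑ p ∈ S, β p * ((∫⁻ y in p.1.2, f y ∂σ) / σ p.1.2) ^ 2
      ≤ ∑ p ∈ S, ∑' Q : D k, (desc D k Q.1).indicator G p := by
        refine Finset.sum_le_sum fun p hp => ?_
        obtain ⟨Q, hQ⟩ := anc p (hmin p hp)
        refine le_trans (le_of_eq ?_) (ENNReal.le_tsum Q)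
        have hpl : p.1.1 < l := by have := hmax p hp; omega
        rw [indicator_of_mem hQ, hG, hβ']
        simp only
        rw [indicator_of_mem (show p.1 ∈ {p : ℤ × Set Y | p.1 < l} from hpl)]
    _ ≤ ∑' p : cubes D, ∑' Q : D k, (desc D k Q.1).indicator G p := ENNReal.sum_le_tsum S
    _ ≤ ∑' p : ℤ × Set Y, ∑' Q : D k, (desc D k Q.1).indicator G p :=
        ENNReal.tsum_comp_le_tsum_of_injective Subtype.val_injective
          fun p => ∑' Q : D k, (desc D k Q.1).indicator G p
    _ = ∑' Q : D k, ∑' p : desc D k Q.1, G p := by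
        rw [ENNReal.tsum_comm]
        exact tsum_congr fun Q => (tsum_subtype _ _).symm
    _ ≤ ∑' Q : D k, 4 * ∫⁻ y in Q.1, f y ^ 2 ∂σ := ENNReal.tsum_le_tsum key
    _ = 4 * ∫⁻ y in ⋃ Q : D k, Q.1, f y ^ 2 ∂σ := by
        rw [ENNReal.tsum_mul_left, lintegral_iUnion (fun Q : D k => h.measurable k Q Q.2)]
        exact fun Q Q' hQ => h.disjoint k Q Q.2 Q' Q'.2 fun e => hQ (Subtype.ext e)
    _ ≤ _ := mul_le_mul_right (setLIntegral_le_lintegral _ _) _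

end Embedding

/-! ### Carleson conditions from sparse stopping families. -/

section Carleson

variable {Y : Type u} [MeasurableSpace Y] {ρ : Y → Y → ℝ} {σ : Measure Y}
  {D : ℤ → Set (Set Y)} {z : ℤ → Set Y → Y} {d η : ℝ} {Λ : ℝ≥0}

theorem tsum_subtype_le_add {ι : Type*} (F : ι → ℝ≥0∞) (s t₁ t₂ : Set ι) (h : s ⊆ t₁ ∪ t₂) :
    ∑' i : s, F i ≤ ∑' i : t₁, F i + ∑' i : t₂, F i :=
  (ENNReal.tsum_mono_subtype F h).trans (ENNReal.tsum_union_le F t₁ t₂)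

/-- A Carleson condition that holds below each cube outside of a sparse family of smaller cubes
holds below each cube. -/
theorem tsum_desc_le_of_stopping (β : ℤ × Set Y → ℝ≥0∞) {b C : ℝ≥0∞} (hb0 : b ≠ 0) (hbt : b ≠ ∞)
    (hselect : ∀ k, ∀ Q ∈ D k, ∃ 𝒢 : Set (ℤ × Set Y), 𝒢 ⊆ desc D (k + 1) Q ∧
      ∑' g : 𝒢, σ g.1.2 + b * σ Q ≤ σ Q ∧
      ∑' p : {p | p ∈ desc D k Q ∧ ∀ g ∈ 𝒢, p ∉ desc D g.1 g.2}, β p ≤ C * σ Q)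
    {k : ℤ} {Q : Set Y} (hQ : Q ∈ D k) : ∑' p : desc D k Q, β p ≤ C / b * σ Q := by
  -- Cutting `β` off at generation `l` permits induction on `l - k`, since stopping cubes have
  -- generation at least `k + 1`. The constant closes up because `C + (C / b) * (1 - b) = C / b`,
  -- and it does not depend on `l`.
  have trunc : ∀ l : ℤ, ∀ n : ℕ, ∀ k : ℤ, l - k ≤ n → ∀ Q ∈ D k,
      ∑' p : desc D k Q, {p : ℤ × Set Y | p.1 < l}.indicator β p ≤ C / b * σ Q := by
    intro l n
    induction n with
    | zero =>
      intro k hk Q hQ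
      rw [ENNReal.tsum_eq_zero.2]
      · exact zero_le
      · intro p
        refine indicator_of_notMem (fun hp => ?_) _
        have h1 := p.2.2.1
        have h2 : p.1.1 < l := hp
        push_cast at hk
        omega
    | succ n ih =>
      intro k hk Q hQ
      obtain ⟨𝒢, h𝒢, hpack, hgood⟩ := hselect k Q hQ
      set β' := {p : ℤ × Set Y | p.1 < l}.indicator β with hβ'
      have hle : ∀ p, β' p ≤ β p := fun p => indicator_le_self _ _ _
      calc ∑' p : desc D k Q, β' p
          ≤ ∑' p : {p | p ∈ desc D k Q ∧ ∀ g ∈ 𝒢, p ∉ desc D g.1 g.2}, β' p +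
            ∑' p : (⋃ g : 𝒢, desc D g.1.1 g.1.2), β' p := by
            refine tsum_subtype_le_add _ _ _ _ fun p hp => ?_
            by_cases hex : ∃ g ∈ 𝒢, p ∈ desc D g.1 g.2
            · obtain ⟨g, hg, hpg⟩ := hex
              exact Or.inr (mem_iUnion.2 ⟨⟨g, hg⟩, hpg⟩)
            · push Not at hex
              exact Or.inl ⟨hp, hex⟩
        _ ≤ C * σ Q + ∑' g : 𝒢, C / b * σ g.1.2 := by
            refine add_le_add ((ENNReal.tsum_le_tsum fun p => hle _).trans hgood) ?_
            refine le_trans ?_ (ENNReal.tsum_le_tsum fun g : 𝒢 =>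
              ih g.1.1 (by have := (h𝒢 g.2).2.1; push_cast at hk; omega) g.1.2 (h𝒢 g.2).1)
            exact ENNReal.tsum_iUnion_le_tsum β' fun g : 𝒢 => desc D g.1.1 g.1.2
        _ = C / b * (∑' g : 𝒢, σ g.1.2 + b * σ Q) := by
            rw [ENNReal.tsum_mul_left, mul_add, ← mul_assoc, ENNReal.div_mul_cancel hb0 hbt,
              add_comm]
        _ ≤ _ := by gcongr
  rw [ENNReal.tsum_eq_iSup_sum]
  refine iSup_le fun S => ?_
  obtain ⟨l, hl⟩ : ∃ l : ℤ, ∀ p ∈ S, p.1.1 < l := by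
    rcases S.eq_empty_or_nonempty with rfl | hS
    · exact ⟨0, by simp⟩
    obtain ⟨p₁, -, hmax⟩ := S.exists_max_image (fun p => p.1.1) hS
    exact ⟨p₁.1.1 + 1, fun p hp => by have := hmax p hp; omega⟩
  refine le_trans (Finset.sum_le_sum fun p hp => le_of_eq ?_)
    ((ENNReal.sum_le_tsum S).trans (trunc l (l - k).toNat k (by omega) Q hQ))
  rw [indicator_of_mem (show p.1 ∈ {p : ℤ × Set Y | p.1 < l} from hl p hp)]

end Carleson

/-! ### The stopping time construction. -/

section Stopping

variable {Y : Type u} [MeasurableSpace Y] {ρ : Y → Y → ℝ} {σ : Measure Y}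
  {D : ℤ → Set (Set Y)} {z : ℤ → Set Y → Y} {d η : ℝ} {Λ : ℝ≥0}

theorem sq_enorm_setIntegral_le {b : Y → ℂ} (hb : AEStronglyMeasurable b σ) (F : Set Y) :
    ‖∫ y in F, b y ∂σ‖ₑ ^ 2 ≤ σ F * ∫⁻ y, ‖b y‖ₑ ^ 2 ∂σ :=
  calc ‖∫ y in F, b y ∂σ‖ₑ ^ 2 ≤ (∫⁻ y in F, ‖b y‖ₑ ∂σ) ^ 2 :=
        pow_le_pow_left' (enorm_integral_le_lintegral_enorm _) 2
    _ ≤ σ F * ∫⁻ y in F, ‖b y‖ₑ ^ 2 ∂σ := sq_setLIntegral_le hb.enorm F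
    _ ≤ _ := mul_le_mul_right (setLIntegral_le_lintegral _ _) _

/-- If `b` has a large average over `Q` but small averages over disjoint subsets of `Q`, then these
subsets leave out a substantial part of `Q`. -/
theorem le_measure_diff_of_average {b : Y → ℂ} {Q : Set Y} {C₀ : ℝ} {M : ℝ≥0∞}
    (hQ : MeasurableSet Q) (hQt : σ Q ≠ ∞) (hC₀ : 0 < C₀)
    (hbm : AEStronglyMeasurable b σ) (hb2 : ∫⁻ y, ‖b y‖ₑ ^ 2 ∂σ ≤ M) (hM : M ≠ ∞)
    (hlarge : 1 / C₀ * (σ Q).toReal ≤ ‖∫ y in Q, b y ∂σ‖) {ι : Type*} [Countable ι] (s : ι → Set Y)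
    (hs : ∀ i, MeasurableSet (s i)) (hd : Pairwise (Function.onFun Disjoint s))
    (hsQ : ∀ i, s i ⊆ Q)
    (hsmall : ∀ i, ‖∫ y in s i, b y ∂σ‖ ≤ 1 / (2 * C₀) * (σ (s i)).toReal) :
    (1 / (2 * C₀) * (σ Q).toReal) ^ 2 ≤ (σ (Q \ ⋃ i, s i)).toReal * M.toReal := by
  set U := ⋃ i, s i with hU
  have hUm : MeasurableSet U := MeasurableSet.iUnion hs
  have hUQ : U ⊆ Q := iUnion_subset hsQ
  have hbL : MemLp b 2 σ := ⟨hbm, by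
    have := sq_eLpNorm_two σ b
    by_contra htop
    rw [not_lt, top_le_iff] at htop
    rw [htop] at this
    have h2 : ∫⁻ y, ‖b y‖ₑ ^ 2 ∂σ ≠ ∞ := ne_top_of_le_ne_top hM hb2
    exact h2 (by rw [← this]; simp)⟩
  have hbi : IntegrableOn b Q σ := by
    have : IsFiniteMeasure (σ.restrict Q) := ⟨by simpa using hQt.lt_top⟩
    exact (hbL.restrict Q).integrable (by norm_num)
  have h1 : ∫ y in Q, b y ∂σ = ∫ y in U, b y ∂σ + ∫ y in Q \ U, b y ∂σ := by
    rw [← setIntegral_union disjoint_sdiff_right (hQ.diff hUm) (hbi.mono_set hUQ)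
      (hbi.mono_set sdiff_subset), union_sdiff_cancel hUQ]
  have h2 : ‖∫ y in U, b y ∂σ‖ ≤ 1 / (2 * C₀) * (σ Q).toReal := by
    have hc : 0 ≤ 1 / (2 * C₀) := by positivity
    have : ‖∫ y in U, b y ∂σ‖ₑ ≤ ENNReal.ofReal (1 / (2 * C₀)) * σ Q := by
      rw [hU, integral_iUnion hs hd (hbi.mono_set hUQ)]
      refine enorm_tsum_le_tsum_enorm.trans ?_
      calc ∑' i, ‖∫ y in s i, b y ∂σ‖ₑ ≤ ∑' i, ENNReal.ofReal (1 / (2 * C₀)) * σ (s i) := by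
            refine ENNReal.tsum_le_tsum fun i => ?_
            rw [← ofReal_norm, ← ENNReal.ofReal_toReal
              (ne_top_of_le_ne_top hQt (measure_mono (hsQ i))), ← ENNReal.ofReal_mul hc]
            exact ENNReal.ofReal_le_ofReal (hsmall i)
        _ = ENNReal.ofReal (1 / (2 * C₀)) * σ U := by
            rw [ENNReal.tsum_mul_left, ← measure_iUnion hd hs]
        _ ≤ _ := by gcongr
    rw [← ENNReal.ofReal_toReal hQt, ← ENNReal.ofReal_mul hc, ← ofReal_norm] at this
    exact (ENNReal.ofReal_le_ofReal_iff (by positivity)).1 this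
  have h3 : 1 / (2 * C₀) * (σ Q).toReal ≤ ‖∫ y in Q \ U, b y ∂σ‖ := by
    have h4 := norm_add_le (∫ y in U, b y ∂σ) (∫ y in Q \ U, b y ∂σ)
    rw [← h1] at h4
    have e : 1 / C₀ * (σ Q).toReal = 2 * (1 / (2 * C₀) * (σ Q).toReal) := by
      field_simp
    rw [e] at hlarge
    linarith
  have h5 : ‖∫ y in Q \ U, b y ∂σ‖ ^ 2 ≤ (σ (Q \ U)).toReal * M.toReal := by
    have h6 := (sq_enorm_setIntegral_le hbm (Q \ U)).trans (mul_le_mul_right hb2 _)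
    have hFt : σ (Q \ U) ≠ ∞ := ne_top_of_le_ne_top hQt (measure_mono sdiff_subset)
    have := ENNReal.toReal_mono (ENNReal.mul_ne_top hFt hM) h6
    simpa [ENNReal.toReal_mul, ENNReal.toReal_pow] using this
  exact (pow_le_pow_left₀ (by positivity) h3 2).trans h5

theorem norm_mean {Q : Set Y} (b : Y → ℂ) :
    ‖mean σ Q b‖ = ‖∫ y in Q, b y ∂σ‖ / (σ Q).toReal := by
  rw [mean, norm_div, Complex.norm_real, Real.norm_of_nonneg ENNReal.toReal_nonneg]

/-- The stopping time construction for an accretive function. -/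
theorem DyadicSpace.exists_stopping (d η : ℝ) (Λ : ℝ≥0) (hd : 0 ≤ d) (C₀ c₀ : ℝ) (hC₀ : 1 ≤ C₀)
    (hc₀ : 0 < c₀) :
    ∃ a : ℝ, 0 < a ∧ ∀ {Y : Type u} [MeasurableSpace Y] {ρ : Y → Y → ℝ} {σ : Measure Y}
      {D : ℤ → Set (Set Y)} {z : ℤ → Set Y → Y}, DyadicSpace ρ σ D z d η Λ →
      ∀ (k : ℤ) (Q : Set Y) (b : Y → ℂ), Q ∈ D k → AEStronglyMeasurable b σ →
      ∫⁻ y, ‖b y‖ₑ ^ 2 ∂σ ≤ ENNReal.ofReal C₀ * σ Q →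
      (∃ k' : ℤ, ∃ Q' ∈ D k', Q' ⊆ Q ∧ c₀ * side k ≤ side k' ∧ k ≤ k' ∧
          1 / C₀ * (σ Q').toReal ≤ ‖∫ y in Q', b y ∂σ‖) →
      ∃ 𝒢 : Set (ℤ × Set Y), 𝒢 ⊆ desc D (k + 1) Q ∧
        ∑' g : 𝒢, σ g.1.2 + ENNReal.ofReal a * σ Q ≤ σ Q ∧
        ∀ p ∈ desc D k Q, (∀ g ∈ 𝒢, p ∉ desc D g.1 g.2) →
          c₀ * side k ≤ side p.1 ∨ 1 / (2 * C₀) ≤ ‖mean σ p.2 b‖ := by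
  set Λ₂ : ℝ := Λ * (2 * Λ) ^ d with hΛ₂
  by_cases hΛ1 : 1 ≤ Λ
  swap
  · exact ⟨1, one_pos, fun h => absurd h.one_le hΛ1⟩
  have hΛpos : (0 : ℝ) < Λ := by exact_mod_cast one_pos.trans_le hΛ1
  have hΛ₂pos : 0 < Λ₂ := by positivity
  set c : ℝ := c₀ ^ d / (Λ * Λ₂) with hc
  have hcpos : 0 < c := by positivity
  have hC₀pos : 0 < C₀ := by linarith
  -- With `c` a lower bound for `σ Q' / σ Q`, this is the value resulting from `(c σ(Q) / (2 C₀))² ≤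
  -- σ(F) · C₀ σ(Q)`, where `F` is the part of `Q'` outside the stopping cubes.
  refine ⟨c ^ 2 / (4 * C₀ ^ 3), by positivity, ?_⟩
  intro Y _ ρ σ D z h k Q b hQ hbm hb2 ⟨k', Q', hQ', hQ'Q, hside, hkk', hlarge⟩
  have hz : ∀ p ∈ cubes D, z p.1 p.2 ∈ p.2 := fun p hp => h.ctr_mem _ _ hp
  have hQt := h.measure_ne_top hQ
  have hQ't := h.measure_ne_top hQ'
  have hqpos : 0 < (σ Q).toReal := ENNReal.toReal_pos (h.measure_ne_zero hQ) hQt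
  have hpos : ∀ p ∈ cubes D, 0 < (σ p.2).toReal := fun p hp =>
    ENNReal.toReal_pos (h.measure_ne_zero hp) (h.measure_ne_top hp)
  -- the cube inside is not much smaller
  have hcomp : c * (σ Q).toReal ≤ (σ Q').toReal := by
    have hs := side_pos k
    have hs' := side_pos k'
    have l1 : side k' ^ d ≤ Λ * (σ Q').toReal := by
      have := h.le_measure k' Q' hQ'
      rw [ENNReal.ofReal_le_iff_le_toReal
        (ENNReal.mul_ne_top ENNReal.coe_ne_top hQ't), ENNReal.toReal_mul] at this
      simpa using this
    have l2 : (σ Q).toReal ≤ Λ₂ * side k ^ d := by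
      have := ENNReal.toReal_mono (ENNReal.mul_ne_top ENNReal.coe_ne_top ENNReal.ofReal_ne_top)
        (h.measure_le hQ)
      rw [ENNReal.toReal_mul, ENNReal.toReal_ofReal (by positivity), ENNReal.coe_toReal] at this
      push_cast at this
      rwa [Real.coe_toNNReal _ (by positivity)] at this
    have l3 : c₀ ^ d * side k ^ d ≤ side k' ^ d := by
      rw [← Real.mul_rpow hc₀.le hs.le]
      exact Real.rpow_le_rpow (by positivity) hside hd
    calc c * (σ Q).toReal ≤ c * (Λ₂ * side k ^ d) := by gcongr
      _ = (c₀ ^ d * side k ^ d) / Λ := by rw [hc]; field_simp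
      _ ≤ (Λ * (σ Q').toReal) / Λ := by exact div_le_div_of_nonneg_right (l3.trans l1) hΛpos.le
      _ = _ := by field_simp
  -- The stopping family consists of the other cubes in `Q` of the generation of `Q'`, on which no
  -- lower bound for averages of `b` is given, and of the maximal cubes below `Q'` with a small
  -- average. Maximality is by generation, since one set may be several cubes.
  set bad : Set (ℤ × Set Y) := {p | p ∈ desc D k' Q' ∧ ‖mean σ p.2 b‖ < 1 / (2 * C₀)} with hbad
  set 𝒢₁ : Set (ℤ × Set Y) := {p | p.1 = k' ∧ p.2 ∈ D k' ∧ p.2 ⊆ Q ∧ p.2 ≠ Q'} with h𝒢₁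
  set 𝒢₂ : Set (ℤ × Set Y) := {p | p ∈ bad ∧ ∀ q ∈ bad, q.1 < p.1 → ¬ p.2 ⊆ q.2} with h𝒢₂
  have hne : ∀ p ∈ bad, k' < p.1 := by
    intro p hp
    refine lt_of_le_of_ne hp.1.2.1 fun he => ?_
    have hpD : p.2 ∈ D k' := by rw [he]; exact hp.1.1
    have hpQ' : p.2 = Q' := h.eq_of_mem_of_mem hpD hQ' (hz p hp.1.1) (hp.1.2.2 (hz p hp.1.1))
    have hq' : 0 < (σ Q').toReal := hpos (k', Q') hQ'
    have h1 := hp.2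
    rw [hpQ', norm_mean, div_lt_iff₀ hq'] at h1
    have h2 : 1 / (2 * C₀) * (σ Q').toReal ≤ 1 / C₀ * (σ Q').toReal := by
      gcongr; linarith
    linarith
  have hcub : 𝒢₁ ∪ 𝒢₂ ⊆ cubes D := by
    rintro p (hp | hp)
    · change p.2 ∈ D p.1
      rw [hp.1]; exact hp.2.1
    · exact hp.1.1.1
  have hcount : Countable (𝒢₁ ∪ 𝒢₂ : Set (ℤ × Set Y)) :=
    ((countable_cubes h.countable).mono hcub).to_subtype
  have hcount₂ : Countable 𝒢₂ :=
    ((countable_cubes h.countable).mono (subset_union_right.trans hcub)).to_subtype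
  have hmeas : ∀ p ∈ cubes D, MeasurableSet p.2 := fun p hp => h.measurable _ _ hp
  have hsub₂ : ∀ p ∈ 𝒢₂, p.2 ⊆ Q' := fun p hp => hp.1.1.2.2
  have hdis₁ : ∀ p ∈ 𝒢₁, Disjoint p.2 Q' := fun p hp =>
    h.disjoint k' p.2 hp.2.1 Q' hQ' hp.2.2.2
  have hdis₂' : ∀ p ∈ 𝒢₂, ∀ q ∈ 𝒢₂, p ≠ q → p.1 ≤ q.1 → Disjoint p.2 q.2 := by
    intro p hp q hq hpq hle
    rcases h.nested p.1 q.1 hle p.2 hp.1.1.1 q.2 hq.1.1.1 with hs | hs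
    · exfalso
      rcases hle.lt_or_eq with hlt | he
      · exact hq.2 p hp.1 hlt hs
      · refine hpq (Prod.ext he ?_)
        have hqD : q.2 ∈ D p.1 := by rw [he]; exact hq.1.1.1
        exact h.eq_of_mem_of_mem hp.1.1.1 hqD (hs (hz q hq.1.1.1)) (hz q hq.1.1.1)
    · exact hs.symm
  have hdis₂ : ∀ p ∈ 𝒢₂, ∀ q ∈ 𝒢₂, p ≠ q → Disjoint p.2 q.2 := by
    intro p hp q hq hpq
    rcases le_total p.1 q.1 with hle | hle
    · exact hdis₂' p hp q hq hpq hle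
    · exact (hdis₂' q hq p hp hpq.symm hle).symm
  have hdis : ∀ p ∈ 𝒢₁ ∪ 𝒢₂, ∀ q ∈ 𝒢₁ ∪ 𝒢₂, p ≠ q → Disjoint p.2 q.2 := by
    rintro p (hp | hp) q (hq | hq) hpq
    · refine h.disjoint k' _ hp.2.1 _ hq.2.1 fun he => hpq (Prod.ext ?_ he)
      rw [hp.1, hq.1]
    · exact (hdis₁ p hp).mono_right (hsub₂ q hq)
    · exact ((hdis₁ q hq).mono_right (hsub₂ p hp)).symm
    · exact hdis₂ p hp q hq hpq
  set F := Q' \ ⋃ g : 𝒢₂, g.1.2 with hF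
  have hF_large : ENNReal.ofReal (c ^ 2 / (4 * C₀ ^ 3)) * σ Q ≤ σ F := by
    have hMt : ENNReal.ofReal C₀ * σ Q ≠ ∞ := ENNReal.mul_ne_top ENNReal.ofReal_ne_top hQt
    have := le_measure_diff_of_average (h.measurable k' Q' hQ') hQ't hC₀pos hbm hb2 hMt hlarge
      (fun g : 𝒢₂ => g.1.2) (fun g => hmeas _ g.2.1.1.1)
      (fun g g' hgg => hdis₂ g g.2 g' g'.2 fun e => hgg (Subtype.ext e))
      (fun g => hsub₂ g g.2) (fun g => by
        have h1 := g.2.1.2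
        rw [norm_mean, div_lt_iff₀ (hpos _ g.2.1.1.1)] at h1
        exact h1.le)
    rw [← hF, ENNReal.toReal_mul, ENNReal.toReal_ofReal hC₀pos.le] at this
    have hFt : σ F ≠ ∞ := ne_top_of_le_ne_top hQ't (measure_mono sdiff_subset)
    rw [← ENNReal.ofReal_toReal hFt, ← ENNReal.ofReal_toReal hQt,
      ← ENNReal.ofReal_mul (by positivity)]
    refine ENNReal.ofReal_le_ofReal ?_
    have h1 : (1 / (2 * C₀) * (c * (σ Q).toReal)) ^ 2 ≤ (σ F).toReal * (C₀ * (σ Q).toReal) := by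
      refine le_trans ?_ this
      gcongr
    have h2 : c ^ 2 / (4 * C₀ ^ 3) * (σ Q).toReal * (C₀ * (σ Q).toReal) =
        (1 / (2 * C₀) * (c * (σ Q).toReal)) ^ 2 := by
      field_simp
      ring
    rw [← h2] at h1
    exact le_of_mul_le_mul_right h1 (by positivity)
  refine ⟨𝒢₁ ∪ 𝒢₂, ?_, ?_, ?_⟩
  · rintro p (hp | hp)
    · refine ⟨hcub (Or.inl hp), ?_, hp.2.2.1⟩
      rw [hp.1]
      have : k ≠ k' := by
        rintro rfl
        have e1 : Q' = Q := h.eq_of_mem_of_mem hQ' hQ (h.ctr_mem _ _ hQ') (hQ'Q (h.ctr_mem _ _ hQ'))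
        have hpc : p ∈ cubes D := hcub (Or.inl hp)
        have e2 : p.2 = Q := h.eq_of_mem_of_mem hp.2.1 hQ (hz p hpc) (hp.2.2.1 (hz p hpc))
        exact hp.2.2.2 (e2.trans e1.symm)
      omega
    · refine ⟨hp.1.1.1, ?_, (hsub₂ p hp).trans hQ'Q⟩
      have := hne p hp.1
      omega
  · have hUm : MeasurableSet (⋃ g : (𝒢₁ ∪ 𝒢₂ : Set (ℤ × Set Y)), g.1.2) :=
      MeasurableSet.iUnion fun g => hmeas _ (hcub g.2)
    rw [← measure_iUnion (f := fun g : (𝒢₁ ∪ 𝒢₂ : Set (ℤ × Set Y)) => g.1.2)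
      (fun g g' hgg => hdis g g.2 g' g'.2 fun e => hgg (Subtype.ext e))
      (fun g => hmeas _ (hcub g.2))]
    refine (add_le_add_right hF_large _).trans ?_
    rw [← measure_union' _ hUm]
    · refine measure_mono (union_subset (iUnion_subset fun g => ?_) (sdiff_subset.trans hQ'Q))
      rcases g.2 with hg | hg
      · exact hg.2.2.1
      · exact (hsub₂ _ hg).trans hQ'Q
    · rw [disjoint_iUnion_left]
      intro g
      rcases g.2 with hg | hg
      · exact (hdis₁ _ hg).mono_right sdiff_subset
      · exact disjoint_sdiff_right.mono_left (subset_iUnion (fun g : 𝒢₂ => g.1.2) ⟨g.1, hg⟩)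
  · intro p hp hnot
    rcases lt_or_ge p.1 k' with hlt | hge
    · exact Or.inl (hside.trans (side_le_side hlt.le))
    · right
      obtain ⟨R, hR, hpR⟩ := h.exists_ancestor ⟨Q, hQ⟩ hkk' hge hp.1
      have hzp := hz p hp.1
      have hRQ : R ⊆ Q := h.subset_of_mem_of_mem hkk' hQ hR (hp.2.2 hzp) (hpR hzp)
      have hRQ' : R = Q' := by
        by_contra hne'
        exact hnot (k', R) (Or.inl ⟨rfl, hR, hRQ, hne'⟩) ⟨hp.1, hge, hpR⟩
      by_contra hlt
      rw [not_le] at hlt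
      have hpbad : p ∈ bad := ⟨⟨hp.1, hge, hRQ' ▸ hpR⟩, hlt⟩
      -- Generations of bad cubes are bounded below by `k'`, so among those containing `p.2` there
      -- is a coarsest one. It belongs to `𝒢₂`, which contradicts the choice of `p`.
      have hex : ∃ n : ℕ, ∃ q ∈ bad, p.2 ⊆ q.2 ∧ q.1 ≤ p.1 ∧ q.1 = k' + n :=
        ⟨(p.1 - k').toNat, p, hpbad, subset_rfl, le_rfl, by omega⟩
      classical
      obtain ⟨q, hq, hpq, hqp, hqn⟩ := Nat.find_spec hex
      refine hnot q (Or.inr ⟨hq, fun q' hq' hlt' hqq' => ?_⟩) ⟨hp.1, hqp, hpq⟩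
      have hk := hne q' hq'
      refine Nat.find_min hex (m := (q'.1 - k').toNat) (by omega)
        ⟨q', hq', hpq.trans hqq', by omega, by omega⟩

end Stopping

/-! ### The local `T(b)` theorem for Whitney families. -/

theorem enorm_sq_le_two_mul (a c : ℂ) : ‖a‖ₑ ^ 2 ≤ 2 * (‖c‖ₑ ^ 2 + ‖a - c‖ₑ ^ 2) := by
  have h : ‖a‖ₑ ≤ ‖c‖ₑ + ‖a - c‖ₑ := by
    calc ‖a‖ₑ = ‖c + (a - c)‖ₑ := by rw [add_sub_cancel]
      _ ≤ _ := enorm_add_le _ _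
  calc ‖a‖ₑ ^ 2 ≤ (‖c‖ₑ + ‖a - c‖ₑ) ^ 2 := pow_le_pow_left' h 2
    _ = ‖c‖ₑ ^ 2 + ‖a - c‖ₑ ^ 2 + 2 * ‖c‖ₑ * ‖a - c‖ₑ := by ring
    _ ≤ ‖c‖ₑ ^ 2 + ‖a - c‖ₑ ^ 2 + (‖a - c‖ₑ ^ 2 + ‖c‖ₑ ^ 2) := by
        gcongr
        exact ENNReal_two_mul_le enorm_ne_top enorm_ne_top
    _ = _ := by ring

/-- The functions `f` and `g` enter without measurability: additivity of the integral only requires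
the error term to be measurable. This spares a study of `Θf` as a function of `x`. -/
theorem setLIntegral_enorm_sq_le {X : Type*} [MeasurableSpace X] {μ : Measure X} {ω : X → ℝ≥0∞}
    (hω : Measurable ω) {V : Set X} (hV : MeasurableSet V) (f g : X → ℂ) {e : ℝ≥0∞}
    (he : ∀ x ∈ V, ‖f x - g x‖ₑ ^ 2 ≤ e) :
    ∫⁻ x in V, ‖f x‖ₑ ^ 2 * ω x ∂μ ≤
      2 * (∫⁻ x in V, ‖g x‖ₑ ^ 2 * ω x ∂μ + e * ∫⁻ x in V, ω x ∂μ) := by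
  rw [← lintegral_const_mul e hω, ← lintegral_add_right _ (hω.const_mul e),
    ← lintegral_const_mul' _ _ (by norm_num)]
  refine setLIntegral_mono' hV fun x hx => ?_
  calc ‖f x‖ₑ ^ 2 * ω x ≤ 2 * (‖g x‖ₑ ^ 2 + ‖f x - g x‖ₑ ^ 2) * ω x := by
        gcongr
        exact enorm_sq_le_two_mul _ _
    _ ≤ 2 * (‖g x‖ₑ ^ 2 + e) * ω x := by gcongr; exact he x hx
    _ = _ := by ring

theorem enorm_mean_le {Y : Type*} [MeasurableSpace Y] {σ : Measure Y} {Q : Set Y} (h0 : σ Q ≠ 0)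
    (ht : σ Q ≠ ∞) (f : Y → ℂ) : ‖mean σ Q f‖ₑ ≤ (∫⁻ y in Q, ‖f y‖ₑ ∂σ) / σ Q := by
  have hpos : 0 < (σ Q).toReal := ENNReal.toReal_pos h0 ht
  rw [← ofReal_norm, norm_mean, ENNReal.ofReal_div_of_pos hpos, ENNReal.ofReal_toReal ht,
    ofReal_norm]
  gcongr
  exact enorm_integral_le_lintegral_enorm _

/-- The cubes of each generation below `Q` fill `Q` up to a null set, so each of the `J` generations
contributes `σ Q`. -/
theorem DyadicSpace.tsum_desc_measure_le {Y : Type u} [MeasurableSpace Y] {ρ : Y → Y → ℝ}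
    {σ : Measure Y} {D : ℤ → Set (Set Y)} {z : ℤ → Set Y → Y} {d η : ℝ} {Λ : ℝ≥0}
    (h : DyadicSpace ρ σ D z d η Λ) {k : ℤ} {Q : Set Y} (hQ : Q ∈ D k) (J : ℕ) :
    ∑' p : {p : ℤ × Set Y | p ∈ desc D k Q ∧ p.1 < k + J}, σ p.1.2 ≤ J * σ Q := by
  have hsub : {p : ℤ × Set Y | p ∈ desc D k Q ∧ p.1 < k + J} ⊆
      ⋃ i : Fin J, (fun R => ((k + i : ℤ), R)) '' subcubes D (k + i) Q := by
    intro p hp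
    have h1 := hp.1.2.1
    have h2 := hp.2
    have e : k + ((p.1 - k).toNat : ℤ) = p.1 := by omega
    refine mem_iUnion.2 ⟨⟨(p.1 - k).toNat, by omega⟩, p.2, ⟨?_, hp.1.2.2⟩, ?_⟩
    · rw [e]; exact hp.1.1
    · exact Prod.ext e rfl
  refine (ENNReal.tsum_mono_subtype (fun p : ℤ × Set Y => σ p.2) hsub).trans
    ((ENNReal.tsum_iUnion_le (fun p : ℤ × Set Y => σ p.2) _).trans ?_)
  calc _ = ∑ i : Fin J, σ Q := by
        refine Finset.sum_congr rfl fun i _ => ?_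
        rw [tsum_image (g := fun R => ((k + i : ℤ), R)) (fun p : ℤ × Set Y => σ p.2)
          (fun R _ R' _ hR => (Prod.ext_iff.1 hR).2)]
        exact (h.measure_eq_tsum_subcubes (by omega) hQ).symm
    _ ≤ _ := by simp

/-- The local `T(b)` theorem for a Whitney family. -/
theorem IsWhitneyFamily.tsum_lintegral_le (d υ ε η : ℝ) (Λ B : ℝ≥0) (hd : 0 ≤ d)
    (hε : 0 < ε) (hευ : 2 * ε ≤ υ) (hεη : 2 * ε ≤ η) (C₀ c₀ : ℝ) (hC₀ : 1 ≤ C₀) (hc₀ : 0 < c₀) :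
    ∃ C : ℝ≥0, ∀ {X : Type v} {Y : Type u} [MeasurableSpace X] [MeasurableSpace Y] [Nonempty X]
      {ρ : Y → Y → ℝ} {σ : Measure Y} {D : ℤ → Set (Set Y)} {z : ℤ → Set Y → Y} {μ : Measure X}
      {ω : X → ℝ≥0∞} {θ : X → Y → ℝ} {V : ℤ → Set Y → Set X},
      DyadicSpace ρ σ D z d η Λ → IsWhitneyFamily ρ σ D z μ ω θ V d υ ε B →
      (∀ k, ∀ Q ∈ D k, ∃ b : Y → ℂ, AEStronglyMeasurable b σ ∧
        ∫⁻ y, ‖b y‖ₑ ^ 2 ∂σ ≤ ENNReal.ofReal C₀ * σ Q ∧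
        (∃ k' : ℤ, ∃ Q' ∈ D k', Q' ⊆ Q ∧ c₀ * side k ≤ side k' ∧ k ≤ k' ∧
          1 / C₀ * (σ Q').toReal ≤ ‖∫ y in Q', b y ∂σ‖) ∧
        ∑' p : desc D k Q, ∫⁻ x in V p.1.1 p.1.2, ‖kernelOp θ σ b x‖ₑ ^ 2 * ω x ∂μ ≤
          ENNReal.ofReal C₀ * σ Q) →
      ∀ f : Y → ℂ, MemLp f 2 σ →
        ∑' p : cubes D, ∫⁻ x in V p.1.1 p.1.2, ‖kernelOp θ σ f x‖ₑ ^ 2 * ω x ∂μ ≤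
          C * ∫⁻ y, ‖f y‖ₑ ^ 2 ∂σ := by
  have hυ : 0 < υ := by linarith
  obtain ⟨A, hA⟩ := IsAdapted.abs_centered_le.{u} d υ ε η Λ B hd hυ
  obtain ⟨Ce, hCe⟩ := IsWhitneyFamily.exists_error_bound.{u, v} d υ ε η Λ B hd hε hευ hεη
  obtain ⟨a, ha, hselect⟩ := DyadicSpace.exists_stopping.{u} d η Λ hd C₀ c₀ hC₀ hc₀
  -- Descendants of side at least `c₀ * side k` belong to the first `J` generations.
  obtain ⟨J, hJ⟩ := exists_pow_lt_of_lt_one hc₀ (show (2 : ℝ)⁻¹ < 1 by norm_num)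
  have hC₀pos : 0 < C₀ := by linarith
  set c : ℝ≥0 := Real.toNNReal C₀ with hc
  have hcc : ENNReal.ofReal C₀ = c := rfl
  -- The first term comes from the first `J` generations, each with the trivial bound `A ^ 2 * B`.
  -- The second comes from the cubes with large mean: `(2 C₀)²` from dividing by the mean, then the
  -- tent hypothesis and the error estimate for `b`. The `1` in `K` keeps it nonzero for the
  -- normalisation of `β`.
  set K₁ : ℝ≥0 := A ^ 2 * B * J + (2 * c) ^ 2 * (2 * (c + Ce * c)) with hK₁
  set K : ℝ≥0 := K₁ / Real.toNNReal a + 1 with hK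
  have hapos : 0 < Real.toNNReal a := Real.toNNReal_pos.2 ha
  refine ⟨2 * (K * 4 + Ce), ?_⟩
  intro X Y _ _ _ ρ σ D z μ ω θ V h hV hb f hf
  have hω := hV.measurable_weight
  set β : ℤ × Set Y → ℝ≥0∞ := fun p =>
    ∫⁻ x in V p.1 p.2, ‖kernelOp θ σ 1 x‖ₑ ^ 2 * ω x ∂μ with hβ
  have hβσ : ∀ p ∈ cubes D, β p ≤ (A ^ 2 * B : ℝ≥0) * σ p.2 := by
    intro p hp
    have hs := side_pos p.1
    have hpt : ∀ x ∈ V p.1 p.2, ‖kernelOp θ σ 1 x‖ₑ ^ 2 ≤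
        (A : ℝ≥0∞) ^ 2 * ENNReal.ofReal (side p.1 ^ (-(2 * υ))) := by
      intro x hx
      have h1 := (hA h p.1 p.2 _ hp (hV.adapted p.1 p.2 hp x hx)).2.1
      have e : kernelOp θ σ 1 x = ((∫ y, θ x y ∂σ : ℝ) : ℂ) := by
        rw [kernelOp, ← integral_complex_ofReal]
        simp
      rw [integral_const_mul, abs_mul, abs_of_pos (by positivity)] at h1
      rw [e, ← ofReal_norm, Complex.norm_real, ← ENNReal.ofReal_pow (norm_nonneg _),
        ← ENNReal.ofReal_coe_nnreal, ← ENNReal.ofReal_pow (by positivity),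
        ← ENNReal.ofReal_mul (by positivity)]
      refine ENNReal.ofReal_le_ofReal ?_
      rw [Real.norm_eq_abs]
      have h2 := pow_le_pow_left₀ (by positivity) h1 2
      have e2 : side p.1 ^ (-(2 * υ)) = ((side p.1 ^ υ) ^ 2)⁻¹ := by
        rw [Real.rpow_neg hs.le, mul_comm, Real.rpow_mul hs.le]
        simp
      rw [e2, ← div_eq_mul_inv, le_div_iff₀ (by positivity)]
      linarith [mul_pow (side p.1 ^ υ) |∫ y, θ x y ∂σ| 2]
    calc β p ≤ ∫⁻ x in V p.1 p.2, (A : ℝ≥0∞) ^ 2 * ENNReal.ofReal (side p.1 ^ (-(2 * υ))) *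
          ω x ∂μ := setLIntegral_mono' (hV.measurable p.1 p.2 hp) fun x hx => by
            gcongr; exact hpt x hx
      _ ≤ (A : ℝ≥0∞) ^ 2 * ENNReal.ofReal (side p.1 ^ (-(2 * υ))) *
            (B * ENNReal.ofReal (side p.1 ^ (2 * υ)) * σ p.2) := by
          rw [lintegral_const_mul _ hω]
          gcongr
          exact hV.weight_le p.1 p.2 hp
      _ = (A : ℝ≥0∞) ^ 2 * B * (ENNReal.ofReal (side p.1 ^ (-(2 * υ))) *
            ENNReal.ofReal (side p.1 ^ (2 * υ))) * σ p.2 := by ring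
      _ = _ := by
          rw [← ENNReal.ofReal_mul (by positivity), ← Real.rpow_add hs]
          simp
  have carleson : ∀ k, ∀ Q ∈ D k, ∑' p : desc D k Q, β p ≤ K * σ Q := by
    intro k Q hQ
    have main := tsum_desc_le_of_stopping (D := D) (σ := σ) β (b := ENNReal.ofReal a) (C := K₁)
      (by simpa using ha) ENNReal.ofReal_ne_top ?_ hQ
    · refine main.trans ?_
      gcongr
      rw [ENNReal.ofReal, ← ENNReal.coe_div hapos.ne']
      exact_mod_cast le_add_right le_rfl
    intro k Q hQ
    obtain ⟨b, hbm, hb2, hbl, hb3⟩ := hb k Q hQ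
    obtain ⟨𝒢, h𝒢, hpack, hgood⟩ := hselect h k Q b hQ hbm hb2 hbl
    refine ⟨𝒢, h𝒢, hpack, ?_⟩
    have hbL : MemLp b 2 σ := ⟨hbm, by
      have h1 : eLpNorm b 2 σ ^ 2 < ∞ := by
        rw [sq_eLpNorm_two]
        exact hb2.trans_lt (ENNReal.mul_lt_top ENNReal.ofReal_lt_top (h.measure_ne_top hQ).lt_top)
      simpa using h1⟩
    obtain ⟨e, he, hesum⟩ := hCe h hV b hbL
    refine (tsum_subtype_le_add β _ {p : ℤ × Set Y | p ∈ desc D k Q ∧ p.1 < k + J}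
      {p : ℤ × Set Y | p ∈ desc D k Q ∧ 1 / (2 * C₀) ≤ ‖mean σ p.2 b‖} ?_).trans ?_
    · rintro p ⟨hp, hpg⟩
      rcases hgood p hp hpg with h1 | h1
      · left
        refine ⟨hp, ?_⟩
        by_contra hlt
        rw [not_lt] at hlt
        have h2 := h1.trans (side_le_side hlt)
        have e : side (k + J) = (2 : ℝ)⁻¹ ^ J * side k := by
          unfold side
          rw [neg_add, zpow_add₀ (by norm_num), zpow_neg _ (J : ℤ), zpow_natCast, inv_pow, mul_comm]
        rw [e] at h2
        exact absurd (le_of_mul_le_mul_right h2 (side_pos k)) (not_le.2 hJ)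
      · exact Or.inr ⟨hp, h1⟩
    have s1 : ∑' p : {p : ℤ × Set Y | p ∈ desc D k Q ∧ p.1 < k + J}, β p ≤
        (A ^ 2 * B : ℝ≥0) * (J * σ Q) := by
      refine (ENNReal.tsum_le_tsum fun p : {p : ℤ × Set Y | p ∈ desc D k Q ∧ p.1 < k + J} =>
        hβσ p.1 p.2.1.1).trans ?_
      rw [ENNReal.tsum_mul_left]
      gcongr
      exact h.tsum_desc_measure_le hQ J
    -- Where the mean of `b` is at least `1 / (2 * C₀)`, `Θ1` is at most `2 * C₀` times `Θ1 · mean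
    -- b`, which differs from `Θb` by the square integrable error.
    have s2 : ∑' p : {p : ℤ × Set Y | p ∈ desc D k Q ∧ 1 / (2 * C₀) ≤ ‖mean σ p.2 b‖}, β p ≤
        (2 * c) ^ 2 * (2 * (c * σ Q + Ce * (c * σ Q))) := by
      calc _ ≤ ∑' p : {p : ℤ × Set Y | p ∈ desc D k Q ∧ 1 / (2 * C₀) ≤ ‖mean σ p.2 b‖},
            (2 * c : ℝ≥0∞) ^ 2 * (2 * (∫⁻ x in V p.1.1 p.1.2, ‖kernelOp θ σ b x‖ₑ ^ 2 * ω x ∂μ +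
              e p.1.1 p.1.2 * ∫⁻ x in V p.1.1 p.1.2, ω x ∂μ)) := by
            refine ENNReal.tsum_le_tsum fun p => ?_
            have hpc := p.2.1.1
            have hm : 1 ≤ 2 * (c : ℝ≥0∞) * ‖mean σ p.1.2 b‖ₑ := by
              rw [← hcc, ← ofReal_norm, ← ENNReal.ofReal_ofNat, ← ENNReal.ofReal_mul (by norm_num),
                ← ENNReal.ofReal_mul (by positivity), ENNReal.one_le_ofReal]
              have := p.2.2
              rwa [div_le_iff₀ (by positivity), mul_comm] at this
            calc β p ≤ ∫⁻ x in V p.1.1 p.1.2, (2 * c : ℝ≥0∞) ^ 2 *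
                  (‖kernelOp θ σ 1 x * mean σ p.1.2 b‖ₑ ^ 2 * ω x) ∂μ := by
                  refine lintegral_mono fun x => ?_
                  rw [enorm_mul, ← mul_assoc, ← mul_pow]
                  gcongr
                  calc ‖kernelOp θ σ 1 x‖ₑ = ‖kernelOp θ σ 1 x‖ₑ * 1 := (mul_one _).symm
                    _ ≤ ‖kernelOp θ σ 1 x‖ₑ * (2 * (c : ℝ≥0∞) * ‖mean σ p.1.2 b‖ₑ) := by gcongr
                    _ = _ := by ring
              _ = (2 * c : ℝ≥0∞) ^ 2 * ∫⁻ x in V p.1.1 p.1.2,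
                  ‖kernelOp θ σ 1 x * mean σ p.1.2 b‖ₑ ^ 2 * ω x ∂μ :=
                  lintegral_const_mul' _ _ (by finiteness)
              _ ≤ _ := by
                  gcongr
                  refine setLIntegral_enorm_sq_le hω (hV.measurable _ _ hpc) _ _ fun x hx => ?_
                  rw [← enorm_neg, neg_sub]
                  exact he _ _ hpc x hx
        _ = (2 * c : ℝ≥0∞) ^ 2 * (2 *
            (∑' p : {p : ℤ × Set Y | p ∈ desc D k Q ∧ 1 / (2 * C₀) ≤ ‖mean σ p.2 b‖},
              ∫⁻ x in V p.1.1 p.1.2, ‖kernelOp θ σ b x‖ₑ ^ 2 * ω x ∂μ +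
            ∑' p : {p : ℤ × Set Y | p ∈ desc D k Q ∧ 1 / (2 * C₀) ≤ ‖mean σ p.2 b‖},
              e p.1.1 p.1.2 * ∫⁻ x in V p.1.1 p.1.2, ω x ∂μ)) := by
            rw [ENNReal.tsum_mul_left, ENNReal.tsum_mul_left, ENNReal.tsum_add]
        _ ≤ _ := by
            gcongr
            · exact (ENNReal.tsum_mono_subtype (fun p : ℤ × Set Y =>
                ∫⁻ x in V p.1 p.2, ‖kernelOp θ σ b x‖ₑ ^ 2 * ω x ∂μ) fun p hp => hp.1).trans hb3
            · refine (ENNReal.tsum_mono_subtype (fun p : ℤ × Set Y =>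
                e p.1 p.2 * ∫⁻ x in V p.1 p.2, ω x ∂μ) fun p hp => hp.1.1).trans (hesum.trans ?_)
              gcongr
              exact hb2
    refine (add_le_add s1 s2).trans (le_of_eq ?_)
    rw [hK₁]
    push_cast
    ring
  have hKpos : (K : ℝ≥0∞) ≠ 0 := by
    rw [hK]; positivity
  obtain ⟨e, he, hesum⟩ := hCe h hV f hf
  have hf2 : ∫⁻ y, ‖f y‖ₑ ^ 2 ∂σ ≠ ∞ := by
    rw [← sq_eLpNorm_two]
    exact (ENNReal.pow_lt_top hf.2).ne
  have emb := h.tsum_mul_sq_le (fun p => β p / K) (fun k Q hQ => by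
    simp_rw [div_eq_mul_inv]
    rw [ENNReal.tsum_mul_right, ← div_eq_mul_inv]
    refine ENNReal.div_le_of_le_mul ?_
    rw [mul_comm]
    exact carleson k Q hQ) hf.1.enorm hf2
  have emb' : ∑' p : cubes D, β p * ((∫⁻ y in p.1.2, ‖f y‖ₑ ∂σ) / σ p.1.2) ^ 2 ≤
      K * (4 * ∫⁻ y, ‖f y‖ₑ ^ 2 ∂σ) := by
    refine le_trans (le_of_eq ?_) (mul_le_mul_right emb (K : ℝ≥0∞))
    rw [← ENNReal.tsum_mul_left]
    refine tsum_congr fun p => ?_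
    rw [← mul_assoc, ENNReal.mul_div_cancel hKpos ENNReal.coe_ne_top]
  calc ∑' p : cubes D, ∫⁻ x in V p.1.1 p.1.2, ‖kernelOp θ σ f x‖ₑ ^ 2 * ω x ∂μ
      ≤ ∑' p : cubes D, 2 * (β p * ((∫⁻ y in p.1.2, ‖f y‖ₑ ∂σ) / σ p.1.2) ^ 2 +
          e p.1.1 p.1.2 * ∫⁻ x in V p.1.1 p.1.2, ω x ∂μ) := by
        refine ENNReal.tsum_le_tsum fun p => ?_
        refine (setLIntegral_enorm_sq_le hω (hV.measurable _ _ p.2) _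
          (fun x => kernelOp θ σ 1 x * mean σ p.1.2 f) (he _ _ p.2)).trans ?_
        gcongr
        have e1 : ∫⁻ x in V p.1.1 p.1.2, ‖kernelOp θ σ 1 x * mean σ p.1.2 f‖ₑ ^ 2 * ω x ∂μ =
            ‖mean σ p.1.2 f‖ₑ ^ 2 * β p := by
          rw [hβ, ← lintegral_const_mul' _ _ (by finiteness)]
          refine lintegral_congr fun x => ?_
          rw [enorm_mul]
          ring
        rw [e1, mul_comm]
        gcongr
        exact enorm_mean_le (h.measure_ne_zero p.2) (h.measure_ne_top p.2) f
    _ = 2 * (∑' p : cubes D, β p * ((∫⁻ y in p.1.2, ‖f y‖ₑ ∂σ) / σ p.1.2) ^ 2 +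
          ∑' p : cubes D, e p.1.1 p.1.2 * ∫⁻ x in V p.1.1 p.1.2, ω x ∂μ) := by
        rw [ENNReal.tsum_mul_left, ENNReal.tsum_add]
    _ ≤ 2 * (K * (4 * ∫⁻ y, ‖f y‖ₑ ^ 2 ∂σ) + Ce * ∫⁻ y, ‖f y‖ₑ ^ 2 ∂σ) := by gcongr
    _ = _ := by push_cast; ring

/-! ### Regular spaces as dyadic spaces. -/

theorem IsADR.measurable_dist {Y : Type*} [MeasurableSpace Y] {ρ : Y → Y → ℝ} {σ : Measure Y}
    {n A : ℝ} (h : IsADR ρ σ n A) (x : Y) : Measurable (ρ x) :=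
  measurable_of_Iio fun r => h.measurable_ball x r

theorem ofReal_le_qDiam {Y : Type*} (ρ : Y → Y → ℝ) (x y : Y) : ENNReal.ofReal (ρ x y) ≤ qDiam ρ :=
  le_iSup₂ (f := fun x y => ENNReal.ofReal (ρ x y)) x y

theorem le_toReal_qDiam {Y : Type*} {ρ : Y → Y → ℝ} (h : qDiam ρ ≠ ∞) (x y : Y) :
    ρ x y ≤ (qDiam ρ).toReal :=
  (ENNReal.ofReal_le_iff_le_toReal h).1 (ofReal_le_qDiam ρ x y)

theorem IsGeomDoubling.exists_cover {X : Type*} {ρ : X → X → ℝ} {N : ℕ} (h : IsGeomDoubling ρ N)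
    (j : ℕ) (x : X) {r : ℝ} (hr : 0 < r) :
    ∃ F : Finset X, F.card ≤ N ^ j ∧ qBall ρ x r ⊆ ⋃ w ∈ F, qBall ρ w (r / 2 ^ j) := by
  classical
  induction j with
  | zero => exact ⟨{x}, by simp, by simp⟩
  | succ j ih =>
    obtain ⟨F, hF, hcov⟩ := ih
    choose G hG hGcov using fun w => h w (r / 2 ^ j) (by positivity)
    refine ⟨F.biUnion G, ?_, fun y hy => ?_⟩
    · calc (F.biUnion G).card ≤ F.card * N := Finset.card_biUnion_le_card_mul _ _ _ fun w _ => hG w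
        _ ≤ N ^ j * N := by gcongr
        _ = _ := (pow_succ _ _).symm
    · obtain ⟨w, hw, hyw⟩ := mem_iUnion₂.1 (hcov hy)
      obtain ⟨v, hv, hyv⟩ := mem_iUnion₂.1 (hGcov w hyw)
      refine mem_iUnion₂.2 ⟨v, Finset.mem_biUnion.2 ⟨w, hw, hv⟩, ?_⟩
      rwa [pow_succ, ← div_div]

/-- In a regular subspace of a geometrically doubling space, the upper bound for the measure of
balls holds for all radii. -/
theorem IsADR.measure_ball_le_all (Cs Cρ n A : ℝ) (N : ℕ) (hCs : 1 ≤ Cs) (hCρ : 1 ≤ Cρ)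
    (hn : 0 ≤ n) :
    ∃ C : ℝ≥0, ∀ {X : Type v} {Y : Type u} [MeasurableSpace Y] {ρ : X → X → ℝ} {σ : Measure Y}
      (φ : Y → X), Function.Injective φ → IsQuasiDist ρ Cs Cρ → IsGeomDoubling ρ N →
      IsADR (fun x y => ρ (φ x) (φ y)) σ n A → ∀ x r, 0 < r →
      σ (qBall (fun x y => ρ (φ x) (φ y)) x r) ≤ C * ENNReal.ofReal (r ^ n) := by
  -- With this `j`, two points of a covering ball of radius `2 * R / 2 ^ j` are at distance less
  -- than `R`, so a covering ball that meets the subspace lies in a ball of radius `R` about one of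
  -- its points. For radii above the diameter `R` such a covering is needed: the open ball of radius
  -- `R` may miss points at distance exactly `R`.
  obtain ⟨j, hj⟩ := pow_unbounded_of_one_lt (2 * Cs * Cρ) (one_lt_two : (1 : ℝ) < 2)
  refine ⟨Real.toNNReal A + N ^ j * Real.toNNReal A, ?_⟩
  intro X Y _ ρ σ φ hφ hρ hdbl hadr x r hr
  set ρ' : Y → Y → ℝ := fun x y => ρ (φ x) (φ y) with hρ'
  by_cases hd : ENNReal.ofReal r ≤ qDiam ρ'
  · refine (hadr.measure_ball_le x r hr hd).trans ?_
    rw [ENNReal.ofReal_mul' (by positivity)]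
    refine mul_le_mul_left ?_ _
    change ((Real.toNNReal A : ℝ≥0) : ℝ≥0∞) ≤ _
    exact ENNReal.coe_le_coe.2 (le_add_right le_rfl)
  · rw [not_le] at hd
    have hDt : qDiam ρ' ≠ ∞ := (hd.trans ENNReal.ofReal_lt_top).ne
    set R := (qDiam ρ').toReal with hR
    have hofR : ENNReal.ofReal R = qDiam ρ' := ENNReal.ofReal_toReal hDt
    have hR0 : 0 < R := by
      obtain ⟨a, b, hab⟩ := hadr.nontrivial
      have h1 := le_toReal_qDiam hDt a b
      refine lt_of_lt_of_le (lt_of_le_of_ne (hρ.nonneg _ _) fun h0 => hab (hφ ?_)) h1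
      exact (hρ.eq_zero_iff _ _).1 h0.symm
    have hRr : R ≤ r := by
      rw [← hofR] at hd
      exact ((ENNReal.ofReal_lt_ofReal_iff hr).1 hd).le
    obtain ⟨F, hF, hcov⟩ := hdbl.exists_cover j (φ x) (show 0 < 2 * R by positivity)
    have hball : ∀ w : X, σ {y | φ y ∈ qBall ρ w (2 * R / 2 ^ j)} ≤
        Real.toNNReal A * ENNReal.ofReal (r ^ n) := by
      intro w
      rcases eq_empty_or_nonempty {y | φ y ∈ qBall ρ w (2 * R / 2 ^ j)} with he | ⟨y₀, hy₀⟩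
      · rw [he, measure_empty]
        exact zero_le
      · refine (measure_mono fun y hy => ?_).trans
          ((hadr.measure_ball_le y₀ R hR0 hofR.le).trans ?_)
        · change ρ (φ y₀) (φ y) < R
          have h1 : ρ w (φ y₀) < 2 * R / 2 ^ j := hy₀
          have h2 : ρ w (φ y) < 2 * R / 2 ^ j := hy
          have h3 := hρ.symm_le w (φ y₀)
          have h4 := hρ.le_max (φ y₀) (φ y) w
          have hs : 0 < 2 * R / 2 ^ j := by positivity
          have h5 : max (ρ (φ y₀) w) (ρ w (φ y)) < Cs * (2 * R / 2 ^ j) := by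
            refine max_lt (h3.trans_lt (by gcongr)) (h2.trans_le ?_)
            nlinarith
          calc ρ (φ y₀) (φ y) ≤ Cρ * max (ρ (φ y₀) w) (ρ w (φ y)) := h4
            _ < Cρ * (Cs * (2 * R / 2 ^ j)) := by gcongr
            _ = 2 * Cs * Cρ / 2 ^ j * R := by ring
            _ ≤ 1 * R := by
                gcongr
                exact (div_le_one (by positivity)).2 hj.le
            _ = R := one_mul R
        · rw [ENNReal.ofReal_mul' (by positivity)]
          gcongr
          exact le_rfl
    calc σ (qBall ρ' x r) ≤ σ (⋃ w ∈ F, {y | φ y ∈ qBall ρ w (2 * R / 2 ^ j)}) := by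
          refine measure_mono fun y _ => ?_
          have h1 : φ y ∈ qBall ρ (φ x) (2 * R) := by
            have := le_toReal_qDiam hDt x y
            change ρ (φ x) (φ y) < 2 * R
            change ρ (φ x) (φ y) ≤ R at this
            linarith
          simpa using hcov h1
      _ ≤ ∑ w ∈ F, σ {y | φ y ∈ qBall ρ w (2 * R / 2 ^ j)} := measure_biUnion_finset_le _ _
      _ ≤ ∑ w ∈ F, Real.toNNReal A * ENNReal.ofReal (r ^ n) :=
          Finset.sum_le_sum fun w _ => hball w
      _ = F.card * (Real.toNNReal A * ENNReal.ofReal (r ^ n)) := by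
          rw [Finset.sum_const, nsmul_eq_mul]
      _ ≤ (N ^ j : ℕ) * (Real.toNNReal A * ENNReal.ofReal (r ^ n)) := by
          gcongr
      _ ≤ _ := by
          push_cast
          rw [add_mul, ← mul_assoc]
          exact le_add_left le_rfl

theorem IsQuasiDist.comap {X Y : Type*} {ρ : X → X → ℝ} {Cs Cρ : ℝ} (h : IsQuasiDist ρ Cs Cρ)
    {φ : Y → X} (hφ : Function.Injective φ) : IsQuasiDist (fun x y => ρ (φ x) (φ y)) Cs Cρ where
  nonneg _ _ := h.nonneg _ _
  eq_zero_iff _ _ := (h.eq_zero_iff _ _).trans hφ.eq_iff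
  symm_le _ _ := h.symm_le _ _
  le_max _ _ _ := h.le_max _ _ _

theorem IsQuasiDist.triangle {X : Type*} {ρ : X → X → ℝ} {Cs Cρ T : ℝ} (h : IsQuasiDist ρ Cs Cρ)
    (hC : 0 ≤ Cρ) (hT : Cρ ≤ T) (x y w : X) : ρ x y ≤ T * (ρ x w + ρ w y) := by
  have h1 := h.nonneg x w
  have h2 := h.nonneg w y
  calc ρ x y ≤ Cρ * max (ρ x w) (ρ w y) := h.le_max x y w
    _ ≤ T * (ρ x w + ρ w y) := by
        gcongr
        · exact hC.trans hT
        · exact max_le (by linarith) (by linarith)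

theorem side_succ (k : ℤ) : side (k + 1) = side k / 2 := by
  unfold side
  rw [neg_add, zpow_add₀ two_ne_zero, zpow_neg_one]
  rfl

theorem IsGeneration.mono {Y : Type*} {ρ : Y → Y → ℝ} {k l : ℤ} (hkl : k ≤ l)
    (h : IsGeneration ρ k) : IsGeneration ρ l :=
  (ENNReal.ofReal_le_ofReal (side_le_side (by omega))).trans_lt h

theorem isGeneration_of_le {Y : Type*} {ρ : Y → Y → ℝ} {k : ℤ}
    (h : ENNReal.ofReal (side k) ≤ qDiam ρ) : IsGeneration ρ k := by
  refine lt_of_lt_of_le ?_ h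
  rw [ENNReal.ofReal_lt_ofReal_iff (side_pos k), side_succ]
  linarith [side_pos k]

/-- The cubes of a regular space make it a `DyadicSpace`. -/
theorem IsDyadic.exists_dyadicSpace (d η Cs Cρ A a₀ a₁ c : ℝ) (CE : ℝ≥0)
    (hCρ : 1 ≤ Cρ) (hA : 1 ≤ A) (ha₀ : 0 < a₀) :
    ∃ Λ : ℝ≥0, ∀ {Y : Type u} [MeasurableSpace Y] {ρ : Y → Y → ℝ} {σ : Measure Y}
      {D : ℤ → Set (Set Y)}, IsQuasiDist ρ Cs Cρ → IsADR ρ σ d A →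
      (∀ x r, 0 < r → σ (qBall ρ x r) ≤ CE * ENNReal.ofReal (r ^ d)) →
      IsDyadic ρ σ D a₀ a₁ η c → ∃ z, DyadicSpace ρ σ D z d η Λ := by
  -- A cube of generation `k` only guarantees that `side k / 2` is below the diameter, and the lower
  -- bound for balls is available only up to the diameter.
  set t : ℝ := min a₀ (1 / 2) with ht
  have ht0 : 0 < t := lt_min ha₀ (by norm_num)
  set Λ : ℝ≥0 := 1 + CE + Cs.toNNReal + Cρ.toNNReal + a₁.toNNReal + c.toNNReal +
    (A * (t ^ d)⁻¹).toNNReal with hΛ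
  have e1 : 1 ≤ Λ := by rw [hΛ]; simp only [add_assoc]; exact le_add_right le_rfl
  have e2 : CE ≤ Λ := by
    rw [hΛ]; simp only [add_assoc]; exact le_add_left (le_add_right le_rfl)
  have e3 : Cs.toNNReal ≤ Λ := by
    rw [hΛ]; simp only [add_assoc]; exact le_add_left (le_add_left (le_add_right le_rfl))
  have e4 : Cρ.toNNReal ≤ Λ := by
    rw [hΛ]; exact le_add_right (le_add_right (le_add_right (le_add_left le_rfl)))
  have e5 : a₁.toNNReal ≤ Λ := by
    rw [hΛ]; exact le_add_right (le_add_right (le_add_left le_rfl))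
  have e6 : c.toNNReal ≤ Λ := by
    rw [hΛ]; exact le_add_right (le_add_left le_rfl)
  have e7 : (A * (t ^ d)⁻¹).toNNReal ≤ Λ := by
    rw [hΛ]; exact le_add_left le_rfl
  have hle : ∀ {a : ℝ}, a.toNNReal ≤ Λ → a ≤ Λ := fun h =>
    (Real.le_coe_toNNReal _).trans (by exact_mod_cast h)
  refine ⟨Λ, ?_⟩
  intro Y _ ρ σ D hρ hadr hball hD
  have hne : Nonempty Y := hadr.nontrivial.to_nonempty
  have hz : ∀ k Q, ∃ x, Q ∈ D k →
      x ∈ Q ∧ qBall ρ x (a₀ * side k) ⊆ Q ∧ Q ⊆ qBall ρ x (a₁ * side k) := by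
    intro k Q
    by_cases hQ : Q ∈ D k
    · obtain ⟨x, hx⟩ := hD.size k Q hQ
      exact ⟨x, fun _ => hx⟩
    · exact ⟨Classical.arbitrary Y, fun h => absurd h hQ⟩
  choose z hz using hz
  refine ⟨z, ?_⟩
  constructor
  · exact e1
  · exact hρ.nonneg
  · intro x y
    exact (hρ.symm_le x y).trans (mul_le_mul_of_nonneg_right (hle e3) (hρ.nonneg _ _))
  · exact fun x y w => hρ.triangle (by linarith) (hle e4) x y w
  · exact hadr.measurable_dist
  · intro x r hr
    refine (hball x r hr).trans (mul_le_mul_left ?_ _)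
    exact_mod_cast e2
  · exact hD.countable
  · exact hD.measurable
  · exact hD.disjoint
  · exact hD.nested
  · exact fun k Q hQ => (hz k Q hQ).1
  · intro k Q hQ y hy
    have h1 : ρ (z k Q) y < a₁ * side k := (hz k Q hQ).2.2 hy
    exact h1.le.trans (mul_le_mul_of_nonneg_right (hle e5) (side_pos k).le)
  · intro k Q hQ
    have hs := side_pos k
    have h1 : ENNReal.ofReal (A⁻¹ * (t * side k) ^ d) ≤ σ Q := by
      refine (hadr.le_measure_ball (z k Q) (t * side k) (by positivity) ?_).trans
        (measure_mono fun y hy => (hz k Q hQ).2.1 ?_)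
      · refine le_trans (ENNReal.ofReal_le_ofReal ?_) (hD.gen k Q hQ).le
        rw [side_succ]
        have : t ≤ 1 / 2 := min_le_right _ _
        nlinarith
      · have h2 : ρ (z k Q) y < t * side k := hy
        exact h2.trans_le (mul_le_mul_of_nonneg_right (min_le_left _ _) hs.le)
    have htd : 0 < t ^ d := Real.rpow_pos_of_pos ht0 d
    calc ENNReal.ofReal (side k ^ d)
        = ENNReal.ofReal (A * (t ^ d)⁻¹) * ENNReal.ofReal (A⁻¹ * (t * side k) ^ d) := by
          rw [← ENNReal.ofReal_mul (by positivity), Real.mul_rpow ht0.le hs.le]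
          congr 1
          have : A ≠ 0 := by positivity
          field_simp
      _ ≤ Λ * σ Q := mul_le_mul' (ENNReal.coe_le_coe.2 e7) h1
  · intro k Q hQ τ hτ
    refine (hD.thin_boundary k Q hQ τ hτ).trans (mul_le_mul_left ?_ _)
    rw [ENNReal.ofReal_mul' (by positivity)]
    exact mul_le_mul_left (ENNReal.coe_le_coe.2 e6) _
  · rintro k l hkl ⟨Q, hQ⟩
    exact hD.cover l ((hD.gen k Q hQ).mono hkl)

/-- Every point is close to a cube of each generation. -/
theorem IsDyadic.exists_dist_lt {Y : Type*} [MeasurableSpace Y] {ρ : Y → Y → ℝ} {σ : Measure Y}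
    {D : ℤ → Set (Set Y)} {d A a₀ a₁ η c : ℝ} (hD : IsDyadic ρ σ D a₀ a₁ η c) (hA : 0 < A)
    (hadr : IsADR ρ σ d A) {k : ℤ} (hk : ENNReal.ofReal (side k) ≤ qDiam ρ) (y : Y) :
    ∃ Q ∈ D k, ∃ w ∈ Q, ρ y w < side k := by
  have hs := side_pos k
  -- Otherwise a ball about `y`, which has positive measure, would miss all the cubes of this
  -- generation.
  by_contra! hcon
  have h1 : qBall ρ y (side k) ⊆ (⋃₀ D k)ᶜ := by
    rintro w hw ⟨Q, hQ, hwQ⟩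
    exact absurd hw (not_lt.2 (hcon Q hQ w hwQ))
  have h2 := (hadr.le_measure_ball y (side k) hs hk).trans (measure_mono h1)
  rw [hD.cover k (isGeneration_of_le hk), nonpos_iff_eq_zero, ENNReal.ofReal_eq_zero] at h2
  have : 0 < A⁻¹ * side k ^ d := by positivity
  linarith

/-! ### Points of Whitney sets and the kernels they define. -/

/-- The point `x` lies at distance comparable to `r` from `E` and from `z ∈ E`. -/
structure IsLocated {X : Type*} (ρ ρ' : X → X → ℝ) (E : Set X) (Γ r : ℝ) (z x : X) : Prop where
  add_le : ∀ y ∈ E, r + ρ z y ≤ Γ * ρ x y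
  dist_le : ρ z x ≤ Γ * r
  le_delta : r ≤ Γ * deltaE ρ' E x
  delta_le : deltaE ρ' E x ≤ Γ * r

theorem isLocated_of_dist_le {X : Type*} {ρ ρ' : X → X → ℝ} {E : Set X} {Cs Cρ L T r : ℝ} {z x : X}
    (hρ : IsQuasiDist ρ Cs Cρ) (hρ' : IsRegularization ρ ρ' E L) (hT : 1 ≤ T) (hCρ : 0 ≤ Cρ)
    (hL : 1 ≤ L) (hCsT : Cs ≤ T) (hCρT : Cρ ≤ T) (hLT : L ≤ T) (hr : 0 ≤ r) (hz : z ∈ E)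
    (hzx : ρ z x ≤ 4 * T ^ 4 * r) (hx : ∀ y ∈ E, r ≤ T * ρ x y) :
    IsLocated ρ ρ' E (6 * T ^ 6) r z x := by
  have hT0 : 0 ≤ T := by linarith
  have h4 : T ^ 4 ≤ T ^ 6 := pow_le_pow_right₀ hT (by norm_num)
  have h2 : T ^ 2 ≤ T ^ 6 := pow_le_pow_right₀ hT (by norm_num)
  have h1 : T ≤ T ^ 6 := by simpa using pow_le_pow_right₀ hT (show 1 ≤ 6 by norm_num)
  have h0' : ∀ y, 0 ≤ ρ' x y := fun y => by
    have h1 := (hρ.nonneg x y).trans (hρ'.mul_le x y)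
    exact nonneg_of_mul_nonneg_right h1 (by linarith)
  have hbdd : BddBelow (range fun y : E => ρ' x y) := ⟨0, by rintro _ ⟨y, rfl⟩; exact h0' y⟩
  constructor
  · intro y hy
    have h3 := hρ.triangle hCρ hCρT z y x
    have h5 := hx y hy
    have h6 := hρ.nonneg x y
    have h7 : ρ z x ≤ 4 * T ^ 4 * (T * ρ x y) := hzx.trans (by gcongr)
    calc r + ρ z y ≤ T * ρ x y + T * (4 * T ^ 4 * (T * ρ x y) + ρ x y) := by
          linarith [mul_le_mul_of_nonneg_left h7 hT0]
      _ = (2 * T + 4 * T ^ 6) * ρ x y := by ring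
      _ ≤ 6 * T ^ 6 * ρ x y := by gcongr; linarith
  · refine hzx.trans ?_
    gcongr
    norm_num
  · have h3 : r ≤ T ^ 2 * deltaE ρ' E x := by
      rcases hT0.eq_or_lt with h0 | hTp
      · linarith
      rw [← div_le_iff₀' (by positivity)]
      have : Nonempty E := ⟨⟨z, hz⟩⟩
      refine le_ciInf fun y => ?_
      rw [div_le_iff₀' (by positivity)]
      calc r ≤ T * ρ x y := hx y y.2
        _ ≤ T * (T * ρ' x y) := by
            gcongr
            exact (hρ'.mul_le x y).trans (mul_le_mul_of_nonneg_right hLT (h0' y))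
        _ = _ := by ring
    have h5 : 0 ≤ deltaE ρ' E x := Real.iInf_nonneg fun y => h0' y
    refine h3.trans (mul_le_mul_of_nonneg_right ?_ h5)
    linarith [pow_nonneg hT0 6]
  · have h5 := hρ.nonneg z x
    calc deltaE ρ' E x ≤ ρ' x z := ciInf_le hbdd ⟨z, hz⟩
      _ ≤ L * ρ x z := hρ'.le_mul x z
      _ ≤ T * (T * (4 * T ^ 4 * r)) := by
          gcongr
          · exact hρ.nonneg x z
          · refine (hρ.symm_le z x).trans ?_
            gcongr
      _ = 4 * T ^ 6 * r := by ring
      _ ≤ _ := by gcongr; norm_num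

/-- The exponent `2υ - (m - d)` of the weight can have either sign, so both the upper and the lower
bound for `δ_E` are used, and the constant involves `|p|`. -/
theorem IsLocated.rpow_delta_le {X : Type*} {ρ ρ' : X → X → ℝ} {E : Set X} {Γ r : ℝ} {z x : X}
    (h : IsLocated ρ ρ' E Γ r z x) (hΓ : 0 < Γ) (hr : 0 < r) (p : ℝ) :
    deltaE ρ' E x ^ p ≤ Γ ^ |p| * r ^ p := by
  have hδ : 0 < deltaE ρ' E x := by
    have := hr.trans_le h.le_delta
    exact pos_of_mul_pos_right this hΓ.le
  rcases le_total 0 p with hp | hp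
  · rw [abs_of_nonneg hp, ← Real.mul_rpow hΓ.le hr.le]
    exact Real.rpow_le_rpow hδ.le h.delta_le hp
  · rw [abs_of_nonpos hp]
    calc deltaE ρ' E x ^ p = Γ ^ (-p) * (Γ * deltaE ρ' E x) ^ p := by
          rw [Real.mul_rpow hΓ.le hδ.le, ← mul_assoc, ← Real.rpow_add hΓ]
          simp
      _ ≤ Γ ^ (-p) * r ^ p := by
          exact mul_le_mul_of_nonneg_left (Real.rpow_le_rpow_of_nonpos hr h.le_delta hp)
            (by positivity)

theorem measurable_of_borel_le {Y Z : Type*} [MeasurableSpace Y] [TopologicalSpace Y]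
    [TopologicalSpace Z] (hle : borel Y ≤ ‹MeasurableSpace Y›) {g : Y → Z} (hg : Continuous g) :
    @Measurable Y Z _ (borel Z) g := by
  refine @measurable_generateFrom Y Z _ _ g fun s hs => ?_
  exact hle _ (MeasurableSpace.measurableSet_generateFrom (hg.isOpen_preimage s hs))

/-- For `x ∉ E` the slice `y ↦ (x, y)` is continuous into the complement of the diagonal. The
argument goes through continuity because `θ` is only assumed measurable for the Borel sets of the
product topology. -/
theorem IsKernel.measurable_right {X : Type*} {ρ θ : X → X → ℝ} {d υ α Cθ : ℝ}
    (h : IsKernel ρ θ d υ α Cθ) {E : Set X} [MeasurableSpace E]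
    (hle : @borel E (qTopology (restr ρ E)) ≤ ‹MeasurableSpace E›) {x : X} (hx : x ∉ E) :
    Measurable fun y : E => θ x y := by
  let τX : TopologicalSpace X := qTopology ρ
  have hval : @Continuous E X (qTopology (restr ρ E)) τX Subtype.val := by
    refine @Continuous.mk E X (qTopology (restr ρ E)) τX _ fun s hs y hy => ?_
    obtain ⟨r, hr, hsub⟩ := hs y.1 hy
    exact ⟨r, hr, fun w hw => hsub hw⟩
  have hne : ∀ y : E, x ≠ y.1 := fun y hxy => hx (hxy ▸ y.2)
  let g : E → {p : X × X // p.1 ≠ p.2} := fun y => ⟨(x, y.1), hne y⟩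
  have hg : @Continuous E {p : X × X // p.1 ≠ p.2} (qTopology (restr ρ E)) _ g := by
    refine @Continuous.subtype_mk _ _ _ (qTopology (restr ρ E)) _ _ ?_ _
    exact @Continuous.prodMk _ _ _ _ _ (qTopology (restr ρ E)) _ _
      (@continuous_const _ _ (qTopology (restr ρ E)) _ _) hval
  have hgm := @measurable_of_borel_le E _ _ (qTopology (restr ρ E)) _ hle g hg
  have h2 := @Measurable.comp _ _ _ _ (borel _) (borel ℝ) _ _ h.measurable hgm
  rw [BorelSpace.measurable_eq (α := ℝ)]
  exact h2

theorem IsRegularization.measurable_deltaE {X : Type*} [MeasurableSpace X] {ρ ρ' : X → X → ℝ}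
    {E : Set X} {L : ℝ} (h : IsRegularization ρ ρ' E L)
    (hle : @borel X (qTopology ρ) ≤ ‹MeasurableSpace X›) : Measurable (deltaE ρ' E) := by
  have h2 := @measurable_of_borel_le X ℝ _ (qTopology ρ) _ hle _ h.continuous
  rw [BorelSpace.measurable_eq (α := ℝ)]
  exact h2

/-- The kernel `θ(x, ·)`, suitably scaled, is adapted at the location of `x`. -/
theorem IsKernel.isAdapted {X : Type*} {ρ ρ' θ : X → X → ℝ} {d υ α Cθ Cs Cρ ε Γ r : ℝ} {B : ℝ≥0}
    {E : Set X} [MeasurableSpace E] (h : IsKernel ρ θ d υ α Cθ) (hρ : IsQuasiDist ρ Cs Cρ)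
    (hle : @borel E (qTopology (restr ρ E)) ≤ ‹MeasurableSpace E›)
    {z : E} {x : X} (hx : x ∉ E) (hloc : IsLocated ρ ρ' E Γ r z x) (hr : 0 < r)
    (hΓ : 0 < Γ) (hCθ : 0 ≤ Cθ) (hd : 0 ≤ d) (hυ : 0 ≤ υ) (hα : 0 ≤ α) (hε : 0 ≤ ε)
    (hεα : ε ≤ α) (hB1 : 1 ≤ B) (hB2 : 2 * Γ ≤ B) (hB3 : Cθ * Γ ^ (d + υ) ≤ B)
    (hB4 : Cθ * Γ ^ (d + υ + α) ≤ B) :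
    IsAdapted (restr ρ E) d υ ε B r z (fun y => r ^ υ * θ x y) := by
  have hne : ∀ y : E, x ≠ y.1 := fun y hxy => hx (hxy ▸ y.2)
  have hS : ∀ y : E, 0 < r + ρ z y := fun y => by linarith [hρ.nonneg z y]
  have hdist : ∀ (y : E) {p : ℝ}, 0 ≤ p → (ρ x y ^ p)⁻¹ ≤ Γ ^ p / (r + ρ z y) ^ p := by
    intro y p hp
    have h1 := hS y
    have h2 := hloc.add_le y y.2
    have h3 : 0 < ρ x y := pos_of_mul_pos_right (h1.trans_le h2) hΓ.le
    have h4 := Real.rpow_le_rpow h1.le h2 hp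
    rw [Real.mul_rpow hΓ.le h3.le] at h4
    rw [inv_le_iff_one_le_mul₀ (by positivity), div_mul_eq_mul_div, le_div_iff₀ (by positivity),
      one_mul]
    exact h4
  constructor
  · exact (h.measurable_right hle hx).const_mul _
  · intro y
    have h1 := hS y
    calc |r ^ υ * θ x y| = r ^ υ * |θ x y| := by rw [abs_mul, abs_of_pos (by positivity)]
      _ ≤ r ^ υ * (Cθ * (Γ ^ (d + υ) / (r + ρ z y) ^ (d + υ))) := by
          gcongr
          refine (h.decay x y (hne y)).trans ?_
          rw [div_eq_mul_inv]
          gcongr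
          exact hdist y (by linarith)
      _ = Cθ * Γ ^ (d + υ) * poisson (restr ρ E) d υ r z y := by
          unfold poisson
          ring
      _ ≤ _ := mul_le_mul_of_nonneg_right hB3
          (poisson_nonneg (fun a b => hρ.nonneg a b) hr.le _ _)
  · intro y y' hyy
    have h1 := hS y
    have hB : (0 : ℝ) < B := by
      have : (1 : ℝ) ≤ B := by exact_mod_cast hB1
      linarith
    have hn : 0 ≤ ρ y y' := hρ.nonneg y y'
    have h2 : ρ y y' ≤ r / B := hyy
    -- The condition `2 * Γ ≤ B` makes admissible increments small enough for the Hölder hypothesis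
    -- on `θ`.
    have h3 : ρ y y' ≤ ρ x y / 2 := by
      have h4 := hloc.add_le y y.2
      have h5 := hρ.nonneg z y
      have h6 : r / B ≤ r / (2 * Γ) := by gcongr
      have h7 : r / (2 * Γ) ≤ ρ x y / 2 := by
        rw [div_le_div_iff₀ (by positivity) (by norm_num)]
        nlinarith
      linarith
    -- This permits lowering the Hölder exponent from `α` to `ε`.
    have h4 : ρ y y' / r ≤ 1 := by
      rw [div_le_one hr]
      refine h2.trans (div_le_self hr.le ?_)
      exact_mod_cast hB1
    have h4' : 0 ≤ ρ y y' / r := by positivity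
    calc |r ^ υ * θ x y - r ^ υ * θ x y'| = r ^ υ * |θ x y - θ x y'| := by
          rw [← mul_sub, abs_mul, abs_of_pos (by positivity)]
      _ ≤ r ^ υ * (Cθ * (ρ y y' ^ α * (Γ ^ (d + υ + α) / (r + ρ z y) ^ (d + υ + α)))) := by
          gcongr
          refine (h.holder x y y' (hne y) (hne y').symm h3).trans ?_
          rw [div_eq_mul_inv]
          gcongr
          exact hdist y (by linarith)
      _ = Cθ * Γ ^ (d + υ + α) * ((ρ y y' / r) ^ α * ((r / (r + ρ z y)) ^ α *
            poisson (restr ρ E) d υ r z y)) := by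
          unfold poisson
          rw [Real.div_rpow hn hr.le, Real.div_rpow hr.le h1.le, Real.rpow_add h1]
          have := Real.rpow_pos_of_pos hr α
          field_simp
      _ ≤ B * ((ρ y y' / r) ^ ε * (1 * poisson (restr ρ E) d υ r z y)) := by
          have hp := poisson_nonneg (ρ := restr ρ E) (d := d) (ε := υ)
            (fun a b => hρ.nonneg a b) hr.le z y
          gcongr ?_ * (?_ * (?_ * _))
          · exact Real.rpow_le_rpow_of_exponent_ge' h4' h4 hε hεα
          · refine Real.rpow_le_one (by positivity) ?_ hα
            rw [div_le_one h1]
            linarith [hρ.nonneg z y]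
      _ = _ := by rw [one_mul]

/-- The kernel is integrable, being dominated by the Poisson kernel, and bounded by `B r^(-d)`. In
contrast to `IsAdapted.memLp` no cube is required, so the statement also covers points far from a
bounded `E`. -/
theorem IsAdapted.memLp_two {Y : Type u} [MeasurableSpace Y] {ρ : Y → Y → ℝ} {σ : Measure Y}
    {d υ ε r : ℝ} {Λ B : ℝ≥0} {z : Y} {κ : Y → ℝ} (h0 : ∀ x y, 0 ≤ ρ x y)
    (hm : ∀ x, Measurable (ρ x))
    (hball : ∀ x r, 0 < r → σ (qBall ρ x r) ≤ Λ * ENNReal.ofReal (r ^ d))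
    (hd : 0 ≤ d) (hυ : 0 < υ) (hr : 0 < r) (hκ : IsAdapted ρ d υ ε B r z κ) : MemLp κ 2 σ := by
  obtain ⟨C, hC⟩ := lintegral_poisson_le.{u} d υ Λ hd hυ
  have hP : Integrable (fun y => poisson ρ d υ r z y) σ := by
    refine ⟨(measurable_poisson hm z).aestronglyMeasurable, ?_⟩
    rw [hasFiniteIntegral_iff_ofReal (Filter.Eventually.of_forall fun y =>
      poisson_nonneg h0 hr.le z y)]
    exact (hC h0 hm hball r z hr).trans_lt ENNReal.coe_lt_top
  have hi : Integrable κ σ := (hP.const_mul B).mono' hκ.measurable.aestronglyMeasurable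
    (Filter.Eventually.of_forall hκ.abs_le)
  rw [memLp_two_iff_integrable_sq hκ.measurable.aestronglyMeasurable]
  have := hi.bdd_mul (c := B * r ^ (-d)) hκ.measurable.aestronglyMeasurable
    (Filter.Eventually.of_forall fun y => (hκ.abs_le y).trans (by
      gcongr
      exact poisson_le_rpow_neg h0 hr (by linarith) _ _))
  simpa [sq] using this

/-! ### Assigning Whitney sets to cubes. -/

/-- The Whitney set `I j` has the size of the cube `p` and is close to it. -/
def IsAssigned {X : Type*} (ρ : X → X → ℝ) {E : Set X} (D : ℤ → Set (Set E)) (I : ℕ → Set X)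
    (s : ℕ → ℝ) (K : ℝ) (j : ℕ) (p : ℤ × Set E) : Prop :=
  p ∈ cubes D ∧ side p.1 ≤ s j ∧ s j ≤ 2 * side p.1 ∧
    ∃ x ∈ I j, ∃ w ∈ p.2, ρ x w ≤ K * side p.1

/-- The part of the complement of `E` covered by the Whitney sets assigned to a cube. -/
def whitneyPart {X : Type*} {E : Set X} (I : ℕ → Set X) (S : Set ℕ) (q : ℕ → ℤ × Set E) (k : ℤ)
    (Q : Set E) : Set X :=
  ⋃ j ∈ {j | j ∈ S ∧ q j = (k, Q)}, disjointed I j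

theorem measurableSet_whitneyPart {X : Type*} [MeasurableSpace X] {E : Set X} {I : ℕ → Set X}
    (hI : ∀ j, MeasurableSet (I j)) (S : Set ℕ) (q : ℕ → ℤ × Set E) (k : ℤ) (Q : Set E) :
    MeasurableSet (whitneyPart I S q k Q) :=
  MeasurableSet.biUnion (to_countable _) fun j _ => MeasurableSet.disjointed hI j

theorem disjoint_whitneyPart {X : Type*} {E : Set X} (I : ℕ → Set X) (S : Set ℕ)
    (q : ℕ → ℤ × Set E) {p p' : ℤ × Set E} (hp : p ≠ p') :
    Disjoint (whitneyPart I S q p.1 p.2) (whitneyPart I S q p'.1 p'.2) := by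
  simp only [whitneyPart, disjoint_iUnion_left, disjoint_iUnion_right]
  rintro j ⟨-, hj⟩ i ⟨-, hi⟩
  refine disjoint_disjointed I fun hij => hp ?_
  rw [hij] at hi
  exact hi.symm.trans hj

theorem exists_of_mem_whitneyPart {X : Type*} {E : Set X} {I : ℕ → Set X} {S : Set ℕ}
    {q : ℕ → ℤ × Set E} {k : ℤ} {Q : Set E} {x : X} (hx : x ∈ whitneyPart I S q k Q) :
    ∃ j ∈ S, q j = (k, Q) ∧ x ∈ I j := by
  obtain ⟨j, ⟨hj, hq⟩, hx⟩ := mem_iUnion₂.1 hx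
  exact ⟨j, hj, hq, disjointed_subset I j hx⟩

theorem exists_side_le {s : ℝ} (hs : 0 < s) : ∃ k : ℤ, side k ≤ s ∧ s ≤ 2 * side k := by
  obtain ⟨n, hn⟩ := exists_mem_Ico_zpow hs (one_lt_two : (1 : ℝ) < 2)
  refine ⟨-n, ?_, ?_⟩
  · simpa [side] using hn.1
  · have := hn.2.le
    rw [zpow_add_one₀ two_ne_zero] at this
    simp only [side, neg_neg]
    linarith

theorem IsAssigned.subset_whitneyRegion {X : Type*} {ρ : X → X → ℝ} {E : Set X}
    {D : ℤ → Set (Set E)} {I : ℕ → Set X} {s : ℕ → ℝ} {K K₀ : ℝ} {j : ℕ} {p : ℤ × Set E}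
    (h : IsAssigned ρ D I s K₀ j p) (hK : K₀ ≤ K) (hK2 : 2 ≤ K) :
    I j ⊆ whitneyRegion ρ I s K p.1 p.2 := by
  obtain ⟨-, h1, h2, x, hx, w, hw, hxw⟩ := h
  have hs := side_pos p.1
  refine subset_biUnion_of_mem (u := fun j => I j) ?_
  refine ⟨?_, ?_, ?_⟩
  · rw [inv_mul_le_iff₀ (by linarith)]
    nlinarith
  · nlinarith
  · unfold qDist
    refine (iInf₂_le_of_le x hx (iInf₂_le (w : X) (mem_image_of_mem _ hw))).trans ?_
    exact ENNReal.ofReal_le_ofReal (hxw.trans (by gcongr))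

section

variable {X : Type u} [MeasurableSpace X] {ρ ρ' θ : X → X → ℝ} {μ : Measure X} {E : Set X}
  {σ : Measure E} {D : ℤ → Set (Set E)} {I : ℕ → Set X} {s : ℕ → ℝ} {z : ℤ → Set E → E}
  {d m υ α ε η Cs Cρ L W AX AE a₀ a₁ c Cθ K T : ℝ} {M : ℕ} {Λ B : ℝ≥0}

/-- The generation with `side k ≤ s j ≤ 2 * side k` has side at most `diam E`, so a cube passes
within `side k` of a point of `E` near `I j`. Both legs of the path to it have length at most `2 * W
* side k`; the quasi-triangle inequality gives the constant `2 * Cρ * W`. -/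
theorem IsWhitney.exists_isAssigned (hI : IsWhitney ρ E I s W M) (hW : 1 ≤ W) (hCρ : 1 ≤ Cρ)
    (hρ : IsQuasiDist ρ Cs Cρ) (hAE : 0 < AE) (hadr : IsADR (restr ρ E) σ d AE)
    (hD : IsDyadic (restr ρ E) σ D a₀ a₁ η c) {j : ℕ} (hne : (I j).Nonempty)
    (hj : ENNReal.ofReal (s j) ≤ qDiam (restr ρ E)) :
    ∃ p, IsAssigned ρ D I s (2 * Cρ * W) j p := by
  obtain ⟨k, hk1, hk2⟩ := exists_side_le (hI.size_pos j)
  obtain ⟨x, hx⟩ := hne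
  obtain ⟨y, hy, hxy⟩ := hI.dist_le j x hx
  have hs := side_pos k
  obtain ⟨Q, hQ, w, hw, hyw⟩ := hD.exists_dist_lt hAE hadr
    ((ENNReal.ofReal_le_ofReal hk1).trans hj) ⟨y, hy⟩
  refine ⟨(k, Q), hQ, hk1, hk2, x, hx, w, hw, (hρ.le_max x w y).trans ?_⟩
  have hyw' : ρ y w < side k := hyw
  have h1 : max (ρ x y) (ρ y w) ≤ 2 * W * side k := by
    refine max_le (hxy.trans ?_) (hyw'.le.trans ?_)
    · nlinarith
    · nlinarith
  calc Cρ * max (ρ x y) (ρ y w) ≤ Cρ * (2 * W * side k) := by gcongr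
    _ = _ := by ring

/-- The centre of the cube is joined to `x` through the point of the cube and the point of `I j`
that witness their closeness; `T` dominates all the constants involved. -/
theorem IsAssigned.isLocated {j : ℕ} {k : ℤ} {Q : Set E} (h : IsAssigned ρ D I s K j (k, Q))
    (hDS : DyadicSpace (restr ρ E) σ D z d η Λ) (hI : IsWhitney ρ E I s W M)
    (hρ : IsQuasiDist ρ Cs Cρ) (hρ' : IsRegularization ρ ρ' E L) (hT : 1 ≤ T) (hCρ : 0 ≤ Cρ)
    (hL : 1 ≤ L) (hCsT : Cs ≤ T) (hCρT : Cρ ≤ T) (hLT : L ≤ T) (hWT : W ≤ T) (hKT : K ≤ T)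
    (hΛT : Λ ≤ T) {x : X} (hx : x ∈ I j) :
    IsLocated ρ ρ' E (6 * T ^ 6) (side k) (z k Q) x := by
  obtain ⟨hQ, h1, h2, x₀, hx₀, w, hw, hxw⟩ := h
  replace h1 : side k ≤ s j := h1
  replace h2 : s j ≤ 2 * side k := h2
  replace hxw : ρ x₀ w ≤ K * side k := hxw
  have hs := side_pos k
  have hsj := hI.size_pos j
  have hT0 : 0 ≤ T := by linarith
  refine isLocated_of_dist_le hρ hρ' hT hCρ hL hCsT hCρT hLT hs.le (z k Q).2 ?_ ?_
  · have e1 : ρ (z k Q) w ≤ T * side k :=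
      (hDS.dist_ctr_le k Q hQ w hw).trans (by gcongr)
    have e2 : ρ w x₀ ≤ T * (T * side k) := by
      refine (hρ.symm_le x₀ w).trans ?_
      have := hρ.nonneg x₀ w
      gcongr
      exact hxw.trans (by gcongr)
    have e3 : ρ x₀ x ≤ T * (2 * side k) := (hI.diam_le j x₀ hx₀ x hx).trans (by gcongr)
    have e4 := hρ.triangle hCρ hCρT w x x₀
    have e5 := hρ.triangle hCρ hCρT (z k Q) x w
    have e6 : ρ w x ≤ T * (T * (T * side k) + T * (2 * side k)) := e4.trans (by gcongr)
    have e7 : T ^ 3 ≤ T ^ 4 := pow_le_pow_right₀ hT (by norm_num)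
    have e8 : T ^ 2 ≤ T ^ 4 := pow_le_pow_right₀ hT (by norm_num)
    calc ρ (z k Q) x ≤ T * (ρ (z k Q) w + ρ w x) := e5
      _ ≤ T * (T * side k + T * (T * (T * side k) + T * (2 * side k))) := by gcongr
      _ = (T ^ 2 + T ^ 4 + 2 * T ^ 3) * side k := by ring
      _ ≤ 4 * T ^ 4 * side k := by gcongr; linarith
  · intro y hy
    refine h1.trans ((hI.le_dist j x hx y hy).trans ?_)
    have := hρ.nonneg x y
    gcongr

/-- This version uses no cubes: the scale is the size of the Whitney set and the base point a nearby
point of `E`. It also serves Whitney sets larger than `E`. -/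
theorem IsWhitney.exists_isLocated (hI : IsWhitney ρ E I s W M)
    (hρ : IsQuasiDist ρ Cs Cρ) (hρ' : IsRegularization ρ ρ' E L) (hT : 1 ≤ T) (hCρ : 0 ≤ Cρ)
    (hL : 1 ≤ L) (hCsT : Cs ≤ T) (hCρT : Cρ ≤ T) (hLT : L ≤ T) (hWT : W ≤ T) {j : ℕ} {x : X}
    (hx : x ∈ I j) : ∃ z : E, IsLocated ρ ρ' E (6 * T ^ 6) (s j) z x := by
  obtain ⟨z, hz, hxz⟩ := hI.dist_le j x hx
  have hs := hI.size_pos j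
  refine ⟨⟨z, hz⟩, isLocated_of_dist_le hρ hρ' hT hCρ hL hCsT hCρT hLT hs.le hz ?_ ?_⟩
  · have e8 : T ^ 2 ≤ T ^ 4 := pow_le_pow_right₀ hT (by norm_num)
    have := hρ.nonneg x z
    calc ρ z x ≤ Cs * ρ x z := hρ.symm_le x z
      _ ≤ T * (T * s j) := by gcongr; exact hxz.trans (by gcongr)
      _ = T ^ 2 * s j := by ring
      _ ≤ 4 * T ^ 4 * s j := by gcongr; linarith [pow_nonneg (zero_le_one.trans hT) 4]
  · intro y hy
    have := hρ.nonneg x y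
    exact (hI.le_dist j x hx y hy).trans (by gcongr)

end

/-- The Whitney sets assigned to the cubes form a Whitney family. -/
theorem IsWhitney.isWhitneyFamily (d m υ α ε η Cs Cρ L W Cθ K : ℝ) (Λ CX : ℝ≥0) (hd : 0 ≤ d)
    (hυ : 0 ≤ υ) (hα : 0 ≤ α) (hε : 0 ≤ ε) (hεα : ε ≤ α) (hCθ : 0 ≤ Cθ)
    (hCρ : 0 ≤ Cρ) (hL : 1 ≤ L) :
    ∃ B : ℝ≥0, ∀ {X : Type u} [MeasurableSpace X] {ρ ρ' θ : X → X → ℝ} {μ : Measure X}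
      {E : Set X} {σ : Measure E} {D : ℤ → Set (Set E)} {I : ℕ → Set X} {s : ℕ → ℝ}
      {z : ℤ → Set E → E} {M : ℕ} {S : Set ℕ} {q : ℕ → ℤ × Set E}, IsQuasiDist ρ Cs Cρ →
      IsRegularization ρ ρ' E L → IsKernel ρ θ d υ α Cθ → IsWhitney ρ E I s W M →
      DyadicSpace (restr ρ E) σ D z d η Λ →
      @borel X (qTopology ρ) ≤ ‹MeasurableSpace X› →
      @borel E (qTopology (restr ρ E)) ≤ Subtype.instMeasurableSpace →
      (∀ x r, 0 < r → μ (qBall ρ x r) ≤ CX * ENNReal.ofReal (r ^ m)) →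
      (∀ j ∈ S, IsAssigned ρ D I s K j (q j)) →
      IsWhitneyFamily (restr ρ E) σ D z μ
        (fun x => ENNReal.ofReal (deltaE ρ' E x ^ (2 * υ - (m - d)))) (fun x (y : E) => θ x y)
        (whitneyPart I S q) d υ ε B := by
  set T : ℝ := max 1 (max (max Cs Cρ) (max (max L W) (max K Λ))) with hTdef
  have hT : 1 ≤ T := le_max_left _ _
  have hCsT : Cs ≤ T := by simp [hTdef]
  have hCρT : Cρ ≤ T := by simp [hTdef]
  have hLT : L ≤ T := by simp [hTdef]
  have hWT : W ≤ T := by simp [hTdef]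
  have hKT : K ≤ T := by simp [hTdef]
  have hΛT : Λ ≤ T := by simp [hTdef]
  set Γ : ℝ := 6 * T ^ 6 with hΓdef
  have hΓ : 0 < Γ := by positivity
  set p : ℝ := 2 * υ - (m - d) with hp
  set A : ℝ≥0 := (Γ ^ |p|).toNNReal * (CX * ((2 * Γ) ^ m).toNNReal) * Λ with hA
  set B : ℝ≥0 := 1 + (2 * Γ).toNNReal + (Cθ * Γ ^ (d + υ)).toNNReal +
    (Cθ * Γ ^ (d + υ + α)).toNNReal + A with hB
  have hB1 : 1 ≤ B := by
    rw [hB]; exact le_add_right (le_add_right (le_add_right (le_add_right le_rfl)))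
  have hle : ∀ {a : ℝ}, a.toNNReal ≤ B → a ≤ B := fun h =>
    (Real.le_coe_toNNReal _).trans (by exact_mod_cast h)
  have hB2 : 2 * Γ ≤ B := hle <| by
    rw [hB]; exact le_add_right (le_add_right (le_add_right (le_add_left le_rfl)))
  have hB3 : Cθ * Γ ^ (d + υ) ≤ B := hle <| by
    rw [hB]; exact le_add_right (le_add_right (le_add_left le_rfl))
  have hB4 : Cθ * Γ ^ (d + υ + α) ≤ B := hle <| by
    rw [hB]; exact le_add_right (le_add_left le_rfl)
  have hB5 : A ≤ B := by rw [hB]; exact le_add_left le_rfl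
  refine ⟨B, ?_⟩
  intro X _ ρ ρ' θ μ E σ D I s z M S q hρ hρ' hθ hI hDS hX hE hball hq
  have hloc : ∀ k Q, ∀ x ∈ whitneyPart I S q k Q,
      x ∉ E ∧ IsLocated ρ ρ' E Γ (side k) (z k Q) x := by
    intro k Q x hx
    obtain ⟨j, hj, hqj, hxj⟩ := exists_of_mem_whitneyPart hx
    have h1 := hq j hj
    rw [hqj] at h1
    refine ⟨?_, h1.isLocated hDS hI hρ hρ' hT hCρ hL hCsT hCρT hLT hWT hKT hΛT hxj⟩
    have : x ∈ ⋃ j, I j := mem_iUnion.2 ⟨j, hxj⟩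
    rwa [hI.cover] at this
  constructor
  · exact hB1
  · exact ((hρ'.measurable_deltaE hX).pow_const _).ennreal_ofReal
  · exact fun k Q _ => measurableSet_whitneyPart hI.measurable S q k Q
  · exact fun p _ p' _ hpp => disjoint_whitneyPart I S q hpp
  · intro k Q _ x hx
    obtain ⟨hxE, hl⟩ := hloc k Q x hx
    exact hθ.isAdapted hρ hE hxE hl (side_pos k) hΓ hCθ hd hυ hα hε hεα hB1 hB2 hB3 hB4
  · intro k Q hQ
    have hs := side_pos k
    have h1 : μ (whitneyPart I S q k Q) ≤ CX * ENNReal.ofReal ((2 * Γ * side k) ^ m) := by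
      refine (measure_mono fun x hx => ?_).trans (hball (z k Q) (2 * Γ * side k) (by positivity))
      have := (hloc k Q x hx).2.dist_le
      change ρ (z k Q) x < 2 * Γ * side k
      nlinarith [mul_pos hΓ hs]
    calc ∫⁻ x in whitneyPart I S q k Q, ENNReal.ofReal (deltaE ρ' E x ^ p) ∂μ
        ≤ ∫⁻ _ in whitneyPart I S q k Q, ENNReal.ofReal (Γ ^ |p| * side k ^ p) ∂μ := by
          refine setLIntegral_mono measurable_const fun x hx => ?_
          exact ENNReal.ofReal_le_ofReal ((hloc k Q x hx).2.rpow_delta_le hΓ hs p)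
      _ = ENNReal.ofReal (Γ ^ |p| * side k ^ p) * μ (whitneyPart I S q k Q) := by
          rw [setLIntegral_const]
      _ ≤ ENNReal.ofReal (Γ ^ |p| * side k ^ p) * (CX * ENNReal.ofReal ((2 * Γ * side k) ^ m)) :=
          mul_le_mul_right h1 _
      _ = ENNReal.ofReal (Γ ^ |p|) * (CX * ENNReal.ofReal ((2 * Γ) ^ m)) *
            ENNReal.ofReal (side k ^ (2 * υ)) * ENNReal.ofReal (side k ^ d) := by
          -- The weight and the measure of the region combine to the exponent `2υ + d`, and `side k
          -- ^ d` is comparable to `σ Q`.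
          have e : side k ^ p * side k ^ m = side k ^ (2 * υ) * side k ^ d := by
            rw [← Real.rpow_add hs, ← Real.rpow_add hs]
            congr 1
            rw [hp]
            ring
          rw [Real.mul_rpow (by positivity) hs.le, ENNReal.ofReal_mul (by positivity),
            ENNReal.ofReal_mul (by positivity)]
          calc _ = ENNReal.ofReal (Γ ^ |p|) * (CX * ENNReal.ofReal ((2 * Γ) ^ m)) *
                (ENNReal.ofReal (side k ^ p) * ENNReal.ofReal (side k ^ m)) := by ring
            _ = _ := by
                rw [← ENNReal.ofReal_mul (by positivity), e, ENNReal.ofReal_mul (by positivity)]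
                ring
      _ ≤ ENNReal.ofReal (Γ ^ |p|) * (CX * ENNReal.ofReal ((2 * Γ) ^ m)) *
            ENNReal.ofReal (side k ^ (2 * υ)) * (Λ * σ Q) :=
          mul_le_mul_right (hDS.le_measure k Q hQ) _
      _ = A * ENNReal.ofReal (side k ^ (2 * υ)) * σ Q := by
          rw [hA]
          push_cast
          simp only [ENNReal.ofReal]
          ring
      _ ≤ _ := by gcongr

/-- `Θ f` converges absolutely off `E`, for `f` in `L²`. -/
theorem IsKernel.integrable_mul {X : Type u} [MeasurableSpace X] {ρ ρ' θ : X → X → ℝ} {E : Set X}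
    {σ : Measure E} {d υ α Cθ Cs Cρ Γ r : ℝ} {CE : ℝ≥0} (h : IsKernel ρ θ d υ α Cθ)
    (hρ : IsQuasiDist ρ Cs Cρ) (hE : @borel E (qTopology (restr ρ E)) ≤ Subtype.instMeasurableSpace)
    (hm : ∀ x, Measurable (restr ρ E x))
    (hball : ∀ x r, 0 < r → σ (qBall (restr ρ E) x r) ≤ CE * ENNReal.ofReal (r ^ d))
    {z : E} {x : X} (hx : x ∉ E) (hloc : IsLocated ρ ρ' E Γ r z x) (hr : 0 < r)
    (hΓ : 0 < Γ) (hCθ : 0 ≤ Cθ) (hd : 0 ≤ d) (hυ : 0 < υ) (hα : 0 ≤ α) {f : E → ℂ}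
    (hf : MemLp f 2 σ) : Integrable (fun y : E => (θ x y : ℂ) * f y) σ := by
  set B : ℝ≥0 := 1 + (2 * Γ).toNNReal + (Cθ * Γ ^ (d + υ)).toNNReal +
    (Cθ * Γ ^ (d + υ + α)).toNNReal with hB
  have hle : ∀ {a : ℝ}, a.toNNReal ≤ B → a ≤ B := fun h =>
    (Real.le_coe_toNNReal _).trans (by exact_mod_cast h)
  -- Only the size of the kernel matters here, so the Hölder exponent may be `0`.
  have h1 : IsAdapted (restr ρ E) d υ 0 B r z (fun y => r ^ υ * θ x y) := by
    refine h.isAdapted hρ hE hx hloc hr hΓ hCθ hd hυ.le hα le_rfl hα ?_ (hle ?_) (hle ?_) (hle ?_)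
    · rw [hB]; exact le_add_right (le_add_right (le_add_right le_rfl))
    · rw [hB]; exact le_add_right (le_add_right (le_add_left le_rfl))
    · rw [hB]; exact le_add_right (le_add_left le_rfl)
    · rw [hB]; exact le_add_left le_rfl
  have h0 : ∀ a b : E, 0 ≤ restr ρ E a b := fun a b => hρ.nonneg a b
  have h2 := (h1.memLp_two h0 hm hball hd hυ hr).const_mul (r ^ υ)⁻¹
  have h3 : ∀ y : E, (r ^ υ)⁻¹ * (r ^ υ * θ x y) = θ x y := fun y =>
    inv_mul_cancel_left₀ (Real.rpow_pos_of_pos hr υ).ne' _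
  simp only [h3] at h2
  exact MemLp.integrable_ofReal_mul h2 hf

/-! ### Whitney sets larger than `E`, and tents. -/

/-- The part of the square function over the Whitney sets that are larger than `E`. -/
theorem lintegral_far_le (d m υ α Cs Cρ L W Cθ : ℝ) (CE CX : ℝ≥0) (hd : 0 < d) (hm : 0 ≤ m)
    (hυ : 0 ≤ υ) (hCθ : 0 ≤ Cθ) (hCρ : 0 ≤ Cρ) (hL : 1 ≤ L) :
    ∃ C : ℝ≥0, ∀ {X : Type u} [MeasurableSpace X] {ρ ρ' θ : X → X → ℝ} {μ : Measure X}
      {E : Set X} {σ : Measure E} {I : ℕ → Set X} {s : ℕ → ℝ} {M : ℕ}, IsQuasiDist ρ Cs Cρ →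
      IsRegularization ρ ρ' E L → IsKernel ρ θ d υ α Cθ → IsWhitney ρ E I s W M → Nontrivial E →
      (∀ x, Measurable (ρ x)) →
      (∀ x r, 0 < r → μ (qBall ρ x r) ≤ CX * ENNReal.ofReal (r ^ m)) →
      (∀ x r, 0 < r → σ (qBall (restr ρ E) x r) ≤ CE * ENNReal.ofReal (r ^ d)) →
      ∀ f : E → ℂ, AEStronglyMeasurable f σ →
      ∫⁻ x in ⋃ j ∈ {j | qDiam (restr ρ E) < ENNReal.ofReal (s j)}, I j, ‖Theta θ σ f x‖ₑ ^ 2 *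
        ENNReal.ofReal (deltaE ρ' E x ^ (2 * υ - (m - d))) ∂μ ≤ C * ∫⁻ y, ‖f y‖ₑ ^ 2 ∂σ := by
  -- With `R = diam E`, the integrand on a Whitney set of size `s > R` is at most a multiple of `R^d
  -- s^(-(m + d)) ‖f‖²`. As `R + ρ(e₀, x)` is bounded by a multiple of `s`, this is dominated by the
  -- Poisson kernel on the ambient space with dimension `m`, decay `d` and scale `R`.
  obtain ⟨C₁, hC₁⟩ := lintegral_poisson_le.{u} m d CX hm hd
  set T : ℝ := max 1 (max (max Cs Cρ) (max L W)) with hTdef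
  have hT : 1 ≤ T := le_max_left _ _
  have hCsT : Cs ≤ T := by simp [hTdef]
  have hCρT : Cρ ≤ T := by simp [hTdef]
  have hLT : L ≤ T := by simp [hTdef]
  have hWT : W ≤ T := by simp [hTdef]
  set Γ : ℝ := 6 * T ^ 6 with hΓdef
  have hΓ : 0 < Γ := by positivity
  set p : ℝ := 2 * υ - (m - d) with hp
  set H : ℝ := 1 + T * (1 + Γ) with hH
  have hH0 : 0 < H := by positivity
  set b : ℝ := Cθ * Γ ^ (d + υ) with hb
  have hb0 : 0 ≤ b := by positivity
  refine ⟨(b ^ 2 * Γ ^ |p| * 2 ^ d * H ^ (m + d)).toNNReal * CE * C₁, ?_⟩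
  intro X _ ρ ρ' θ μ E σ I s M hρ hρ' hθ hI hE hmeas hball hballE f hf
  rcases eq_empty_or_nonempty {j | qDiam (restr ρ E) < ENNReal.ofReal (s j)} with he | ⟨j₀, hj₀⟩
  · simp [he]
  have hDt : qDiam (restr ρ E) ≠ ∞ := ((show _ < _ from hj₀).trans ENNReal.ofReal_lt_top).ne
  set R := (qDiam (restr ρ E)).toReal with hR
  have hofR : ENNReal.ofReal R = qDiam (restr ρ E) := ENNReal.ofReal_toReal hDt
  obtain ⟨e₀, e₁, he⟩ := hE
  have hR0 : 0 < R := by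
    have h1 : ρ e₀ e₁ ≤ R := le_toReal_qDiam hDt e₀ e₁
    refine lt_of_lt_of_le (lt_of_le_of_ne (hρ.nonneg _ _) fun h0 => he (Subtype.ext ?_)) h1
    exact (hρ.eq_zero_iff _ _).1 h0.symm
  have hσ : σ univ ≤ CE * ENNReal.ofReal ((2 * R) ^ d) := by
    refine (measure_mono fun y _ => ?_).trans (hballE e₀ (2 * R) (by positivity))
    have : ρ e₀ y ≤ R := le_toReal_qDiam hDt e₀ y
    change ρ e₀ y < 2 * R
    linarith
  set F := ∫⁻ y, ‖f y‖ₑ ^ 2 ∂σ with hF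
  have hpt : ∀ x ∈ ⋃ j ∈ {j | qDiam (restr ρ E) < ENNReal.ofReal (s j)}, I j,
      ‖Theta θ σ f x‖ₑ ^ 2 * ENNReal.ofReal (deltaE ρ' E x ^ p) ≤
        (ENNReal.ofReal (b ^ 2 * Γ ^ |p| * 2 ^ d * H ^ (m + d)) * CE * F) *
          ENNReal.ofReal (poisson ρ m d R e₀ x) := by
    intro x hx
    obtain ⟨j, hj, hxj⟩ := mem_iUnion₂.1 hx
    have hs := hI.size_pos j
    have hRs : R < s j := by
      have h1 : qDiam (restr ρ E) < ENNReal.ofReal (s j) := hj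
      rw [← hofR] at h1
      exact (ENNReal.ofReal_lt_ofReal_iff hs).1 h1
    obtain ⟨z, hz⟩ := hI.exists_isLocated hρ hρ' hT hCρ hL hCsT hCρT hLT hWT hxj
    have hxE : x ∉ E := by
      have : x ∈ ⋃ j, I j := mem_iUnion.2 ⟨j, hxj⟩
      rwa [hI.cover] at this
    have hθb : ∀ y : E, |θ x y| ≤ b * s j ^ (-(d + υ)) := by
      intro y
      have h1 := hz.add_le y y.2
      have h2 := hρ.nonneg z y
      have h3 : s j / Γ ≤ ρ x y := by
        rw [div_le_iff₀' hΓ]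
        linarith
      calc |θ x y| ≤ Cθ / ρ x y ^ (d + υ) := hθ.decay x y fun hxy => hxE (hxy ▸ y.2)
        _ ≤ Cθ / (s j / Γ) ^ (d + υ) := by gcongr
        _ = b * s j ^ (-(d + υ)) := by
            rw [Real.div_rpow hs.le hΓ.le, Real.rpow_neg hs.le, hb]
            field_simp
    have hΘ : ‖Theta θ σ f x‖ₑ ^ 2 ≤
        ENNReal.ofReal (b * s j ^ (-(d + υ))) ^ 2 * (CE * ENNReal.ofReal ((2 * R) ^ d) * F) := by
      calc ‖Theta θ σ f x‖ₑ ^ 2 ≤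
            (∫⁻ y, ENNReal.ofReal (b * s j ^ (-(d + υ))) * ‖f y‖ₑ ∂σ) ^ 2 := by
            refine pow_le_pow_left' ((enorm_integral_le_lintegral_enorm _).trans
              (lintegral_mono fun y => ?_)) 2
            rw [enorm_mul]
            refine mul_le_mul_left ?_ _
            rw [← ofReal_norm, Complex.norm_real, Real.norm_eq_abs]
            exact ENNReal.ofReal_le_ofReal (hθb y)
        _ = ENNReal.ofReal (b * s j ^ (-(d + υ))) ^ 2 * (∫⁻ y in univ, ‖f y‖ₑ ∂σ) ^ 2 := by
            rw [lintegral_const_mul'' _ hf.enorm, mul_pow, Measure.restrict_univ]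
        _ ≤ _ := by
            refine mul_le_mul_right ((sq_setLIntegral_le hf.enorm univ).trans ?_) _
            rw [Measure.restrict_univ]
            exact mul_le_mul_left hσ _
    have hHs : R + ρ e₀ x ≤ H * s j := by
      have h1 := hρ.triangle hCρ hCρT e₀ x z
      have h2 : ρ e₀ z ≤ R := le_toReal_qDiam hDt e₀ z
      have h3 := hz.dist_le
      have h4 : ρ e₀ x ≤ T * (s j + Γ * s j) := h1.trans (by gcongr; linarith)
      calc R + ρ e₀ x ≤ s j + T * (s j + Γ * s j) := by linarith
        _ = _ := by rw [hH]; ring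
    have hpos : 0 < R + ρ e₀ x := by linarith [hρ.nonneg e₀ x]
    have hpo : R ^ d * s j ^ (-(m + d)) ≤ H ^ (m + d) * poisson ρ m d R e₀ x := by
      unfold poisson
      have h1 : (R + ρ e₀ x) ^ (m + d) ≤ H ^ (m + d) * s j ^ (m + d) := by
        rw [← Real.mul_rpow hH0.le hs.le]
        exact Real.rpow_le_rpow hpos.le hHs (by linarith)
      rw [Real.rpow_neg hs.le, ← div_eq_mul_inv, mul_div_assoc',
        div_le_div_iff₀ (by positivity) (by positivity)]
      calc R ^ d * (R + ρ e₀ x) ^ (m + d) ≤ R ^ d * (H ^ (m + d) * s j ^ (m + d)) := by gcongr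
        _ = _ := by ring
    have hreal : (b * s j ^ (-(d + υ))) ^ 2 * (2 * R) ^ d * (Γ ^ |p| * s j ^ p) ≤
        b ^ 2 * Γ ^ |p| * 2 ^ d * H ^ (m + d) * poisson ρ m d R e₀ x := by
      have e : (s j ^ (-(d + υ))) ^ 2 * s j ^ p = s j ^ (-(m + d)) := by
        rw [← Real.rpow_natCast, ← Real.rpow_mul hs.le, ← Real.rpow_add hs]
        congr 1
        rw [hp]
        push_cast
        ring
      calc _ = b ^ 2 * Γ ^ |p| * 2 ^ d * (R ^ d * ((s j ^ (-(d + υ))) ^ 2 * s j ^ p)) := by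
            rw [Real.mul_rpow two_pos.le hR0.le]
            ring
        _ ≤ b ^ 2 * Γ ^ |p| * 2 ^ d * (H ^ (m + d) * poisson ρ m d R e₀ x) := by
            rw [e]
            gcongr
        _ = _ := by ring
    calc ‖Theta θ σ f x‖ₑ ^ 2 * ENNReal.ofReal (deltaE ρ' E x ^ p)
        ≤ ENNReal.ofReal (b * s j ^ (-(d + υ))) ^ 2 * (CE * ENNReal.ofReal ((2 * R) ^ d) * F) *
            ENNReal.ofReal (Γ ^ |p| * s j ^ p) :=
          mul_le_mul' hΘ (ENNReal.ofReal_le_ofReal (hz.rpow_delta_le hΓ hs p))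
      _ = ENNReal.ofReal ((b * s j ^ (-(d + υ))) ^ 2 * (2 * R) ^ d * (Γ ^ |p| * s j ^ p)) *
            (CE * F) := by
          rw [ENNReal.ofReal_mul (p := (b * s j ^ (-(d + υ))) ^ 2 * (2 * R) ^ d) (by positivity),
            ENNReal.ofReal_mul (p := (b * s j ^ (-(d + υ))) ^ 2) (by positivity),
            ENNReal.ofReal_pow (by positivity)]
          ring
      _ ≤ ENNReal.ofReal (b ^ 2 * Γ ^ |p| * 2 ^ d * H ^ (m + d) * poisson ρ m d R e₀ x) *
            (CE * F) := mul_le_mul_left (ENNReal.ofReal_le_ofReal hreal) _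
      _ = _ := by
          rw [ENNReal.ofReal_mul (by positivity)]
          ring
  have hPm : Measurable fun x => ENNReal.ofReal (poisson ρ m d R e₀ x) :=
    (measurable_poisson hmeas e₀.1).ennreal_ofReal
  calc _ ≤ ∫⁻ x in ⋃ j ∈ {j | qDiam (restr ρ E) < ENNReal.ofReal (s j)}, I j,
        (ENNReal.ofReal (b ^ 2 * Γ ^ |p| * 2 ^ d * H ^ (m + d)) * CE * F) *
          ENNReal.ofReal (poisson ρ m d R e₀ x) ∂μ :=
        setLIntegral_mono (hPm.const_mul _) hpt
    _ ≤ ∫⁻ x, (ENNReal.ofReal (b ^ 2 * Γ ^ |p| * 2 ^ d * H ^ (m + d)) * CE * F) *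
          ENNReal.ofReal (poisson ρ m d R e₀ x) ∂μ := setLIntegral_le_lintegral _ _
    _ = (ENNReal.ofReal (b ^ 2 * Γ ^ |p| * 2 ^ d * H ^ (m + d)) * CE * F) *
          ∫⁻ x, ENNReal.ofReal (poisson ρ m d R e₀ x) ∂μ := lintegral_const_mul _ hPm
    _ ≤ (ENNReal.ofReal (b ^ 2 * Γ ^ |p| * 2 ^ d * H ^ (m + d)) * CE * F) * C₁ :=
        mul_le_mul_right (hC₁ hρ.nonneg hmeas hball R e₀ hR0) _
    _ = _ := by
        push_cast
        simp only [ENNReal.ofReal]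
        ring

/-- The Whitney sets assigned to the descendants of a cube lie in its tent. -/
theorem tsum_desc_lintegral_le {X : Type*} [MeasurableSpace X] {ρ : X → X → ℝ} {μ : Measure X}
    {E : Set X} {D : ℤ → Set (Set E)} {I : ℕ → Set X} {s : ℕ → ℝ} {S : Set ℕ}
    {q : ℕ → ℤ × Set E} {K K₀ : ℝ} (hI : ∀ j, MeasurableSet (I j))
    (hD : ∀ k, (D k).Countable) (hq : ∀ j ∈ S, IsAssigned ρ D I s K₀ j (q j)) (hK : K₀ ≤ K)
    (hK2 : 2 ≤ K) (k : ℤ) (Q : Set E) (g : X → ℝ≥0∞) :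
    ∑' p : desc D k Q, ∫⁻ x in whitneyPart I S q p.1.1 p.1.2, g x ∂μ ≤
      ∫⁻ x in tent ρ D I s K Q, g x ∂μ := by
  have : Countable (desc D k Q) := ((countable_cubes hD).mono fun p hp => hp.1).to_subtype
  rw [← lintegral_iUnion (fun p : desc D k Q => measurableSet_whitneyPart hI S q p.1.1 p.1.2)
    (fun p p' hpp => disjoint_whitneyPart I S q fun h => hpp (Subtype.ext h))]
  refine lintegral_mono_set (iUnion_subset fun p x hx => ?_)
  obtain ⟨j, hj, hqj, hxj⟩ := exists_of_mem_whitneyPart hx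
  have h1 := hq j hj
  rw [hqj] at h1
  have h2 := h1.subset_whitneyRegion hK hK2 hxj
  exact mem_iUnion.2 ⟨p.1.1, mem_iUnion₂.2 ⟨p.1.2, ⟨p.2.1, p.2.2.2⟩, h2⟩⟩

/-- The sub-cube of a cube in the accretivity condition may be taken of a later generation. -/
theorem IsDyadic.exists_le_generation {Y : Type*} [MeasurableSpace Y] {ρ : Y → Y → ℝ}
    {σ : Measure Y} {D : ℤ → Set (Set Y)} {a₀ a₁ η c c₀ : ℝ} (hD : IsDyadic ρ σ D a₀ a₁ η c)
    (hc₀ : c₀ ≤ 1) {k : ℤ} {Q : Set Y} (hQ : Q ∈ D k) {P : Set Y → Prop}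
    (h : ∃ k' : ℤ, ∃ Q' ∈ D k', Q' ⊆ Q ∧ c₀ * side k ≤ side k' ∧ P Q') :
    ∃ k' : ℤ, ∃ Q' ∈ D k', Q' ⊆ Q ∧ c₀ * side k ≤ side k' ∧ k ≤ k' ∧ P Q' := by
  obtain ⟨k', Q', hQ', hsub, hs, hP⟩ := h
  rcases le_or_gt k k' with hk | hk
  · exact ⟨k', Q', hQ', hsub, hs, hk, hP⟩
  · have hsub' : Q ⊆ Q' := by
      refine (hD.nested k' k hk.le Q' hQ' Q hQ).resolve_right fun hdis => ?_
      obtain ⟨x, hx, -⟩ := hD.size k' Q' hQ'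
      exact disjoint_left.1 hdis (hsub hx) hx
    obtain rfl : Q' = Q := hsub.antisymm hsub'
    refine ⟨k, Q', hQ, Subset.rfl, ?_, le_rfl, hP⟩
    nlinarith [side_pos k]

/-! ### Assembling the near and the far part. -/

/-- The local `T(b)` theorem for square functions. -/
theorem lintegral_sq_Theta_le (d m : ℝ) (hd : 0 < d) (hdm : d < m) (Cs Cρ AX AE : ℝ) (hCs : 1 ≤ Cs)
    (hCρ : 1 ≤ Cρ) (hAE : 1 ≤ AE) (N : ℕ) (L : ℝ) (hL : 1 ≤ L) (a₀ a₁ η c : ℝ)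
    (ha₀ : 0 < a₀) (hη : 0 < η) (W : ℝ) (hW : 1 ≤ W) (M : ℕ) (K : ℝ) (hK : 2 * Cρ * W ≤ K)
    (υ α Cθ C₀ c₀ : ℝ) (hυ : 0 < υ) (hα : 0 < α) (hCθ : 0 < Cθ) (hC₀ : 1 ≤ C₀) (hc₀ : 0 < c₀)
    (hc₀1 : c₀ ≤ 1) :
    ∃ C : ℝ≥0, ∀ (X : Type u) [MeasurableSpace X] (ρ : X → X → ℝ) (μ : Measure X) (E : Set X)
      (σ : Measure E) (ρ' : X → X → ℝ) (D : ℤ → Set (Set E)) (I : ℕ → Set X) (s : ℕ → ℝ)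
      (θ : X → X → ℝ),
      IsQuasiDist ρ Cs Cρ → IsADR ρ μ m AX → IsGeomDoubling ρ N → IsADR (restr ρ E) σ d AE →
      IsRegularization ρ ρ' E L → IsDyadic (restr ρ E) σ D a₀ a₁ η c → IsWhitney ρ E I s W M →
      IsKernel ρ θ d υ α Cθ →
      (∃ b : ℤ → Set E → E → ℂ, ∀ k : ℤ, ∀ Q ∈ D k,
        AEStronglyMeasurable (b k Q) σ ∧
        ∫⁻ y, ‖b k Q y‖ₑ ^ 2 ∂σ ≤ ENNReal.ofReal C₀ * σ Q ∧
        (∃ k' : ℤ, ∃ Q' ∈ D k', Q' ⊆ Q ∧ c₀ * side k ≤ side k' ∧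
          1 / C₀ * (σ Q').toReal ≤ ‖∫ y in Q', b k Q y ∂σ‖) ∧
        ∫⁻ x in tent ρ D I s K Q, ‖Theta θ σ (b k Q) x‖ₑ ^ 2 *
          ENNReal.ofReal (deltaE ρ' E x ^ (2 * υ - (m - d))) ∂μ ≤ ENNReal.ofReal C₀ * σ Q) →
      ∀ f : E → ℂ, MemLp f 2 σ →
        (∀ x ∈ Eᶜ, Integrable (fun y : E => (θ x y : ℂ) * f y) σ) ∧
        ∫⁻ x in Eᶜ, ‖Theta θ σ f x‖ₑ ^ 2 *
          ENNReal.ofReal (deltaE ρ' E x ^ (2 * υ - (m - d))) ∂μ ≤ C * ∫⁻ y, ‖f y‖ₑ ^ 2 ∂σ := by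
  have hm : 0 ≤ m := by linarith
  have hCρ0 : 0 ≤ Cρ := by linarith
  -- The gain is limited by the Hölder exponent, by the decay and by the thin boundary exponent. The
  -- halves reflect the intermediate scale halfway between two generations.
  set ε : ℝ := min α (min (υ / 2) (η / 2)) with hεdef
  have hε : 0 < ε := by positivity
  have hεα : ε ≤ α := min_le_left _ _
  have hευ : 2 * ε ≤ υ := by
    have : ε ≤ υ / 2 := (min_le_right _ _).trans (min_le_left _ _)
    linarith
  have hεη : 2 * ε ≤ η := by
    have : ε ≤ η / 2 := (min_le_right _ _).trans (min_le_right _ _)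
    linarith
  obtain ⟨CX, hCX⟩ := IsADR.measure_ball_le_all.{u, u} Cs Cρ m AX N hCs hCρ hm
  obtain ⟨CE, hCE⟩ := IsADR.measure_ball_le_all.{u, u} Cs Cρ d AE N hCs hCρ hd.le
  obtain ⟨Λ, hΛ⟩ := IsDyadic.exists_dyadicSpace.{u} d η Cs Cρ AE a₀ a₁ c CE hCρ hAE ha₀
  obtain ⟨B, hB⟩ := IsWhitney.isWhitneyFamily.{u} d m υ α ε η Cs Cρ L W Cθ (2 * Cρ * W) Λ CX hd.le
    hυ.le hα.le hε.le hεα hCθ.le hCρ0 hL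
  obtain ⟨C₁, hC₁⟩ := IsWhitneyFamily.tsum_lintegral_le.{u, u} d υ ε η Λ B hd.le hε hευ hεη C₀ c₀
    hC₀ hc₀
  obtain ⟨C₂, hC₂⟩ := lintegral_far_le.{u} d m υ α Cs Cρ L W Cθ CE CX hd hm hυ.le hCθ.le hCρ0 hL
  refine ⟨C₁ + C₂, ?_⟩
  intro X _ ρ μ E σ ρ' D I s θ hρ hX hdbl hE hρ' hD hI hθ ⟨b, hb⟩ f hf
  have hballX : ∀ x r, 0 < r → μ (qBall ρ x r) ≤ CX * ENNReal.ofReal (r ^ m) :=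
    hCX id Function.injective_id hρ hdbl hX
  have hballE : ∀ x r, 0 < r → σ (qBall (restr ρ E) x r) ≤ CE * ENNReal.ofReal (r ^ d) :=
    hCE Subtype.val Subtype.val_injective hρ hdbl hE
  refine ⟨fun x hx => ?_, ?_⟩
  · set T : ℝ := max 1 (max (max Cs Cρ) (max L W)) with hTdef
    have hT : 1 ≤ T := le_max_left _ _
    rw [← hI.cover] at hx
    obtain ⟨j, hxj⟩ := mem_iUnion.1 hx
    obtain ⟨z, hz⟩ := hI.exists_isLocated hρ hρ' hT hCρ0 hL (by simp [hTdef]) (by simp [hTdef])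
      (by simp [hTdef]) (by simp [hTdef]) hxj
    rw [hI.cover] at hx
    exact hθ.integrable_mul hρ hE.borel_le hE.measurable_dist hballE hx hz (hI.size_pos j)
      (by positivity) hCθ.le hd.le hυ hα.le hf
  obtain ⟨z, hDS⟩ := hΛ (hρ.comap Subtype.val_injective) hE hballE hD
  -- Empty members are left out, since an assignment needs a point of `I j` close to the cube.
  set S : Set ℕ := {j | (I j).Nonempty ∧ ENNReal.ofReal (s j) ≤ qDiam (restr ρ E)} with hS
  have hex : ∀ j, ∃ p, j ∈ S → IsAssigned ρ D I s (2 * Cρ * W) j p := by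
    intro j
    by_cases hj : j ∈ S
    · obtain ⟨p, hp⟩ := hI.exists_isAssigned hW hCρ hρ (by linarith) hE hD hj.1 hj.2
      exact ⟨p, fun _ => hp⟩
    · exact ⟨(0, ∅), fun h => absurd h hj⟩
  choose q hq using hex
  have hV := hB (μ := μ) hρ hρ' hθ hI hDS hX.borel_le hE.borel_le hballX hq
  have hK2 : 2 ≤ K := by nlinarith
  have : Nonempty X := hX.nontrivial.to_nonempty
  set g : X → ℝ≥0∞ := fun x => ‖Theta θ σ f x‖ₑ ^ 2 *
    ENNReal.ofReal (deltaE ρ' E x ^ (2 * υ - (m - d))) with hg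
  have hnear : ∑' p : cubes D, ∫⁻ x in whitneyPart I S q p.1.1 p.1.2, g x ∂μ ≤
      C₁ * ∫⁻ y, ‖f y‖ₑ ^ 2 ∂σ := by
    refine hC₁ hDS hV (fun k Q hQ => ?_) f hf
    obtain ⟨h1, h2, h3, h4⟩ := hb k Q hQ
    refine ⟨b k Q, h1, h2, hD.exists_le_generation hc₀1 hQ h3, ?_⟩
    exact (tsum_desc_lintegral_le hI.measurable hD.countable hq hK hK2 k Q _).trans h4
  have hfar := hC₂ hρ hρ' hθ hI hE.nontrivial hX.measurable_dist hballX hballE f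
    hf.aestronglyMeasurable
  have hcov : Eᶜ ⊆ (⋃ p : cubes D, whitneyPart I S q p.1.1 p.1.2) ∪
      ⋃ j ∈ {j | qDiam (restr ρ E) < ENNReal.ofReal (s j)}, I j := by
    intro x hx
    rw [← hI.cover, ← iUnion_disjointed] at hx
    obtain ⟨j, hxj⟩ := mem_iUnion.1 hx
    have hxI := disjointed_subset I j hxj
    rcases le_or_gt (ENNReal.ofReal (s j)) (qDiam (restr ρ E)) with hj | hj
    · have hjS : j ∈ S := ⟨⟨x, hxI⟩, hj⟩
      exact Or.inl (mem_iUnion.2 ⟨⟨q j, (hq j hjS).1⟩, mem_iUnion₂.2 ⟨j, ⟨hjS, rfl⟩, hxj⟩⟩)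
    · exact Or.inr (mem_iUnion₂.2 ⟨j, hj, hxI⟩)
  have : Countable (cubes D) := (countable_cubes hD.countable).to_subtype
  calc ∫⁻ x in Eᶜ, g x ∂μ
      ≤ ∫⁻ x in (⋃ p : cubes D, whitneyPart I S q p.1.1 p.1.2) ∪
          ⋃ j ∈ {j | qDiam (restr ρ E) < ENNReal.ofReal (s j)}, I j, g x ∂μ :=
        lintegral_mono_set hcov
    _ ≤ ∑' p : cubes D, ∫⁻ x in whitneyPart I S q p.1.1 p.1.2, g x ∂μ +
          ∫⁻ x in ⋃ j ∈ {j | qDiam (restr ρ E) < ENNReal.ofReal (s j)}, I j, g x ∂μ :=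
        (lintegral_union_le _ _ _).trans (add_le_add (lintegral_iUnion_le _ _) le_rfl)
    _ ≤ C₁ * ∫⁻ y, ‖f y‖ₑ ^ 2 ∂σ + C₂ * ∫⁻ y, ‖f y‖ₑ ^ 2 ∂σ := add_le_add hnear hfar
    _ = _ := by
        push_cast
        ring

end LocalTb

theorem theorem2p1
    -- dimensions, and the constants of `ρ`, of the ADR conditions and of geometric doubling
    (d m : ℝ) (hd : 0 < d) (hdm : d < m)
    (Cs Cρ AX AE : ℝ) (hCs : 1 ≤ Cs) (hCρ : 1 ≤ Cρ) (hAX : 1 ≤ AX) (hAE : 1 ≤ AE) (N : ℕ)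
    -- constants of the regularization, of the dyadic cubes and of the Whitney covering
    (L : ℝ) (hL : 1 ≤ L)
    (a₀ a₁ η c : ℝ) (ha₀ : 0 < a₀) (ha₁ : a₀ ≤ a₁) (hη : 0 < η) (hc : 0 < c)
    (W : ℝ) (hW : 1 ≤ W) (M : ℕ) :
    -- the constant in the definition of the regions `U_Q` is sufficiently large
    ∃ K₀ : ℝ, 1 ≤ K₀ ∧ ∀ K : ℝ, K₀ ≤ K →
    ∀ υ α Cθ C₀ c₀ : ℝ, 0 < υ → 0 < α → 0 < Cθ → 1 ≤ C₀ → 0 < c₀ → c₀ ≤ 1 →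
    ∃ C : ℝ, 0 < C ∧
    ∀ (X : Type*) [MeasurableSpace X] (ρ : X → X → ℝ) (μ : Measure X) (E : Set X) (σ : Measure E)
      (ρ' : X → X → ℝ) (D : ℤ → Set (Set E)) (I : ℕ → Set X) (s : ℕ → ℝ) (θ : X → X → ℝ),
      LocalTb.IsQuasiDist ρ Cs Cρ →
      LocalTb.IsADR ρ μ m AX →
      LocalTb.IsGeomDoubling ρ N →
      @IsClosed X (LocalTb.qTopology ρ) E →
      LocalTb.IsADR (LocalTb.restr ρ E) σ d AE →
      LocalTb.IsBorelRegular (LocalTb.restr ρ E) σ →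
      LocalTb.IsRegularization ρ ρ' E L →
      LocalTb.IsDyadic (LocalTb.restr ρ E) σ D a₀ a₁ η c →
      LocalTb.IsWhitney ρ E I s W M →
      LocalTb.IsKernel ρ θ d υ α Cθ →
      -- the functions `b_Q`
      (∃ b : ℤ → Set E → E → ℂ, ∀ k : ℤ, ∀ Q ∈ D k,
        AEStronglyMeasurable (b k Q) σ ∧
        ∫⁻ y, ‖b k Q y‖ₑ ^ 2 ∂σ ≤ ENNReal.ofReal C₀ * σ Q ∧
        (∃ k' : ℤ, ∃ Q' ∈ D k', Q' ⊆ Q ∧ c₀ * LocalTb.side k ≤ LocalTb.side k' ∧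
          1 / C₀ * (σ Q').toReal ≤ ‖∫ y in Q', b k Q y ∂σ‖) ∧
        ∫⁻ x in LocalTb.tent ρ D I s K Q, ‖LocalTb.Theta θ σ (b k Q) x‖ₑ ^ 2 *
          ENNReal.ofReal (LocalTb.deltaE ρ' E x ^ (2 * υ - (m - d))) ∂μ
            ≤ ENNReal.ofReal C₀ * σ Q) →
      ∀ f : E → ℂ, MemLp f 2 σ →
        (∀ x ∈ Eᶜ, Integrable (fun y : E => (θ x y : ℂ) * f y) σ) ∧
        ∫⁻ x in Eᶜ, ‖LocalTb.Theta θ σ f x‖ₑ ^ 2 *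
          ENNReal.ofReal (LocalTb.deltaE ρ' E x ^ (2 * υ - (m - d))) ∂μ
            ≤ ENNReal.ofReal C * ∫⁻ y, ‖f y‖ₑ ^ 2 ∂σ := by
  -- This is the distance constant of the assignment of Whitney sets to cubes. It is also at least
  -- `2`, which accounts for the comparison of sizes in the regions `U_Q`.
  refine ⟨2 * Cρ * W, by nlinarith, fun K hK υ α Cθ C₀ c₀ hυ hα hCθ hC₀ hc₀ hc₀1 => ?_⟩
  obtain ⟨C, hC⟩ := LocalTb.lintegral_sq_Theta_le d m hd hdm Cs Cρ AX AE hCs hCρ hAE N L hL a₀ a₁ η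
    c ha₀ hη W hW M K hK υ α Cθ C₀ c₀ hυ hα hCθ hC₀ hc₀ hc₀1
  refine ⟨C + 1, by positivity, ?_⟩
  intro X _ ρ μ E σ ρ' D I s θ hρ hX hdbl _ hE _ hρ' hD hI hθ hb f hf
  obtain ⟨h1, h2⟩ := hC X ρ μ E σ ρ' D I s θ hρ hX hdbl hE hρ' hD hI hθ hb f hf
  refine ⟨h1, h2.trans (mul_le_mul_left ?_ _)⟩
  rw [← ENNReal.ofReal_coe_nnreal]
  exact ENNReal.ofReal_le_ofReal (by linarith)
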